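/- Let $G\subset \mathrm{GL}_n(\mathbb R)$ be a closed subgroup with Lie algebra $\mathfrak g$. A *$G$-structure with connection* $(P,\theta,\omega)$ is a smooth manifold $P$ with $\dim P=n+\dim G$ and a smooth, proper, effective, locally free right $G$-action (with infinitesimal generators $\tilde\alpha$, $\alpha\in\mathfrak g$), together with a pointwise surjective 1-form $\theta\in\Omega^1(P,\mathbb R^n)$ with $\theta(\tilde\alpha)=0$ and $g^*\theta=g^{-1}\cdot\theta$, and a 1-form $\omega\in\Omega^1(P,\mathfrak g)$ with $\omega(\tilde\alpha)=\alpha$ and $g^*\omega=\mathrm{Ad}_{g^{-1}}\circ\omega$. A *local equivalence* is a diffeomorphism $\Phi$ between open subsets of $P$ with $\Phi^*\theta=\theta$ and $\Phi^*\omega=\omega$ (it then commutes with the infinitesimal action of $\mathfrak g$). An *invariant function* is a smooth $I:P\to\mathbb R$ with $I\circ\Phi=I$ on the domain of every local equivalence $\Phi$. $(P,\theta,\omega)$ is *fully regular* if the dimension of $\{\mathrm d_pI: I \text{ invariant}\}\subset T^*_pP$ does not depend on $p\in P$. Write $p\sim q$ if some local equivalence maps $p$ to $q$, and let $h:P\to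 X_{(\theta,\omega)}:=P/{\sim}$ be the quotient map onto the quotient space. Let $(P,\theta,\omega)$ be a fully regular $G$-structure with connection. Then: (a) $X_{(\theta,\omega)}$ with the quotient topology carries the structure of a smooth manifold (not necessarily Hausdorff) for which $h$ is a submersion. In what follows, $X_{(\theta,\omega)}$ carries any such structure. (b) The trivial bundle $A_{(\theta,\omega)}=X_{(\theta,\omega)}\times(\mathbb R^n\oplus\mathfrak g)$ carries a Lie algebroid structure, with anchor $\rho$ and differential $\mathrm d_A$, such that $H^*\mathrm d_A=\mathrm d H^*$ on functions and on 1-forms (sections of $A^*_{(\theta,\omega)}$), where $H=(\theta,\omega):TP\to A_{(\theta,\omega)}$ covers $h$. In what follows, $A_{(\theta,\omega)}$ carries any such structure; it is called the classifying Lie algebroid. (c) For every $p\in P$, the Lie algebra $\mathfrak X(P,\theta,\omega)_p$ of germs at $p$ of smooth vector fields $\xi$ with $\mathcal L_\xi\theta=0$ and $\mathcal L_\xi\omega=0$ is isomorphic to the isotropy Lie algebra $\ker\rho_{h(p)}\subset A_{(\theta,\omega)}$. In particular, it is finite-dimensional and $$\dim \mathfrak X(P,\theta,\omega)_p=\dim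 P-\dim X_{(\theta,\omega)}.$$ -/

import Mathlib

open scoped Manifold ContDiff Topology
open VectorField Filter

section VectorFields

variable {E : Type*} [NormedAddCommGroup E] [NormedSpace ℝ E]
  {M : Type*} [TopologicalSpace M] [ChartedSpace E M]

/-- The vector field `ξ` is smooth at the point `q`. -/
def SmoothVFAt [IsManifold 𝓘(ℝ, E) ∞ M] (ξ : Π q : M, TangentSpace 𝓘(ℝ, E) q) (q : M) : Prop :=
  ContMDiffAt 𝓘(ℝ, E) 𝓘(ℝ, E).tangent ∞ (fun r => (⟨r, ξ r⟩ : TangentBundle 𝓘(ℝ, E) M)) q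

/-- A `V`-valued 1-form `Θ` is smooth: it is smooth as a function on the total space `TM`. -/
def SmoothForm [IsManifold 𝓘(ℝ, E) ∞ M] {V : Type*} [NormedAddCommGroup V] [NormedSpace ℝ V]
    (Θ : Π q : M, TangentSpace 𝓘(ℝ, E) q →L[ℝ] V) : Prop :=
  ContMDiff 𝓘(ℝ, E).tangent 𝓘(ℝ, V) ∞ (fun v : TangentBundle 𝓘(ℝ, E) M => Θ v.proj v.snd)

/-- The Lie derivative `(L_ξ Θ)(Y) = ξ(Θ(Y)) - Θ([ξ, Y])` at `q`. -/
noncomputable def lieDerivForm {V : Type*} [NormedAddCommGroup V] [NormedSpace ℝ V]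
    (Θ : Π q : M, TangentSpace 𝓘(ℝ, E) q →L[ℝ] V) (ξ Y : Π q : M, TangentSpace 𝓘(ℝ, E) q)
    (q : M) : V :=
  mvfderiv 𝓘(ℝ, E) (fun r => Θ r (Y r)) q (ξ q) - Θ q (mlieBracket 𝓘(ℝ, E) ξ Y q)

/-- The exterior derivative `dΘ(ξ, η) = ξ(Θ(η)) - η(Θ(ξ)) - Θ([ξ, η])` at `q`. -/
noncomputable def extDerivForm {V : Type*} [NormedAddCommGroup V] [NormedSpace ℝ V]
    (Θ : Π q : M, TangentSpace 𝓘(ℝ, E) q →L[ℝ] V) (ξ η : Π q : M, TangentSpace 𝓘(ℝ, E) q)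
    (q : M) : V :=
  mvfderiv 𝓘(ℝ, E) (fun r => Θ r (η r)) q (ξ q) - mvfderiv 𝓘(ℝ, E) (fun r => Θ r (ξ r)) q (η q)
    - Θ q (mlieBracket 𝓘(ℝ, E) ξ η q)

variable [IsManifold 𝓘(ℝ, E) ∞ M] {ξ η ζ : Π q : M, TangentSpace 𝓘(ℝ, E) q} {q : M}

theorem SmoothVFAt.mdiff (h : SmoothVFAt ξ q) :
    MDifferentiableAt 𝓘(ℝ, E) 𝓘(ℝ, E).tangent (fun r => (⟨r, ξ r⟩ : TangentBundle 𝓘(ℝ, E) M)) q :=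
  ContMDiffAt.mdifferentiableAt (n := ∞) h (by simp)

theorem SmoothVFAt.zero : SmoothVFAt (0 : Π q : M, TangentSpace 𝓘(ℝ, E) q) q :=
  (Bundle.contMDiff_zeroSection ℝ (fun q : M => TangentSpace 𝓘(ℝ, E) q)).contMDiffAt

theorem SmoothVFAt.add (h : SmoothVFAt ξ q) (h' : SmoothVFAt η q) : SmoothVFAt (ξ + η) q :=
  ContMDiffAt.add_section h h'

theorem SmoothVFAt.const_smul (c : ℝ) (h : SmoothVFAt ξ q) : SmoothVFAt (c • ξ) q :=
  ContMDiffAt.const_smul_section h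

theorem SmoothVFAt.smul {f : M → ℝ} (hf : ContMDiffAt 𝓘(ℝ, E) 𝓘(ℝ, ℝ) ∞ f q)
    (h : SmoothVFAt ξ q) : SmoothVFAt (f • ξ) q :=
  ContMDiffAt.smul_section hf h

theorem SmoothVFAt.lie [CompleteSpace E] (h : SmoothVFAt ξ q) (h' : SmoothVFAt η q) :
    SmoothVFAt (mlieBracket 𝓘(ℝ, E) ξ η) q := by
  have : IsManifold 𝓘(ℝ, E) (((⊤ : ℕ∞) : WithTop ℕ∞) + 1) M := by simpa
  have : IsManifold 𝓘(ℝ, E) (minSmoothness ℝ 2) M := by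
    rw [minSmoothness_of_isRCLikeNormedField]; infer_instance
  exact ContMDiffAt.mlieBracket_vectorField (m := ⊤) (n := ⊤) h h' (by simp)

theorem SmoothVFAt.jacobi [CompleteSpace E] (h : SmoothVFAt ξ q) (h' : SmoothVFAt η q)
    (h'' : SmoothVFAt ζ q) :
    mlieBracket 𝓘(ℝ, E) ξ (mlieBracket 𝓘(ℝ, E) η ζ) q =
      mlieBracket 𝓘(ℝ, E) (mlieBracket 𝓘(ℝ, E) ξ η) ζ q +
        mlieBracket 𝓘(ℝ, E) η (mlieBracket 𝓘(ℝ, E) ξ ζ) q := by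
  have : IsManifold 𝓘(ℝ, E) (minSmoothness ℝ 3) M := by
    rw [minSmoothness_of_isRCLikeNormedField]; infer_instance
  have hle : minSmoothness ℝ 2 ≤ (∞ : WithTop ℕ∞) := by
    rw [minSmoothness_of_isRCLikeNormedField]; exact WithTop.coe_le_coe.2 le_top
  exact leibniz_identity_mlieBracket_apply (ContMDiffAt.of_le h hle) (ContMDiffAt.of_le h' hle)
    (ContMDiffAt.of_le h'' hle)

theorem SmoothForm.apply {V : Type*} [NormedAddCommGroup V] [NormedSpace ℝ V]
    {Θ : Π q : M, TangentSpace 𝓘(ℝ, E) q →L[ℝ] V} (hΘ : SmoothForm Θ) (h : SmoothVFAt ξ q) :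
    ContMDiffAt 𝓘(ℝ, E) 𝓘(ℝ, V) ∞ (fun r => Θ r (ξ r)) q :=
  (ContMDiff.contMDiffAt hΘ).comp q h

/-- The derivative of a function along `[ξ, η]` is the commutator of the derivatives along `ξ` and
`η`, which are assumed to be smooth functions `b` and `a`. -/
theorem mvfderiv_mlieBracket [CompleteSpace E] {f a b : M → ℝ} (hξ : SmoothVFAt ξ q)
    (hη : SmoothVFAt η q) (hξ' : ∀ᶠ r in 𝓝 q, SmoothVFAt ξ r) (hη' : ∀ᶠ r in 𝓝 q, SmoothVFAt η r)
    (hf : ∀ᶠ r in 𝓝 q, ContMDiffAt 𝓘(ℝ, E) 𝓘(ℝ, ℝ) ∞ f r)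
    (ha : ContMDiffAt 𝓘(ℝ, E) 𝓘(ℝ, ℝ) ∞ a q) (hb : ContMDiffAt 𝓘(ℝ, E) 𝓘(ℝ, ℝ) ∞ b q)
    (hfa : ∀ᶠ r in 𝓝 q, mvfderiv 𝓘(ℝ, E) f r (η r) = a r)
    (hfb : ∀ᶠ r in 𝓝 q, mvfderiv 𝓘(ℝ, E) f r (ξ r) = b r) :
    mvfderiv 𝓘(ℝ, E) f q (mlieBracket 𝓘(ℝ, E) ξ η q) =
      mvfderiv 𝓘(ℝ, E) a q (ξ q) - mvfderiv 𝓘(ℝ, E) b q (η q) := by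
  have key : ∀ ζ : Π q : M, TangentSpace 𝓘(ℝ, E) q, (∀ᶠ r in 𝓝 q, SmoothVFAt ζ r) → ζ q ≠ 0 →
      mvfderiv 𝓘(ℝ, E) f q (mlieBracket 𝓘(ℝ, E) ξ η q) =
      mvfderiv 𝓘(ℝ, E) a q (ξ q) - mvfderiv 𝓘(ℝ, E) b q (η q) := by
    intro ζ hζ' h0
    have hζ := hζ'.self_of_nhds
    have hfq := hf.self_of_nhds
    have md : ∀ {g : M → ℝ} {r : M}, ContMDiffAt 𝓘(ℝ, E) 𝓘(ℝ, ℝ) ∞ g r →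
        MDifferentiableAt 𝓘(ℝ, E) 𝓘(ℝ, ℝ) g r := fun h => h.mdifferentiableAt (by simp)
    have e1 : mlieBracket 𝓘(ℝ, E) η (f • ζ) =ᶠ[𝓝 q]
        (a • ζ + f • mlieBracket 𝓘(ℝ, E) η ζ : Π q : M, TangentSpace 𝓘(ℝ, E) q) := by
      filter_upwards [hf, hζ', hfa] with r h1 h2 h3
      rw [mlieBracket_smul_right (md h1) h2.mdiff, h3]; rfl
    have e2 : mlieBracket 𝓘(ℝ, E) ξ (f • ζ) =ᶠ[𝓝 q]
        (b • ζ + f • mlieBracket 𝓘(ℝ, E) ξ ζ : Π q : M, TangentSpace 𝓘(ℝ, E) q) := by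
      filter_upwards [hf, hζ', hfb] with r h1 h2 h3
      rw [mlieBracket_smul_right (md h1) h2.mdiff, h3]; rfl
    have J := SmoothVFAt.jacobi hξ hη (hζ.smul hfq)
    have J0 := SmoothVFAt.jacobi hξ hη hζ
    rw [(EventuallyEq.refl _ ξ).mlieBracket_vectorField_eq e1,
      (EventuallyEq.refl _ η).mlieBracket_vectorField_eq e2,
      mlieBracket_smul_right (md hfq) hζ.mdiff,
      mlieBracket_add_right (hζ.smul ha).mdiff ((hη.lie hζ).smul hfq).mdiff,
      mlieBracket_add_right (hζ.smul hb).mdiff ((hξ.lie hζ).smul hfq).mdiff,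
      mlieBracket_smul_right (md ha) hζ.mdiff, mlieBracket_smul_right (md hb) hζ.mdiff,
      mlieBracket_smul_right (md hfq) (hη.lie hζ).mdiff,
      mlieBracket_smul_right (md hfq) (hξ.lie hζ).mdiff, hfa.self_of_nhds, hfb.self_of_nhds, J0] at J
    have : (mvfderiv 𝓘(ℝ, E) f q (mlieBracket 𝓘(ℝ, E) ξ η q) -
      (mvfderiv 𝓘(ℝ, E) a q (ξ q) - mvfderiv 𝓘(ℝ, E) b q (η q))) • ζ q = 0 := by
      rw [← sub_eq_zero] at J
      rw [← neg_eq_zero, ← J]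
      module
    rcases smul_eq_zero.1 this with h | h
    · exact sub_eq_zero.1 h
    · exact absurd h h0
  by_cases h1 : ξ q = 0
  · by_cases h2 : η q = 0
    · rw [h1, h2, ← mlieBracketWithin_univ, mlieBracketWithin_eq_zero_of_eq_zero h1 h2]; simp
    · exact key η hη' h2
  · exact key ξ hξ' h1

/-- The vector field `ξ` preserves the 1-form `Θ` at `q`: the Lie derivative vanishes there. -/
def PreservesFormAt {V : Type*} [NormedAddCommGroup V] [NormedSpace ℝ V]
    (Θ : Π q : M, TangentSpace 𝓘(ℝ, E) q →L[ℝ] V) (ξ : Π q : M, TangentSpace 𝓘(ℝ, E) q)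
    (q : M) : Prop :=
  ∀ Y : Π q : M, TangentSpace 𝓘(ℝ, E) q, (∀ᶠ r in 𝓝 q, SmoothVFAt Y r) →
    lieDerivForm Θ ξ Y q = 0

section
variable {V : Type*} [NormedAddCommGroup V] [NormedSpace ℝ V]
  {Θ : Π q : M, TangentSpace 𝓘(ℝ, E) q →L[ℝ] V}

theorem PreservesFormAt.add [CompleteSpace E] (h1 : SmoothVFAt ξ q) (h2 : SmoothVFAt η q)
    (h : PreservesFormAt Θ ξ q) (h' : PreservesFormAt Θ η q) : PreservesFormAt Θ (ξ + η) q := by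
  intro Y hY
  have e := h Y hY
  have e' := h' Y hY
  unfold lieDerivForm at *
  rw [mlieBracket_add_left h1.mdiff h2.mdiff]
  simp only [Pi.add_apply, map_add]
  rw [← add_zero (0 : V)]
  nth_rw 1 [← e]; rw [← e']; abel

theorem PreservesFormAt.const_smul [CompleteSpace E] (c : ℝ) (h1 : SmoothVFAt ξ q)
    (h : PreservesFormAt Θ ξ q) : PreservesFormAt Θ (c • ξ) q := by
  intro Y hY
  have e := h Y hY
  unfold lieDerivForm at *
  rw [mlieBracket_const_smul_left h1.mdiff]
  simp only [Pi.smul_apply, map_smul]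
  rw [← smul_sub, e, smul_zero]

theorem PreservesFormAt.zero [CompleteSpace E] : PreservesFormAt Θ 0 q := by
  intro Y hY
  simp [lieDerivForm]

theorem PreservesFormAt.congr {η : Π q : M, TangentSpace 𝓘(ℝ, E) q} (h : PreservesFormAt Θ ξ q)
    (hξη : ξ =ᶠ[𝓝 q] η) : PreservesFormAt Θ η q := by
  intro Y hY
  have e := h Y hY
  unfold lieDerivForm at *
  rw [← hξη.mlieBracket_vectorField_eq (EventuallyEq.refl _ Y), ← hξη.self_of_nhds, e]

theorem PreservesFormAt.lie [CompleteSpace E] (hΘ : SmoothForm Θ)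
    (hξ : ∀ᶠ r in 𝓝 q, SmoothVFAt ξ r) (hη : ∀ᶠ r in 𝓝 q, SmoothVFAt η r)
    (h : ∀ᶠ r in 𝓝 q, PreservesFormAt Θ ξ r) (h' : ∀ᶠ r in 𝓝 q, PreservesFormAt Θ η r) :
    PreservesFormAt Θ (mlieBracket 𝓘(ℝ, E) ξ η) q := by
  intro Y hY
  have hξY : ∀ᶠ r in 𝓝 q, SmoothVFAt (mlieBracket 𝓘(ℝ, E) ξ Y) r := by
    filter_upwards [hξ, hY] with r h1 h2 using h1.lie h2
  have hηY : ∀ᶠ r in 𝓝 q, SmoothVFAt (mlieBracket 𝓘(ℝ, E) η Y) r := by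
    filter_upwards [hη, hY] with r h1 h2 using h1.lie h2
  refine sub_eq_zero.2 ((SeparatingDual.eq_iff_forall_dual_eq (R := ℝ)).2 fun φ => ?_)
  have D : ∀ (Z X : Π q : M, TangentSpace 𝓘(ℝ, E) q) {r : M}, SmoothVFAt Z r →
      mvfderiv 𝓘(ℝ, E) (fun s => φ (Θ s (Z s))) r (X r) =
      φ (mvfderiv 𝓘(ℝ, E) (fun s => Θ s (Z s)) r (X r)) := by
    intro Z X r hZ
    have := mfderiv_comp r (I := 𝓘(ℝ, E)) (I' := 𝓘(ℝ, V)) (I'' := 𝓘(ℝ, ℝ)) (g := φ)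
      (f := fun s => Θ s (Z s)) φ.differentiableAt.mdifferentiableAt
      ((hΘ.apply hZ).mdifferentiableAt (by simp))
    rw [mfderiv_eq_fderiv, φ.fderiv] at this
    exact congrArg (fun L => L (X r)) this
  have S : ∀ (Z : Π q : M, TangentSpace 𝓘(ℝ, E) q) {r : M}, SmoothVFAt Z r →
      ContMDiffAt 𝓘(ℝ, E) 𝓘(ℝ, ℝ) ∞ (fun s => φ (Θ s (Z s))) r := fun Z r hZ =>
    φ.contDiff.contMDiff.contMDiffAt.comp r (hΘ.apply hZ)
  have C := mvfderiv_mlieBracket (f := fun s => φ (Θ s (Y s)))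
    (a := fun s => φ (Θ s (mlieBracket 𝓘(ℝ, E) η Y s)))
    (b := fun s => φ (Θ s (mlieBracket 𝓘(ℝ, E) ξ Y s)))
    hξ.self_of_nhds hη.self_of_nhds hξ hη
    (by filter_upwards [hY] with r hr using S Y hr) (S _ hηY.self_of_nhds) (S _ hξY.self_of_nhds)
    (by filter_upwards [hY, hY.eventually_nhds, h'] with r h1 h2 h3
        rw [D _ _ h1, sub_eq_zero.1 (h3 Y h2)])
    (by filter_upwards [hY, hY.eventually_nhds, h] with r h1 h2 h3
        rw [D _ _ h1, sub_eq_zero.1 (h3 Y h2)])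
  rw [D _ _ hY.self_of_nhds, D _ _ hηY.self_of_nhds, D _ _ hξY.self_of_nhds,
    sub_eq_zero.1 (h.self_of_nhds _ hηY), sub_eq_zero.1 (h'.self_of_nhds _ hξY),
    SmoothVFAt.jacobi hξ.self_of_nhds hη.self_of_nhds hY.self_of_nhds] at C
  rw [C, map_add, map_add, add_sub_cancel_right]
end

variable (E) in
/-- Vector fields that are smooth near `p`. -/
def smoothVFNear (p : M) : Submodule ℝ (Π q : M, TangentSpace 𝓘(ℝ, E) q) where
  carrier := {ξ | ∀ᶠ q in 𝓝 p, SmoothVFAt ξ q}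
  add_mem' h h' := by
    filter_upwards [h, h'] with q h1 h2 using h1.add h2
  zero_mem' := Eventually.of_forall fun q => SmoothVFAt.zero
  smul_mem' c ξ h := by
    filter_upwards [h] with q h1 using h1.const_smul c

variable (E) in
/-- Vector fields, smooth near `p`, that vanish near `p`. -/
def nullVFNear (p : M) : Submodule ℝ (smoothVFNear E p) where
  carrier := {ξ | ∀ᶠ q in 𝓝 p, ξ.1 q = 0}
  add_mem' {ξ η} h h' := by
    filter_upwards [h, h'] with q h1 h2
    change ξ.1 q + η.1 q = 0
    rw [h1, h2, add_zero]
  zero_mem' := Eventually.of_forall fun q => rfl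
  smul_mem' c ξ h := by
    filter_upwards [h] with q h1
    change c • ξ.1 q = 0
    rw [h1, smul_zero]

variable (E) in
/-- The space of germs at `p` of smooth vector fields. -/
abbrev VFGerm (p : M) : Type _ := smoothVFNear E p ⧸ nullVFNear E p

theorem VFGerm.mk_eq_iff {p : M} {ξ η : smoothVFNear E p} :
    (Submodule.Quotient.mk ξ : VFGerm E p) = Submodule.Quotient.mk η ↔ ξ.1 =ᶠ[𝓝 p] η.1 := by
  rw [Submodule.Quotient.eq]
  exact eventually_congr (Eventually.of_forall fun q => sub_eq_zero)

variable [FiniteDimensional ℝ E]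

/-- The Lie bracket of two vector fields that are smooth near `p`. -/
noncomputable def lieNear {p : M} (ξ η : smoothVFNear E p) : smoothVFNear E p :=
  ⟨mlieBracket 𝓘(ℝ, E) ξ.1 η.1, by
    have := FiniteDimensional.complete ℝ E
    filter_upwards [ξ.2, η.2] with q h1 h2 using h1.lie h2⟩

noncomputable instance (p : M) : Bracket (VFGerm E p) (VFGerm E p) where
  bracket := Quotient.map₂ lieNear fun ξ ξ' h η η' h' => by
    have h := VFGerm.mk_eq_iff.1 (Quotient.sound h)
    have h' := VFGerm.mk_eq_iff.1 (Quotient.sound h')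
    refine Quotient.exact (VFGerm.mk_eq_iff.2 ?_)
    filter_upwards [h.eventuallyEq_nhds, h'.eventuallyEq_nhds] with q h1 h2
      using h1.mlieBracket_vectorField_eq h2

theorem VFGerm.lie_mk {p : M} (ξ η : smoothVFNear E p) :
    ⁅(Submodule.Quotient.mk ξ : VFGerm E p), (Submodule.Quotient.mk η : VFGerm E p)⁆ =
      Submodule.Quotient.mk (lieNear ξ η) := rfl

noncomputable instance (p : M) : LieRing (VFGerm E p) where
  add_lie x y z := by
    have := FiniteDimensional.complete ℝ E
    induction x using Submodule.Quotient.induction_on with | _ x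
    induction y using Submodule.Quotient.induction_on with | _ y
    induction z using Submodule.Quotient.induction_on with | _ z
    rw [← Submodule.Quotient.mk_add]
    simp only [VFGerm.lie_mk]
    rw [← Submodule.Quotient.mk_add]
    refine VFGerm.mk_eq_iff.2 ?_
    filter_upwards [x.2, y.2] with q h1 h2
    exact mlieBracket_add_left h1.mdiff h2.mdiff
  lie_add x y z := by
    have := FiniteDimensional.complete ℝ E
    induction x using Submodule.Quotient.induction_on with | _ x
    induction y using Submodule.Quotient.induction_on with | _ y
    induction z using Submodule.Quotient.induction_on with | _ z
    rw [← Submodule.Quotient.mk_add]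
    simp only [VFGerm.lie_mk]
    rw [← Submodule.Quotient.mk_add]
    refine VFGerm.mk_eq_iff.2 ?_
    filter_upwards [y.2, z.2] with q h1 h2
    exact mlieBracket_add_right h1.mdiff h2.mdiff
  lie_self x := by
    induction x using Submodule.Quotient.induction_on with | _ x
    rw [VFGerm.lie_mk, ← Submodule.Quotient.mk_zero]
    refine VFGerm.mk_eq_iff.2 (Eventually.of_forall fun q => ?_)
    have h := mlieBracket_swap_apply (I := 𝓘(ℝ, E)) (V := x.1) (W := x.1) (x := q)
    have h2 : (2 : ℝ) • mlieBracket 𝓘(ℝ, E) x.1 x.1 q = 0 := by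
      rw [two_smul]
      nth_rw 1 [h]
      exact neg_add_cancel _
    exact (smul_eq_zero.1 h2).resolve_left two_ne_zero
  leibniz_lie x y z := by
    have := FiniteDimensional.complete ℝ E
    induction x using Submodule.Quotient.induction_on with | _ x
    induction y using Submodule.Quotient.induction_on with | _ y
    induction z using Submodule.Quotient.induction_on with | _ z
    simp only [VFGerm.lie_mk]
    rw [← Submodule.Quotient.mk_add]
    refine VFGerm.mk_eq_iff.2 ?_
    filter_upwards [x.2, y.2, z.2] with q h1 h2 h3
    exact h1.jacobi h2 h3

noncomputable instance (p : M) : LieAlgebra ℝ (VFGerm E p) where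
  lie_smul c x y := by
    have := FiniteDimensional.complete ℝ E
    induction x using Submodule.Quotient.induction_on with | _ x
    induction y using Submodule.Quotient.induction_on with | _ y
    rw [← Submodule.Quotient.mk_smul]
    simp only [VFGerm.lie_mk]
    rw [← Submodule.Quotient.mk_smul]
    refine VFGerm.mk_eq_iff.2 ?_
    filter_upwards [y.2] with q h2
    exact mlieBracket_const_smul_right h2.mdiff

/-- The Lie algebra of germs at `p` of vector fields `ξ` with `L_ξ Θ = 0`. -/
noncomputable def germsPreserving {V : Type*} [NormedAddCommGroup V] [NormedSpace ℝ V]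
    (Θ : Π q : M, TangentSpace 𝓘(ℝ, E) q →L[ℝ] V) (hΘ : SmoothForm Θ) (p : M) :
    LieSubalgebra ℝ (VFGerm E p) where
  carrier := {x | ∃ ξ : smoothVFNear E p, Submodule.Quotient.mk ξ = x ∧
    ∀ᶠ q in 𝓝 p, PreservesFormAt Θ ξ.1 q}
  add_mem' := by
    have := FiniteDimensional.complete ℝ E
    rintro _ _ ⟨ξ, rfl, h⟩ ⟨η, rfl, h'⟩
    refine ⟨ξ + η, rfl, ?_⟩
    filter_upwards [ξ.2, η.2, h, h'] with q h1 h2 h3 h4 using h3.add h1 h2 h4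
  zero_mem' := by
    have := FiniteDimensional.complete ℝ E
    exact ⟨0, rfl, Eventually.of_forall fun q => PreservesFormAt.zero⟩
  smul_mem' := by
    have := FiniteDimensional.complete ℝ E
    rintro c _ ⟨ξ, rfl, h⟩
    refine ⟨c • ξ, rfl, ?_⟩
    filter_upwards [ξ.2, h] with q h1 h3 using h3.const_smul c h1
  lie_mem' := by
    have := FiniteDimensional.complete ℝ E
    rintro _ _ ⟨ξ, rfl, h⟩ ⟨η, rfl, h'⟩
    refine ⟨lieNear ξ η, rfl, ?_⟩
    filter_upwards [ξ.2.eventually_nhds, η.2.eventually_nhds, h.eventually_nhds,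
      h'.eventually_nhds] with q h1 h2 h3 h4 using PreservesFormAt.lie hΘ h1 h2 h3 h4

end VectorFields

section Algebroid

variable (F : Type*) [NormedAddCommGroup F] [NormedSpace ℝ F]
  (X : Type*) [TopologicalSpace X] [ChartedSpace F X] [IsManifold 𝓘(ℝ, F) ∞ X]
  (V : Type*) [NormedAddCommGroup V] [NormedSpace ℝ V]

/-- A Lie algebroid structure on the trivial vector bundle `X × V → X`. Sections are the smooth
maps `X → V`. -/
structure TrivialLieAlgebroid where
  /-- the anchor `ρ : X × V → TX` -/
  anchor : Π x : X, V →L[ℝ] TangentSpace 𝓘(ℝ, F) x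
  anchor_smooth : ContMDiff (𝓘(ℝ, F).prod 𝓘(ℝ, V)) 𝓘(ℝ, F).tangent ∞
    (fun z : X × V => (⟨z.1, anchor z.1 z.2⟩ : TangentBundle 𝓘(ℝ, F) X))
  /-- the bracket on sections -/
  bracket : C^∞⟮𝓘(ℝ, F), X; 𝓘(ℝ, V), V⟯ → C^∞⟮𝓘(ℝ, F), X; 𝓘(ℝ, V), V⟯ →
    C^∞⟮𝓘(ℝ, F), X; 𝓘(ℝ, V), V⟯
  bracket_add : ∀ s t u, bracket s (t + u) = bracket s t + bracket s u
  bracket_smul : ∀ (c : ℝ) s t, bracket s (c • t) = c • bracket s t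
  bracket_skew : ∀ s t, bracket t s = - bracket s t
  bracket_jacobi : ∀ s t u,
    bracket s (bracket t u) = bracket (bracket s t) u + bracket t (bracket s u)
  bracket_leibniz : ∀ (f : C^∞⟮𝓘(ℝ, F), X; 𝓘(ℝ, ℝ), ℝ⟯) s t (x : X),
    bracket s (f • t) x = f x • bracket s t x + mvfderiv 𝓘(ℝ, F) f x (anchor x (s x)) • t x
  anchor_bracket : ∀ s t (x : X), anchor x (bracket s t x) =
    mlieBracket 𝓘(ℝ, F) (fun y => anchor y (s y)) (fun y => anchor y (t y)) x

variable {F X V}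

namespace TrivialLieAlgebroid

variable (A : TrivialLieAlgebroid F X V)

/-- The differential `d_A f` of a function, `⟨s, d_A f⟩ = ρ(s) f`. -/
noncomputable def dFunction (f : X → ℝ) (x : X) (a : V) : ℝ :=
  mvfderiv 𝓘(ℝ, F) f x (A.anchor x a)

variable (F X) in
/-- The constant section with value `a`. -/
noncomputable def constSection (a : V) : C^∞⟮𝓘(ℝ, F), X; 𝓘(ℝ, V), V⟯ := ContMDiffMap.const a

/-- The differential of a section `η` of `A^*`,
`d_Aη(s, t) = ρ(s)⟨t, η⟩ - ρ(t)⟨s, η⟩ - ⟨[s, t], η⟩`, at `x`, where the sections `s`, `t` through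
`a`, `b` are taken constant. -/
noncomputable def dForm (η : X → V →L[ℝ] ℝ) (x : X) (a b : V) : ℝ :=
  mvfderiv 𝓘(ℝ, F) (fun y => η y b) x (A.anchor x a)
    - mvfderiv 𝓘(ℝ, F) (fun y => η y a) x (A.anchor x b)
    - η x (A.bracket (constSection F X a) (constSection F X b) x)

theorem bracket_zero_right (s : C^∞⟮𝓘(ℝ, F), X; 𝓘(ℝ, V), V⟯) : A.bracket s 0 = 0 := by
  have := A.bracket_smul 0 s 0
  simpa using this

theorem bracket_sum {ι : Type*} (S : Finset ι) (s : C^∞⟮𝓘(ℝ, F), X; 𝓘(ℝ, V), V⟯)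
    (t : ι → C^∞⟮𝓘(ℝ, F), X; 𝓘(ℝ, V), V⟯) :
    A.bracket s (∑ i ∈ S, t i) = ∑ i ∈ S, A.bracket s (t i) := by
  classical
  induction S using Finset.induction_on with
  | empty => simp [bracket_zero_right]
  | insert i S hi ih => rw [Finset.sum_insert hi, Finset.sum_insert hi, bracket_add, ih]

theorem bracket_skew_apply (s t : C^∞⟮𝓘(ℝ, F), X; 𝓘(ℝ, V), V⟯) (x : X) :
    A.bracket t s x = - A.bracket s t x := by
  rw [A.bracket_skew]; rfl

theorem anchor_bracket_eq_zero {s t : C^∞⟮𝓘(ℝ, F), X; 𝓘(ℝ, V), V⟯} {x : X}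
    (hs : A.anchor x (s x) = 0) (ht : A.anchor x (t x) = 0) :
    A.anchor x (A.bracket s t x) = 0 := by
  rw [A.anchor_bracket, ← mlieBracketWithin_univ]
  exact mlieBracketWithin_eq_zero_of_eq_zero hs ht

/-- The isotropy Lie algebra `ker ρ_x`. -/
abbrev Isotropy (x : X) : Type _ := LinearMap.ker (A.anchor x).toLinearMap

/-- The bracket `[a, b] = [s, t](x)` of the isotropy Lie algebra at `x`, where `s`, `t` are
sections through `a`, `b`; the choice is irrelevant by `Isotropy.coe_lie_eq` below. -/
noncomputable instance (x : X) : Bracket (A.Isotropy x) (A.Isotropy x) where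
  bracket a b := ⟨A.bracket (constSection F X a.1) (constSection F X b.1) x,
    A.anchor_bracket_eq_zero a.2 b.2⟩

theorem Isotropy.coe_lie {x : X} (a b : A.Isotropy x) :
    (⁅a, b⁆ : A.Isotropy x).1 = A.bracket (constSection F X a.1) (constSection F X b.1) x := rfl

variable [FiniteDimensional ℝ V]

/-- The value of `[s, t]` at `x` depends only on `t x` if `ρ(s)` vanishes at `x`. -/
theorem bracket_eq_zero {s t : C^∞⟮𝓘(ℝ, F), X; 𝓘(ℝ, V), V⟯} {x : X}
    (hs : A.anchor x (s x) = 0) (ht : t x = 0) : A.bracket s t x = 0 := by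
  let b := Module.finBasis ℝ V
  let c : Fin (Module.finrank ℝ V) → C^∞⟮𝓘(ℝ, F), X; 𝓘(ℝ, ℝ), ℝ⟯ := fun i =>
    ⟨fun y => b.coord i (t y),
      ((LinearMap.toContinuousLinearMap (b.coord i)).contDiff.contMDiff).comp t.contMDiff⟩
  have ev : ∀ (u : Fin (Module.finrank ℝ V) → C^∞⟮𝓘(ℝ, F), X; 𝓘(ℝ, V), V⟯) (y : X),
      (∑ i, u i) y = ∑ i, u i y := by
    intro u y
    have h := map_sum (ContMDiffMap.coeFnLinearMap (𝕜 := ℝ) (I := 𝓘(ℝ, F)) (N := X) (n := ∞)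
      (V := V)) u Finset.univ
    have h' := congrFun h y
    rw [Finset.sum_apply] at h'
    exact h'
  have ht' : t = ∑ i, c i • constSection F X (b i) := by
    ext y
    rw [ev]
    exact (b.sum_repr (t y)).symm
  have hc : ∀ i, c i x = 0 := fun i => by
    change b.coord i (t x) = 0
    rw [ht, map_zero]
  rw [ht', bracket_sum, ev]
  refine Finset.sum_eq_zero fun i _ => ?_
  rw [A.bracket_leibniz, hs, hc, map_zero, zero_smul, zero_smul, add_zero]

/-- If `ρ(a) = 0` at `x`, the value at `x` of the bracket of a section through `a` and a section
`t` depends only on the value of `t` at `x`. -/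
theorem bracket_congr {s t t' : C^∞⟮𝓘(ℝ, F), X; 𝓘(ℝ, V), V⟯} {x : X}
    (hs : A.anchor x (s x) = 0) (ht : t x = t' x) : A.bracket s t x = A.bracket s t' x := by
  have h : t = t' + (-1 : ℝ) • (t' + (-1 : ℝ) • t) := by
    ext y
    change t y = t' y + (-1 : ℝ) • (t' y + (-1 : ℝ) • t y)
    module
  rw [h, A.bracket_add, A.bracket_smul]
  change A.bracket s t' x + (-1 : ℝ) • A.bracket s (t' + (-1 : ℝ) • t) x = _
  rw [A.bracket_eq_zero (t := t' + (-1 : ℝ) • t) hs, smul_zero, add_zero]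
  change t' x + (-1 : ℝ) • t x = 0
  rw [ht]; module

theorem Isotropy.coe_lie_eq {x : X} (a b : A.Isotropy x) (s t : C^∞⟮𝓘(ℝ, F), X; 𝓘(ℝ, V), V⟯)
    (hs : s x = a.1) (ht : t x = b.1) : (⁅a, b⁆ : A.Isotropy x).1 = A.bracket s t x := by
  have ha : A.anchor x (s x) = 0 := by rw [hs]; exact a.2
  rw [coe_lie, A.bracket_congr (s := constSection F X a.1) (t' := t) a.2 ht.symm,
    A.bracket_skew_apply t, A.bracket_skew_apply t, A.bracket_congr (t' := s) (by rw [ht]; exact b.2) hs.symm]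

noncomputable instance (x : X) : LieRing (A.Isotropy x) where
  lie_add a b c := Subtype.ext <| by
    rw [Submodule.coe_add, Isotropy.coe_lie, Isotropy.coe_lie, Isotropy.coe_lie]
    change _ = (A.bracket _ _ + A.bracket _ _) x
    rw [← A.bracket_add]; rfl
  add_lie a b c := Subtype.ext <| by
    rw [Submodule.coe_add, Isotropy.coe_lie, Isotropy.coe_lie, Isotropy.coe_lie,
      A.bracket_skew_apply (constSection F X c.1), A.bracket_skew_apply (constSection F X c.1),
      A.bracket_skew_apply (constSection F X c.1), ← neg_add]
    change _ = - (A.bracket _ _ + A.bracket _ _) x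
    rw [← A.bracket_add]; rfl
  lie_self a := Subtype.ext <| by
    have h := A.bracket_skew_apply (constSection F X a.1) (constSection F X a.1) x
    have h2 : (2 : ℝ) • A.bracket (constSection F X a.1) (constSection F X a.1) x = 0 := by
      rw [two_smul]
      nth_rw 1 [h]
      exact neg_add_cancel _
    exact (smul_eq_zero.1 h2).resolve_left two_ne_zero
  leibniz_lie a b c := Subtype.ext <| by
    rw [Submodule.coe_add,
      Isotropy.coe_lie_eq A a ⁅b, c⁆ (constSection F X a.1)
        (A.bracket (constSection F X b.1) (constSection F X c.1)) rfl rfl,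
      Isotropy.coe_lie_eq A ⁅a, b⁆ c (A.bracket (constSection F X a.1) (constSection F X b.1))
        (constSection F X c.1) rfl rfl,
      Isotropy.coe_lie_eq A b ⁅a, c⁆ (constSection F X b.1)
        (A.bracket (constSection F X a.1) (constSection F X c.1)) rfl rfl, A.bracket_jacobi]
    rfl

noncomputable instance (x : X) : LieAlgebra ℝ (A.Isotropy x) where
  lie_smul r a b := Subtype.ext <| by
    rw [Submodule.coe_smul, Isotropy.coe_lie, Isotropy.coe_lie]
    change _ = (r • A.bracket _ _) x
    rw [← A.bracket_smul]; rfl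

end TrivialLieAlgebroid
end Algebroid

section GStructures

variable {n : ℕ} (𝔤 : Type*) [NormedAddCommGroup 𝔤] [NormedSpace ℝ 𝔤]
  (E : Type*) [NormedAddCommGroup E] [NormedSpace ℝ E]

/-- The differential at the unit of conjugation by `g`, on `T_1 G`, which is by definition the
model space `𝔤`. -/
noncomputable def AdG {G : Type*} [Group G] [TopologicalSpace G] [ChartedSpace 𝔤 G] (g : G) :
    𝔤 →L[ℝ] 𝔤 :=
  mfderiv 𝓘(ℝ, 𝔤) 𝓘(ℝ, 𝔤) (fun x : G => g * x * g⁻¹) 1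

/-- For a right action of `G` on `P`, the infinitesimal generators
`α ↦ d/dt|_{t=0} p · exp(tα)` at `p`, i.e. the differential at the unit of `g ↦ p · g`.
Tangent spaces of `P` are by definition copies of the model space `E`. -/
noncomputable def infGenerator {G : Type*} [Group G] [TopologicalSpace G] [ChartedSpace 𝔤 G]
    {P : Type*} [TopologicalSpace P] [ChartedSpace E P] (act : P → G → P) (p : P) :
    𝔤 →L[ℝ] TangentSpace 𝓘(ℝ, E) p :=
  mfderiv 𝓘(ℝ, 𝔤) 𝓘(ℝ, E) (fun g : G => act p g) 1

/-- A `G`-structure with connection `(P, θ, ω)`, for a Lie subgroup `G ⊂ GL_n(ℝ)` with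
Lie algebra `𝔤 = T_1 G`. -/
structure GStructureWithConnection (G : Subgroup (Matrix.GeneralLinearGroup (Fin n) ℝ))
    [ChartedSpace 𝔤 G] (P : Type*) [TopologicalSpace P] [ChartedSpace E P]
    [IsManifold 𝓘(ℝ, E) ∞ P] where
  /-- the right action of `G` on `P` -/
  act : P → G → P
  act_one : ∀ p, act p 1 = p
  act_mul : ∀ p g g', act p (g * g') = act (act p g) g'
  act_smooth : ContMDiff (𝓘(ℝ, E).prod 𝓘(ℝ, 𝔤)) 𝓘(ℝ, E) ∞ (fun z : P × G => act z.1 z.2)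
  act_proper : IsProperMap (fun z : P × G => (z.1, act z.1 z.2))
  act_locallyFree : ∀ p, Function.Injective (infGenerator 𝔤 E act p)
  act_effective : ∀ g, (∀ p, act p g = p) → g = 1
  dim_eq : Module.finrank ℝ E = n + Module.finrank ℝ 𝔤
  /-- the tautological form -/
  tautForm : Π p : P, TangentSpace 𝓘(ℝ, E) p →L[ℝ] (Fin n → ℝ)
  tautForm_smooth : SmoothForm tautForm
  tautForm_surjective : ∀ p, Function.Surjective (tautForm p)
  tautForm_horizontal : ∀ p (α : 𝔤), tautForm p (infGenerator 𝔤 E act p α) = 0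
  tautForm_equivariant : ∀ (g : G) p (v : TangentSpace 𝓘(ℝ, E) p),
    tautForm (act p g) (mfderiv 𝓘(ℝ, E) 𝓘(ℝ, E) (fun q => act q g) p v) =
      Matrix.mulVec (g⁻¹ : G).1.1 (tautForm p v)
  /-- the connection form -/
  connForm : Π p : P, TangentSpace 𝓘(ℝ, E) p →L[ℝ] 𝔤
  connForm_smooth : SmoothForm connForm
  connForm_vertical : ∀ p (α : 𝔤), connForm p (infGenerator 𝔤 E act p α) = α
  connForm_equivariant : ∀ (g : G) p (v : TangentSpace 𝓘(ℝ, E) p),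
    connForm (act p g) (mfderiv 𝓘(ℝ, E) 𝓘(ℝ, E) (fun q => act q g) p v) = AdG 𝔤 g⁻¹ (connForm p v)

namespace GStructureWithConnection

variable {𝔤 E} {G : Subgroup (Matrix.GeneralLinearGroup (Fin n) ℝ)} [ChartedSpace 𝔤 G]
  {P : Type*} [TopologicalSpace P] [ChartedSpace E P] [IsManifold 𝓘(ℝ, E) ∞ P]
  (S : GStructureWithConnection 𝔤 E G P)

/-- The coframe `H = (θ, ω)`. -/
noncomputable def coframe (p : P) : TangentSpace 𝓘(ℝ, E) p →L[ℝ] (Fin n → ℝ) × 𝔤 :=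
  (S.tautForm p).prod (S.connForm p)

theorem coframe_bijective [FiniteDimensional ℝ 𝔤] [FiniteDimensional ℝ E] (p : P) : Function.Bijective (S.coframe p) := by
  have hs : Function.Surjective (S.coframe p) := by
    rintro ⟨u, α⟩
    obtain ⟨v, hv⟩ := S.tautForm_surjective p u
    refine ⟨v + infGenerator 𝔤 E S.act p (α - S.connForm p v), ?_⟩
    change (S.tautForm p _, S.connForm p _) = _
    rw [map_add, map_add, S.tautForm_horizontal, S.connForm_vertical, hv]
    simp
  have : FiniteDimensional ℝ (TangentSpace 𝓘(ℝ, E) p) := inferInstanceAs (FiniteDimensional ℝ E)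
  have hd : Module.finrank ℝ (TangentSpace 𝓘(ℝ, E) p) =
      Module.finrank ℝ ((Fin n → ℝ) × 𝔤) := by
    rw [Module.finrank_prod, Module.finrank_fin_fun]
    exact S.dim_eq
  exact ⟨(LinearMap.injective_iff_surjective_of_finrank_eq_finrank hd
    (f := (S.coframe p).toLinearMap)).2 hs, hs⟩

/-- A local (self-)equivalence of `(P, θ, ω)`: a diffeomorphism between open subsets of `P` with
`Φ^*θ = θ` and `Φ^*ω = ω`. The open sets need not be `G`-saturated; equivariance under the
infinitesimal action is automatic, see `IsLocalEquiv.infGenerator` below. If the action of `G` is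
free, the germs of such maps are exactly the germs of `G`-equivariant equivalences between
`G`-saturated open sets. -/
structure IsLocalEquiv (Φ : OpenPartialHomeomorph P P) : Prop where
  smooth : ContMDiffOn 𝓘(ℝ, E) 𝓘(ℝ, E) ∞ Φ Φ.source
  smooth_symm : ContMDiffOn 𝓘(ℝ, E) 𝓘(ℝ, E) ∞ Φ.symm Φ.target
  pullback_taut : ∀ q ∈ Φ.source, ∀ v : TangentSpace 𝓘(ℝ, E) q,
    S.tautForm (Φ q) (mfderiv 𝓘(ℝ, E) 𝓘(ℝ, E) Φ q v) = S.tautForm q v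
  pullback_conn : ∀ q ∈ Φ.source, ∀ v : TangentSpace 𝓘(ℝ, E) q,
    S.connForm (Φ q) (mfderiv 𝓘(ℝ, E) 𝓘(ℝ, E) Φ q v) = S.connForm q v

variable {S}

theorem IsLocalEquiv.mdifferentiableAt {Φ : OpenPartialHomeomorph P P} (h : S.IsLocalEquiv Φ)
    {q : P} (hq : q ∈ Φ.source) : MDifferentiableAt 𝓘(ℝ, E) 𝓘(ℝ, E) Φ q :=
  (h.smooth.contMDiffAt (Φ.open_source.mem_nhds hq)).mdifferentiableAt (by simp)

theorem IsLocalEquiv.infGenerator [FiniteDimensional ℝ 𝔤] [FiniteDimensional ℝ E]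
    {Φ : OpenPartialHomeomorph P P} (h : S.IsLocalEquiv Φ)
    {q : P} (hq : q ∈ Φ.source) (α : 𝔤) :
    mfderiv 𝓘(ℝ, E) 𝓘(ℝ, E) Φ q (infGenerator 𝔤 E S.act q α) = infGenerator 𝔤 E S.act (Φ q) α := by
  apply (S.coframe_bijective (Φ q)).1
  change (S.tautForm _ _, S.connForm _ _) = (S.tautForm _ _, S.connForm _ _)
  rw [h.pullback_taut q hq, h.pullback_conn q hq, S.tautForm_horizontal, S.tautForm_horizontal, S.connForm_vertical,
    S.connForm_vertical]

theorem IsLocalEquiv.refl : S.IsLocalEquiv (OpenPartialHomeomorph.refl P) where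
  smooth := contMDiffOn_id
  smooth_symm := contMDiffOn_id
  pullback_taut q _ v := by
    change S.tautForm q (mfderiv 𝓘(ℝ, E) 𝓘(ℝ, E) (id : P → P) q v) = _
    rw [mfderiv_id]; rfl
  pullback_conn q _ v := by
    change S.connForm q (mfderiv 𝓘(ℝ, E) 𝓘(ℝ, E) (id : P → P) q v) = _
    rw [mfderiv_id]; rfl

theorem IsLocalEquiv.trans {Φ Ψ : OpenPartialHomeomorph P P} (h : S.IsLocalEquiv Φ)
    (h' : S.IsLocalEquiv Ψ) : S.IsLocalEquiv (Φ.trans Ψ) := by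
  have key : ∀ q ∈ (Φ.trans Ψ).source, mfderiv 𝓘(ℝ, E) 𝓘(ℝ, E) (Φ.trans Ψ) q =
      (mfderiv 𝓘(ℝ, E) 𝓘(ℝ, E) Ψ (Φ q)).comp (mfderiv 𝓘(ℝ, E) 𝓘(ℝ, E) Φ q) := by
    intro q hq
    rw [Φ.trans_source] at hq
    exact mfderiv_comp q (h'.mdifferentiableAt hq.2) (h.mdifferentiableAt hq.1)
  refine ⟨?_, ?_, fun q hq v => ?_, fun q hq v => ?_⟩
  · rw [Φ.trans_source]
    exact h'.smooth.comp (h.smooth.mono Set.inter_subset_left) Set.inter_subset_right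
  · rw [Φ.trans_target]
    exact h.smooth_symm.comp (h'.smooth_symm.mono Set.inter_subset_left) Set.inter_subset_right
  · rw [key q hq]
    rw [Φ.trans_source] at hq
    exact (h'.pullback_taut (Φ q) hq.2 _).trans (h.pullback_taut q hq.1 v)
  · rw [key q hq]
    rw [Φ.trans_source] at hq
    exact (h'.pullback_conn (Φ q) hq.2 _).trans (h.pullback_conn q hq.1 v)

theorem IsLocalEquiv.symm {Φ : OpenPartialHomeomorph P P} (h : S.IsLocalEquiv Φ) :
    S.IsLocalEquiv Φ.symm := by
  have key : ∀ q ∈ Φ.target, ∀ v : TangentSpace 𝓘(ℝ, E) q,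
      (mfderiv 𝓘(ℝ, E) 𝓘(ℝ, E) Φ (Φ.symm q) (mfderiv 𝓘(ℝ, E) 𝓘(ℝ, E) Φ.symm q v) : E) = v := by
    intro q hq v
    have hd : MDifferentiableAt 𝓘(ℝ, E) 𝓘(ℝ, E) Φ.symm q :=
      (h.smooth_symm.contMDiffAt (Φ.open_target.mem_nhds hq)).mdifferentiableAt (by simp)
    have e := mfderiv_comp q (h.mdifferentiableAt (Φ.map_target hq)) hd
    have e' : (Φ ∘ Φ.symm : P → P) =ᶠ[𝓝 q] id := Φ.eventually_right_inverse hq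
    rw [e'.mfderiv_eq, mfderiv_id] at e
    exact (congrArg (fun L => L v) e).symm
  refine ⟨h.smooth_symm, h.smooth, fun q hq v => ?_, fun q hq v => ?_⟩
  · have e := h.pullback_taut (Φ.symm q) (Φ.map_target hq) (mfderiv 𝓘(ℝ, E) 𝓘(ℝ, E) Φ.symm q v)
    rw [← e, key q hq v, Φ.right_inv hq]
  · have e := h.pullback_conn (Φ.symm q) (Φ.map_target hq) (mfderiv 𝓘(ℝ, E) 𝓘(ℝ, E) Φ.symm q v)
    rw [← e, key q hq v, Φ.right_inv hq]

variable (S)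

/-- Two points of `P` are locally equivalent if a local equivalence maps one to the other. -/
def locallyEquivalent : Setoid P where
  r p q := ∃ Φ : OpenPartialHomeomorph P P, S.IsLocalEquiv Φ ∧ p ∈ Φ.source ∧ Φ p = q
  iseqv := by
    refine ⟨fun p => ⟨_, IsLocalEquiv.refl, Set.mem_univ p, rfl⟩, ?_, ?_⟩
    · rintro p q ⟨Φ, h, hp, rfl⟩
      exact ⟨Φ.symm, h.symm, Φ.map_source hp, Φ.left_inv hp⟩
    · rintro p q r ⟨Φ, h, hp, rfl⟩ ⟨Ψ, h', hq, rfl⟩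
      exact ⟨Φ.trans Ψ, h.trans h', by rw [Φ.trans_source]; exact ⟨hp, hq⟩, rfl⟩

/-- The invariant functions of `(P, θ, ω)`. -/
def IsInvariant (f : P → ℝ) : Prop :=
  ContMDiff 𝓘(ℝ, E) 𝓘(ℝ, ℝ) ∞ f ∧
    ∀ Φ : OpenPartialHomeomorph P P, S.IsLocalEquiv Φ → ∀ q ∈ Φ.source, f (Φ q) = f q

/-- The space `{d_p f : f an invariant function} ⊂ T_p^*P`. -/
def invariantCodifferentials (p : P) : Submodule ℝ (TangentSpace 𝓘(ℝ, E) p →L[ℝ] ℝ) where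
  carrier := {φ | ∃ f : P → ℝ, S.IsInvariant f ∧ mvfderiv 𝓘(ℝ, E) f p = φ}
  add_mem' := by
    rintro _ _ ⟨f, hf, rfl⟩ ⟨g, hg, rfl⟩
    refine ⟨f + g, ⟨hf.1.add hg.1, fun Φ hΦ q hq => ?_⟩, ?_⟩
    · rw [Pi.add_apply, Pi.add_apply, hf.2 Φ hΦ q hq, hg.2 Φ hΦ q hq]
    · exact mvfderiv_add (hf.1.mdifferentiable (by simp) p) (hg.1.mdifferentiable (by simp) p)
  zero_mem' := ⟨0, ⟨contMDiff_const, fun _ _ _ _ => rfl⟩, mvfderiv_zero⟩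
  smul_mem' := by
    rintro c _ ⟨f, hf, rfl⟩
    have hc : ContMDiff 𝓘(ℝ, E) 𝓘(ℝ, ℝ) ∞ (fun _ : P => c) := contMDiff_const
    refine ⟨(fun _ => c) • f, ⟨hc.smul hf.1, fun Φ hΦ q hq => ?_⟩, ?_⟩
    · change c • f _ = c • f _
      rw [hf.2 Φ hΦ q hq]
    · rw [mvfderiv_smul mdifferentiableAt_const (hf.1.mdifferentiable (by simp) p), mvfderiv_const]
      ext v
      simp

/-- `(P, θ, ω)` is fully regular: the dimension of the space of differentials at `p` of invariant
functions does not depend on `p`. -/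
def IsFullyRegular : Prop :=
  ∃ d : ℕ, ∀ p, Module.finrank ℝ (S.invariantCodifferentials p) = d

/-- The classifying space `X = P / ∼`, with the quotient topology. -/
abbrev ClassifyingSpace : Type _ := Quotient S.locallyEquivalent

/-- The classifying map `h : P → X`. -/
def classifyingMap (p : P) : S.ClassifyingSpace := Quotient.mk S.locallyEquivalent p

/-- A smooth structure on `X` (not required to be Hausdorff) makes it the classifying manifold if `h` is a submersion. -/
structure IsClassifyingManifold (m : ℕ)
    [ChartedSpace (EuclideanSpace ℝ (Fin m)) S.ClassifyingSpace] : Prop where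
  smooth : ContMDiff 𝓘(ℝ, E) (𝓡 m) ∞ S.classifyingMap
  submersion : ∀ p, Function.Surjective (mfderiv 𝓘(ℝ, E) (𝓡 m) S.classifyingMap p)

section Algebroid

variable (m : ℕ) [ChartedSpace (EuclideanSpace ℝ (Fin m)) S.ClassifyingSpace]
  [IsManifold (𝓡 m) ∞ S.ClassifyingSpace]

/-- Lie algebroid structures on the trivial bundle `X × (ℝⁿ ⊕ 𝔤) → X`. -/
abbrev Algebroid : Type _ :=
  TrivialLieAlgebroid (EuclideanSpace ℝ (Fin m)) S.ClassifyingSpace ((Fin n → ℝ) × 𝔤)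

variable {m S}

/-- The pullback `H^*η` of a section `η` of `A^*`, as a 1-form on `P`. -/
noncomputable def pullbackForm
    (η : C^∞⟮𝓡 m, S.ClassifyingSpace; 𝓘(ℝ, ((Fin n → ℝ) × 𝔤) →L[ℝ] ℝ),
      ((Fin n → ℝ) × 𝔤) →L[ℝ] ℝ⟯) (p : P) : TangentSpace 𝓘(ℝ, E) p →L[ℝ] ℝ :=
  (η (S.classifyingMap p)).comp (S.coframe p)

/-- `A` is the classifying Lie algebroid of `(P, θ, ω)`: its differential satisfies
`H^* d_A = d H^*` on functions and on 1-forms, which determines the anchor and the bracket. -/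
structure IsClassifyingAlgebroid (A : S.Algebroid m) : Prop where
  pullback_d_function : ∀ (f : C^∞⟮𝓡 m, S.ClassifyingSpace; 𝓘(ℝ, ℝ), ℝ⟯) (p : P)
    (v : TangentSpace 𝓘(ℝ, E) p),
    mvfderiv 𝓘(ℝ, E) (fun q => f (S.classifyingMap q)) p v =
      A.dFunction f (S.classifyingMap p) (S.coframe p v)
  pullback_d_form : ∀ (η : C^∞⟮𝓡 m, S.ClassifyingSpace; 𝓘(ℝ, ((Fin n → ℝ) × 𝔤) →L[ℝ] ℝ),
      ((Fin n → ℝ) × 𝔤) →L[ℝ] ℝ⟯) (p : P) (ξ₁ ξ₂ : Π q : P, TangentSpace 𝓘(ℝ, E) q),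
    (∀ᶠ q in 𝓝 p, SmoothVFAt ξ₁ q) → (∀ᶠ q in 𝓝 p, SmoothVFAt ξ₂ q) →
    extDerivForm (pullbackForm η) ξ₁ ξ₂ p =
      A.dForm η (S.classifyingMap p) (S.coframe p (ξ₁ p)) (S.coframe p (ξ₂ p))

end Algebroid

/-- The Lie algebra of germs at `p` of infinitesimal symmetries: germs of vector fields `ξ` with
`L_ξ θ = 0` and `L_ξ ω = 0`. -/
noncomputable def symmetryGerms [FiniteDimensional ℝ E] (p : P) : LieSubalgebra ℝ (VFGerm E p) :=
  germsPreserving S.tautForm S.tautForm_smooth p ⊓ germsPreserving S.connForm S.connForm_smooth p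

end GStructureWithConnection
end GStructures

/-! The pair `H = (θ, ω)` is a coframe on `P`, and the local equivalences, invariants and
infinitesimal symmetries of `(P, θ, ω)` are those of `H`, so the work is done for coframes. A
coframe has a dual frame, and equivalences carry this frame to itself. Hence the structure
functions, which are the components of brackets of frame fields, are invariants, and so are the
frame derivatives of invariants.

The core is Cartan's equivalence argument, `IsCoframe.exists_isClassifyingBox`. Take a family of
functions that contains the structure functions and is closed under frame derivatives, near a point
where the rank of its differentials is locally maximal. Finitely many members form a submersion `J`
on which all the others depend locally. In particular `dJ = Γ(J) ∘ H` for some `Γ`, and the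
structure functions are functions of `J`. The graph of an equivalence is an integral manifold of the
distribution on the product that equates the coframes at `x` and `y`. This distribution is
involutive only where `J x = J y`, but it is tangent to that set.
`exists_hasFDerivAt_eq_of_integrable` is the Frobenius theorem under such a constraint: solve along
rays, let the constraint persist by Gronwall, and compare neighbouring rays with an explicit
approximate solution. So points of the box with equal `J` are equivalent. The linearised problem,
treated in the same way, shows that every vector in `ker dJ` extends to a symmetry.

For (a), apply this to the family of all invariants, whose rank is constant by full regularity.
Within a box the fibres of `J` are exactly the equivalence classes, so `J` descends to a chart of
the quotient (`IsCoframe.exists_isManifold_quotient`).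

For (b), the anchor is `dh ∘ H⁻¹`, and the bracket of two sections is read off from the Lie bracket
of their lifts through the frame. Both are unchanged by equivalences and descend. An arbitrary
classifying algebroid has the same anchor and the same brackets of constant sections: functions on
the quotient are invariants upstairs, and by regularity these see all directions transverse to the
fibres of `h` (`IsCoframeSubmersion.isCoframeAlgebroid_of_pullback`).

For (c), send a symmetry `ξ` to `-H(ξ)` at `p`. This lands in the isotropy because symmetries
annihilate invariants, it is injective because a symmetry is determined by its value at a point, and
it is surjective by the extension of vectors in `ker dJ`. Since symmetries commute with the frame,
the bracket of two of them has minus the components of the frame bracket, which explains the sign.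
That symmetries annihilate invariants (`IsCoframe.mvfderiv_invariant_eq_zero`) needs no flow:
Cartan's argument is applied to the family of functions killed by `ξ`, at a point of maximal rank.
-/

set_option linter.unusedSectionVars false

/-! ### The Frobenius theorem under a constraint -/

section Frobenius
open Set Metric

/-- Picard-Lindelöf, with the solution in the closed ball on which the equation is controlled. -/
theorem IsPicardLindelof.exists_hasDerivWithinAt_mem_closedBall {F : Type*} [NormedAddCommGroup F]
    [NormedSpace ℝ F] [CompleteSpace F] {f : ℝ → F → F} {tmin tmax : ℝ} {t₀ : Icc tmin tmax}
    {x₀ : F} {a r L K : NNReal} (hf : IsPicardLindelof f t₀ x₀ a r L K) :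
    ∃ γ : ℝ → F, γ t₀ = x₀ ∧ (∀ t ∈ Icc tmin tmax, γ t ∈ closedBall x₀ a) ∧
      ∀ t ∈ Icc tmin tmax, HasDerivWithinAt γ (f t (γ t)) (Icc tmin tmax) t := by
  have hx : x₀ ∈ closedBall x₀ (r : ℝ) := mem_closedBall_self r.2
  obtain ⟨α, hα⟩ := ODE.FunSpace.exists_isFixedPt_next hf hx
  refine ⟨α.compProj, by rw [ODE.FunSpace.compProj_val, ← hα, ODE.FunSpace.next_apply₀],
    fun t _ => α.compProj_mem_closedBall hf.mul_max_le, fun t ht => ?_⟩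
  apply ODE.hasDerivWithinAt_picard_Icc t₀.2 hf.continuousOn_uncurry
    α.continuous_compProj.continuousOn (fun _ _ => α.compProj_mem_closedBall hf.mul_max_le)
    x₀ ht |>.congr_of_mem _ ht
  intro t' ht'
  nth_rw 1 [← hα]
  rw [ODE.FunSpace.compProj_of_mem ht', ODE.FunSpace.next_apply]

/-- With no initial error the Gronwall bound is linear in the defect; this turns a defect of order
`‖w‖ ^ 2` into an error of the same order. -/
theorem gronwallBound_zero_eq_mul (K ε x : ℝ) :
    gronwallBound 0 K ε x = ε * gronwallBound 0 K 1 x := by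
  unfold gronwallBound
  split_ifs <;> ring

/-- A `C^∞` map is, near a point, bounded, Lipschitz, and its first order Taylor expansion has a
quadratic remainder. -/
theorem ContDiffAt.exists_ball_taylor_bound {Z G : Type*} [NormedAddCommGroup Z] [NormedSpace ℝ Z]
    [NormedAddCommGroup G] [NormedSpace ℝ G] {A : Z → G} {z₀ : Z} (hA : ContDiffAt ℝ 2 A z₀) :
    ∃ R > 0, ∃ C : ℝ, 0 ≤ C ∧ (∀ z ∈ ball z₀ R, DifferentiableAt ℝ A z) ∧
      (∀ z ∈ ball z₀ R, ‖A z‖ ≤ C) ∧ (∀ z ∈ ball z₀ R, ‖fderiv ℝ A z‖ ≤ C) ∧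
      (∀ z ∈ ball z₀ R, ∀ z' ∈ ball z₀ R, ‖A z' - A z‖ ≤ C * ‖z' - z‖) ∧
      ∀ z ∈ ball z₀ R, ∀ z' ∈ ball z₀ R,
        ‖A z' - A z - fderiv ℝ A z (z' - z)‖ ≤ C * ‖z' - z‖ ^ 2 := by
  have h1 : ContDiffAt ℝ 1 (fderiv ℝ A) z₀ := hA.fderiv_right (by norm_num)
  obtain ⟨K, s, hs, hK⟩ := h1.exists_lipschitzOnWith
  have hb : ∀ᶠ z in 𝓝 z₀, ‖A z‖ < ‖A z₀‖ + 1 :=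
    hA.continuousAt.norm.eventually_lt continuousAt_const (by simp)
  have hb' : ∀ᶠ z in 𝓝 z₀, ‖fderiv ℝ A z‖ < ‖fderiv ℝ A z₀‖ + 1 :=
    h1.continuousAt.norm.eventually_lt continuousAt_const (by simp)
  have hd : ∀ᶠ z in 𝓝 z₀, DifferentiableAt ℝ A z :=
    (hA.eventually (by simp)).mono fun z hz => hz.differentiableAt (by simp)
  obtain ⟨R, hR, hball⟩ := Metric.eventually_nhds_iff_ball.1 (hb.and (hb'.and (hd.and
    (show ∀ᶠ z in 𝓝 z₀, z ∈ s from hs))))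
  -- One constant serves all the estimates: it bounds `A`, its derivative, and the Lipschitz
  -- constant of the derivative.
  set C : ℝ := max (max (‖A z₀‖ + 1) (‖fderiv ℝ A z₀‖ + 1)) K with hC
  have hC1 : ‖A z₀‖ + 1 ≤ C := (le_max_left _ _).trans (le_max_left _ _)
  have hC2 : ‖fderiv ℝ A z₀‖ + 1 ≤ C := (le_max_right _ _).trans (le_max_left _ _)
  have hC3 : (K : ℝ) ≤ C := le_max_right _ _
  have hC0 : 0 ≤ C := K.2.trans hC3
  refine ⟨R, hR, C, hC0, fun z hz => (hball z hz).2.2.1, fun z hz => (hball z hz).1.le.trans hC1,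
    fun z hz => (hball z hz).2.1.le.trans hC2, fun z hz z' hz' => ?_, fun z hz z' hz' => ?_⟩
  · exact (convex_ball z₀ R).norm_image_sub_le_of_norm_fderiv_le
      (fun y hy => (hball y hy).2.2.1) (fun y hy => (hball y hy).2.1.le.trans hC2) hz hz'
  · have hseg : segment ℝ z z' ⊆ ball z₀ R := (convex_ball z₀ R).segment_subset hz hz'
    -- The mean value inequality for `A` minus its linear part at `z`: on the segment the derivative
    -- moves by at most `C * ‖z' - z‖`, and the length of the segment gives the second factor.
    have := (convex_segment z z').norm_image_sub_le_of_norm_hasFDerivWithin_le'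
      (f := A) (f' := fderiv ℝ A) (φ := fderiv ℝ A z) (C := C * ‖z' - z‖)
      (fun y hy => (hball y (hseg hy)).2.2.1.hasFDerivAt.hasFDerivWithinAt)
      (fun y hy => by
        rw [← dist_eq_norm]
        refine (hK.dist_le_mul y (hball y (hseg hy)).2.2.2 z (hball z hz).2.2.2).trans ?_
        refine mul_le_mul hC3 ?_ dist_nonneg hC0
        rw [dist_eq_norm]
        exact norm_sub_le_of_mem_segment (segment_symm ℝ z z' ▸ segment_symm ℝ z z' ▸ hy))
      (left_mem_segment ℝ z z') (right_mem_segment ℝ z z')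
    rwa [mul_assoc, ← pow_two] at this

variable {X Y W : Type*} [NormedAddCommGroup X] [NormedSpace ℝ X] [NormedAddCommGroup Y]
  [NormedSpace ℝ Y] [NormedAddCommGroup W] [NormedSpace ℝ W]

/-- A solution of `Df = A(x, f)` with continuously differentiable data is smooth. -/
theorem contDiffOn_of_hasFDerivAt_eq {A : X × Y → X →L[ℝ] Y} {f : X → Y} {s : Set X}
    (hs : IsOpen s) (hA : ∀ x ∈ s, ContDiffAt ℝ ∞ A (x, f x))
    (hf : ∀ x ∈ s, HasFDerivAt f (A (x, f x)) x) : ContDiffOn ℝ ∞ f s := by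
  refine contDiffOn_infty.2 fun n => ?_
  induction n with
  | zero => exact contDiffOn_zero.2 fun x hx => (hf x hx).continuousAt.continuousWithinAt
  | succ n ih =>
    -- Bootstrap: if `f` is `C^n`, then so is its derivative `A (x, f x)`, hence `f` is `C^(n+1)`.
    rw [Nat.cast_succ, contDiffOn_succ_iff_fderiv_of_isOpen hs]
    refine ⟨fun x hx => (hf x hx).differentiableAt.differentiableWithinAt, by simp, ?_⟩
    have : ContDiffOn ℝ n (fun x => A (x, f x)) s := fun x hx =>
      ContDiffAt.comp_contDiffWithinAt x ((hA x hx).of_le (by exact_mod_cast le_top))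
        (contDiffWithinAt_id.prodMk (ih x hx))
    exact this.congr fun x hx => (hf x hx).fderiv

/-- Solutions along rays of the total differential equation `Df = A(x, f)`: existence, and the
first order dependence on the direction, under the integrability condition on the constraint
set `g = 0`. -/
theorem exists_hasFDerivAt_eq_of_integrable [CompleteSpace Y] {A : X × Y → X →L[ℝ] Y} {g : X × Y → W} {x₀ : X}
    {y₀ : Y} {K : ℝ} (hA : ∀ᶠ z in 𝓝 (x₀, y₀), ContDiffAt ℝ ∞ A z) (hg₀ : g (x₀, y₀) = 0)
    (hg : ∀ᶠ z in 𝓝 (x₀, y₀), DifferentiableAt ℝ g z ∧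
      ∀ v, ‖fderiv ℝ g z (v, A z v)‖ ≤ K * ‖g z‖ * ‖v‖)
    (hint : ∀ᶠ z in 𝓝 (x₀, y₀), g z = 0 → ∀ v w,
      fderiv ℝ A z (v, A z v) w = fderiv ℝ A z (w, A z w) v) :
    ∃ f : X → Y, f x₀ = y₀ ∧ ∀ᶠ x in 𝓝 x₀, ContDiffAt ℝ ∞ f x ∧ HasFDerivAt f (A (x, f x)) x := by
  obtain ⟨R₁, hR₁, C, hC, hAd, hAb, hAb', hAL, hAT⟩ :=
    (hA.self_of_nhds.of_le (WithTop.coe_le_coe.2 le_top : (2 : WithTop ℕ∞) ≤ ∞)).exists_ball_taylor_bound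
  obtain ⟨R₂, hR₂, hball⟩ := Metric.eventually_nhds_iff_ball.1 (hA.and (hg.and hint))
  obtain ⟨R, hR, hRR₁, hRR₂⟩ : ∃ R > 0, R ≤ R₁ ∧ R ≤ R₂ :=
    ⟨min R₁ R₂, lt_min hR₁ hR₂, min_le_left _ _, min_le_right _ _⟩
  have hsub₁ : ball (x₀, y₀) R ⊆ ball (x₀, y₀) R₁ := ball_subset_ball hRR₁
  have hsub₂ : ball (x₀, y₀) R ⊆ ball (x₀, y₀) R₂ := ball_subset_ball hRR₂
  have hmem : ∀ {x : X} {y : Y}, ‖x - x₀‖ < R → ‖y - y₀‖ < R → (x, y) ∈ ball (x₀, y₀) R := by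
    intro x y hx hy
    rw [← ball_prod_same]
    exact ⟨mem_ball_iff_norm.2 hx, mem_ball_iff_norm.2 hy⟩
  -- The bound on `r` keeps the rays in the region of control; the bound on `C * r`, which is the
  -- maximal speed of a solution, keeps the solutions there for the whole unit time.
  obtain ⟨r, hr, hrR, hCr⟩ : ∃ r > 0, r ≤ R / 2 ∧ C * r ≤ R / 2 := by
    refine ⟨min (R / 2) (R / 2 / (C + 1)), by positivity, min_le_left _ _, ?_⟩
    calc C * min (R / 2) (R / 2 / (C + 1)) ≤ (C + 1) * (R / 2 / (C + 1)) :=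
          mul_le_mul (by linarith) (min_le_right _ _) (by positivity) (by positivity)
      _ = R / 2 := by field_simp
  have hmul : ∀ {t : ℝ} {v : X}, t ∈ Icc (0 : ℝ) 1 → ‖v‖ ≤ r → ‖x₀ + t • v - x₀‖ < R := by
    intro t v ht hv
    rw [add_sub_cancel_left, norm_smul, Real.norm_of_nonneg ht.1]
    nlinarith [norm_nonneg v, ht.1, ht.2]
  -- the solutions along rays
  have hsol : ∀ v : X, ‖v‖ ≤ r → ∃ γ : ℝ → Y, γ 0 = y₀ ∧
      (∀ t ∈ Icc (0 : ℝ) 1, ‖γ t - y₀‖ ≤ R / 2) ∧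
      ∀ t ∈ Icc (0 : ℝ) 1, HasDerivWithinAt γ (A (x₀ + t • v, γ t) v) (Icc 0 1) t := by
    intro v hv
    have hPL : IsPicardLindelof (fun t y => A (x₀ + t • v, y) v)
        (⟨0, by simp⟩ : Icc (0 : ℝ) 1) y₀ ⟨R / 2, by positivity⟩ 0
        ⟨C * r, by positivity⟩ ⟨C * r, by positivity⟩ := by
      have hin : ∀ t ∈ Icc (0 : ℝ) 1, ∀ y ∈ closedBall y₀ (R / 2),
          (x₀ + t • v, y) ∈ ball (x₀, y₀) R := fun t ht y hy =>
        hmem (hmul ht hv) ((mem_closedBall_iff_norm.1 hy).trans_lt (by linarith))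
      refine ⟨fun t ht => ?_, fun y hy => ?_, fun t ht y hy => ?_, ?_⟩
      · refine LipschitzOnWith.of_dist_le_mul fun y hy y' hy' => ?_
        rw [dist_eq_norm, dist_eq_norm, ← sub_apply]
        refine (ContinuousLinearMap.le_opNorm _ _).trans ?_
        have h1 := hAL _ (hsub₁ (hin t ht y' hy')) _ (hsub₁ (hin t ht y hy))
        have h2 : ‖((x₀ + t • v, y) : X × Y) - (x₀ + t • v, y')‖ = ‖y - y'‖ := by
          simp [Prod.norm_def]
        rw [h2] at h1
        calc _ ≤ C * ‖y - y'‖ * r := by gcongr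
          _ = C * r * ‖y - y'‖ := by ring
      · have : ContinuousOn (fun t : ℝ => A (x₀ + t • v, y)) (Icc 0 1) := by
          intro t ht
          have h1 := (hAd _ (hsub₁ (hin t ht y hy))).continuousAt
          have h2 : ContinuousAt (fun t : ℝ => ((x₀ + t • v, y) : X × Y)) t := by fun_prop
          exact (ContinuousAt.comp (f := fun t : ℝ => ((x₀ + t • v, y) : X × Y)) h1 h2).continuousWithinAt
        exact this.clm_apply continuousOn_const
      · exact (ContinuousLinearMap.le_opNorm _ _).trans
          (mul_le_mul (hAb _ (hsub₁ (hin t ht y hy))) hv (norm_nonneg _) hC)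
      · change C * r * max (1 - 0) (0 - 0) ≤ R / 2 - 0
        simpa using hCr
    obtain ⟨γ, h0, hγ, hd⟩ := hPL.exists_hasDerivWithinAt_mem_closedBall
    exact ⟨γ, h0, fun t ht => mem_closedBall_iff_norm.1 (hγ t ht), hd⟩
  choose! γ hγ0 hγb hγd using hsol
  have hγin : ∀ v : X, ‖v‖ ≤ r → ∀ t ∈ Icc (0 : ℝ) 1, (x₀ + t • v, γ v t) ∈ ball (x₀, y₀) R :=
    fun v hv t ht => hmem (hmul ht hv) ((hγb v hv t ht).trans_lt (by linarith))
  have hright : ∀ {β : ℝ → Y} {β' : Y} {t : ℝ}, t ∈ Ico (0 : ℝ) 1 →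
      HasDerivWithinAt β β' (Icc 0 1) t → HasDerivWithinAt β β' (Ici t) t := fun ht h =>
    h.mono_of_mem_nhdsWithin (Icc_mem_nhdsGE_of_mem ht)
  have hz : ∀ v : X, ‖v‖ ≤ r → ∀ t ∈ Icc (0 : ℝ) 1,
      HasDerivWithinAt (fun t => ((x₀ + t • v, γ v t) : X × Y)) (v, A (x₀ + t • v, γ v t) v)
        (Icc 0 1) t := by
    intro v hv t ht
    have h1 : HasDerivWithinAt (fun t : ℝ => x₀ + t • v) v (Icc 0 1) t := by
      simpa using ((hasDerivWithinAt_id t (Icc (0 : ℝ) 1)).smul_const v).const_add x₀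
    exact h1.prodMk (hγd v hv t ht)
  -- the constraint
  have hgz : ∀ v : X, ‖v‖ ≤ r → ∀ t ∈ Icc (0 : ℝ) 1, g (x₀ + t • v, γ v t) = 0 := by
    intro v hv
    have hd : ∀ t ∈ Icc (0 : ℝ) 1, HasDerivWithinAt (fun t => g (x₀ + t • v, γ v t))
        (fderiv ℝ g (x₀ + t • v, γ v t) (v, A (x₀ + t • v, γ v t) v)) (Icc 0 1) t :=
      fun t ht => (hball _ (hsub₂ (hγin v hv t ht))).2.1.1.hasFDerivAt.comp_hasDerivWithinAt t
        (hz v hv t ht)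
    -- The constraint holds at time 0, and the derivative of `g` along the ray is bounded by a
    -- multiple of `g`.
    refine eq_zero_of_abs_deriv_le_mul_abs_self_of_eq_zero_right (K := K * ‖v‖)
      (fun t ht => (hd t ht).continuousWithinAt)
      (fun t ht => (hd t (Ico_subset_Icc_self ht)).mono_of_mem_nhdsWithin (Icc_mem_nhdsGE_of_mem ht))
      ?_ fun t ht => ?_
    · simp [hγ0 v hv, hg₀]
    · refine ((hball _ (hsub₂ (hγin v hv t (Ico_subset_Icc_self ht)))).2.1.2 v).trans (le_of_eq ?_)
      ring
  -- The candidate is the value at time 1 of the solution along the ray from `x₀` to `x`. At `x =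
  -- x₀` the equation has right-hand side zero, so the solution is constant.
  refine ⟨fun x => γ (x - x₀) 1, ?_, ?_⟩
  · have h0 : ‖(0 : X)‖ ≤ r := by simpa using hr.le
    have hc : ∀ t ∈ Icc (0 : ℝ) 1, γ 0 t = γ 0 0 := by
      refine constant_of_has_deriv_right_zero (fun t ht => (hγd 0 h0 t ht).continuousWithinAt)
        fun t ht => ?_
      simpa using hright ht (hγd 0 h0 t (Ico_subset_Icc_self ht))
    simp only [sub_self]
    rw [hc 1 (by simp), hγ0 0 h0]
  · have key : ∀ x ∈ ball x₀ r,
        HasFDerivAt (fun x => γ (x - x₀) 1) (A (x, γ (x - x₀) 1)) x := by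
      intro x hx
      obtain ⟨v, rfl⟩ : ∃ v, x = x₀ + v := ⟨x - x₀, by simp⟩
      have hv : ‖v‖ < r := by simpa using hx
      rw [hasFDerivAt_iff_isLittleO_nhds_zero]
      -- The first summand comes from the Taylor remainder of `A` applied to `v + w`, the second
      -- from the term quadratic in `w` that the linear part leaves over.
      set D : ℝ := C * (1 + C) ^ 2 * (2 * r) + C * (1 + C) with hD
      have hbound : ∀ᶠ w in 𝓝 (0 : X), ‖γ (x₀ + v + w - x₀) 1 - γ (x₀ + v - x₀) 1 -
          A (x₀ + v, γ (x₀ + v - x₀) 1) w‖ ≤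
          (D * gronwallBound 0 (C * r) 1 1) * ‖‖w‖ ^ 2‖ := by
        have e1 : ∀ᶠ w in 𝓝 (0 : X), ‖v + w‖ < r := by
          have : ContinuousAt (fun w : X => ‖v + w‖) 0 := by fun_prop
          exact this.eventually_lt continuousAt_const (by simpa using hv)
        have e2 : ∀ᶠ w in 𝓝 (0 : X), C * ‖w‖ < R / 2 := by
          have : ContinuousAt (fun w : X => C * ‖w‖) 0 := by fun_prop
          exact this.eventually_lt continuousAt_const (by simpa using hR)
        filter_upwards [e1, e2] with w hw hw'
        have hwr : ‖w‖ ≤ 2 * r := by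
          have : ‖w‖ ≤ ‖v + w‖ + ‖v‖ := by
            simpa using norm_sub_le (v + w) v
          linarith
        -- approximate solution
        set z : ℝ → X × Y := fun t => (x₀ + t • v, γ v t) with hzdef
        set β : ℝ → Y := fun t => γ v t + t • A (z t) w with hβ
        have hzin : ∀ t ∈ Icc (0 : ℝ) 1, z t ∈ ball (x₀, y₀) R := hγin v hv.le
        have hβd : ∀ t ∈ Icc (0 : ℝ) 1, HasDerivWithinAt β
            (A (z t) v + (A (z t) w + t • fderiv ℝ A (z t) (w, A (z t) w) v)) (Icc 0 1) t := by
          intro t ht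
          have hAz : HasDerivWithinAt (fun t => A (z t))
              (fderiv ℝ A (z t) (v, A (z t) v)) (Icc 0 1) t :=
            (hAd _ (hsub₁ (hzin t ht))).hasFDerivAt.comp_hasDerivWithinAt t (hz v hv.le t ht)
          have h2 : HasDerivWithinAt (fun t => A (z t) w)
              (fderiv ℝ A (z t) (v, A (z t) v) w) (Icc 0 1) t := by
            simpa using hAz.clm_apply (hasDerivWithinAt_const t (Icc (0 : ℝ) 1) w)
          have h3 := (hasDerivWithinAt_id t (Icc (0 : ℝ) 1)).smul h2
          have h4 := (hγd v hv.le t ht).add h3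
          -- Integrability, available because the ray satisfies the constraint, exchanges `v` and
          -- `w`. The derivative of `β` then agrees, to first order in `w`, with the right-hand side
          -- of the equation for the direction `v + w`.
          rw [(hball _ (hsub₂ (hzin t ht))).2.2 (hgz v hv.le t ht) v w] at h4
          refine h4.congr_deriv ?_
          simp only [id, one_smul, hzdef]
          abel
        have hβb : ∀ t ∈ Icc (0 : ℝ) 1, ‖β t - y₀‖ < R := by
          intro t ht
          have h1 : ‖t • A (z t) w‖ ≤ C * ‖w‖ := by
            rw [norm_smul, Real.norm_of_nonneg ht.1]
            have := (A (z t)).le_of_opNorm_le (hAb _ (hsub₁ (hzin t ht))) w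
            calc t * ‖A (z t) w‖ ≤ 1 * (C * ‖w‖) := by
                  gcongr
                  exact ht.2
              _ = C * ‖w‖ := one_mul _
          calc ‖β t - y₀‖ = ‖(γ v t - y₀) + t • A (z t) w‖ := by rw [hβ]; congr 1; module
            _ ≤ _ := norm_add_le _ _
            _ < R := by linarith [hγb v hv.le t ht]
        have hsum : v + w = x₀ + v + w - x₀ := by abel
        -- Gronwall: `γ (v + w)` is an exact solution, `β` has defect at most `D * ‖w‖ ^ 2`, and
        -- both start at `y₀`.
        have hdist := dist_le_of_approx_trajectories_ODE_of_mem
          (v := fun t y => A (x₀ + t • (v + w), y) (v + w)) (s := fun _ => ball y₀ R)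
          (K := ⟨C * r, by positivity⟩) (f := γ (v + w)) (g := β)
          (f' := fun t => A (x₀ + t • (v + w), γ (v + w) t) (v + w))
          (g' := fun t => A (z t) v + (A (z t) w + t • fderiv ℝ A (z t) (w, A (z t) w) v))
          (a := 0) (b := 1) (δ := 0) (εf := 0) (εg := D * ‖w‖ ^ 2)
          (fun t ht => by
            refine LipschitzOnWith.of_dist_le_mul fun y hy y' hy' => ?_
            have ht' := Ico_subset_Icc_self ht
            rw [dist_eq_norm, dist_eq_norm, ← sub_apply]
            refine (ContinuousLinearMap.le_opNorm _ _).trans ?_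
            have h1 := hAL _ (hsub₁ (hmem (hmul ht' hw.le) (mem_ball_iff_norm.1 hy')))
              _ (hsub₁ (hmem (hmul ht' hw.le) (mem_ball_iff_norm.1 hy)))
            have h2 : ‖((x₀ + t • (v + w), y) : X × Y) - (x₀ + t • (v + w), y')‖ = ‖y - y'‖ := by
              simp [Prod.norm_def]
            rw [h2] at h1
            calc _ ≤ C * ‖y - y'‖ * r := by gcongr
              _ = C * r * ‖y - y'‖ := by ring)
          (fun t ht => (hγd _ hw.le t ht).continuousWithinAt)
          (fun t ht => hright ht (hγd _ hw.le t (Ico_subset_Icc_self ht)))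
          (fun t ht => by simp)
          (fun t ht => mem_ball_iff_norm.2
            ((hγb _ hw.le t (Ico_subset_Icc_self ht)).trans_lt (by linarith)))
          (fun t ht => (hβd t ht).continuousWithinAt)
          (fun t ht => hright ht (hβd t (Ico_subset_Icc_self ht)))
          (fun t ht => by
            have ht' := Ico_subset_Icc_self ht
            have hzt := hzin t ht'
            have hz' : ((x₀ + t • (v + w), β t) : X × Y) ∈ ball (x₀, y₀) R :=
              hmem (hmul ht' hw.le) (hβb t ht')
            have hzz : ((x₀ + t • (v + w), β t) : X × Y) - z t = t • (w, A (z t) w) := by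
              ext
              · simp [hzdef]
              · simp [hzdef, hβ]
            have hn : ‖((w, A (z t) w) : X × Y)‖ ≤ (1 + C) * ‖w‖ := by
              have h1 := (A (z t)).le_of_opNorm_le (hAb _ (hsub₁ hzt)) w
              rw [Prod.norm_def]
              refine max_le ?_ ?_ <;> nlinarith [norm_nonneg w]
            have hnt : ‖t • ((w, A (z t) w) : X × Y)‖ ≤ (1 + C) * ‖w‖ := by
              rw [norm_smul, Real.norm_of_nonneg ht'.1]
              nlinarith [norm_nonneg ((w, A (z t) w) : X × Y), ht'.1, ht'.2]
            have hT := hAT _ (hsub₁ hzt) _ (hsub₁ hz')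
            rw [hzz, map_smul] at hT
            have e : A (z t) v + (A (z t) w + t • fderiv ℝ A (z t) (w, A (z t) w) v) -
                A (x₀ + t • (v + w), β t) (v + w) =
                - ((A (x₀ + t • (v + w), β t) - A (z t) - t • fderiv ℝ A (z t) (w, A (z t) w))
                  (v + w)) - t • fderiv ℝ A (z t) (w, A (z t) w) w := by
              simp only [sub_apply, smul_apply, map_add,
                smul_add]
              abel
            rw [dist_eq_norm, e]
            refine (norm_sub_le _ _).trans ?_
            rw [norm_neg]
            have b1 : ‖(A (x₀ + t • (v + w), β t) - A (z t) -
                t • fderiv ℝ A (z t) (w, A (z t) w)) (v + w)‖ ≤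
                C * ((1 + C) * ‖w‖) ^ 2 * (2 * r) := by
              refine (ContinuousLinearMap.le_opNorm _ _).trans ?_
              refine mul_le_mul (hT.trans ?_) (by linarith) (norm_nonneg _) (by positivity)
              gcongr
            have b2 : ‖t • fderiv ℝ A (z t) (w, A (z t) w) w‖ ≤ C * ((1 + C) * ‖w‖) * ‖w‖ := by
              rw [norm_smul, Real.norm_of_nonneg ht'.1]
              have h1 := (fderiv ℝ A (z t)).le_of_opNorm_le (hAb' _ (hsub₁ hzt)) (w, A (z t) w)
              have h2 := (fderiv ℝ A (z t) (w, A (z t) w)).le_opNorm w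
              have h3 : ‖fderiv ℝ A (z t) (w, A (z t) w)‖ ≤ C * ((1 + C) * ‖w‖) :=
                h1.trans (by gcongr)
              calc _ ≤ 1 * (‖fderiv ℝ A (z t) (w, A (z t) w)‖ * ‖w‖) :=
                    mul_le_mul ht'.2 h2 (norm_nonneg _) zero_le_one
                _ ≤ _ := by rw [one_mul]; gcongr
            calc _ ≤ C * ((1 + C) * ‖w‖) ^ 2 * (2 * r) + C * ((1 + C) * ‖w‖) * ‖w‖ :=
                  add_le_add b1 b2
              _ = D * ‖w‖ ^ 2 := by rw [hD]; ring)
          (fun t ht => mem_ball_iff_norm.2 (hβb t (Ico_subset_Icc_self ht)))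
          (by simp [hβ, hγ0 _ hw.le, hγ0 _ hv.le]) 1 (by simp)
        rw [dist_eq_norm, zero_add, gronwallBound_zero_eq_mul] at hdist
        rw [← hsum, add_sub_cancel_left]
        have e : γ (v + w) 1 - β 1 = γ (v + w) 1 - γ v 1 - A (x₀ + v, γ v 1) w := by
          simp only [hβ, hzdef, one_smul]; abel
        rw [e] at hdist
        refine hdist.trans (le_of_eq ?_)
        simp only [sub_zero, norm_pow, norm_norm]
        change D * ‖w‖ ^ 2 * gronwallBound 0 (C * r) 1 1 = _
        ring
      exact (Asymptotics.IsBigO.of_bound _ hbound).trans_isLittleO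
        (Asymptotics.isLittleO_norm_pow_id one_lt_two)
    have hsm : ContDiffOn ℝ ∞ (fun x => γ (x - x₀) 1) (ball x₀ r) := by
      refine contDiffOn_of_hasFDerivAt_eq isOpen_ball (fun x hx => ?_) key
      have hv : ‖x - x₀‖ ≤ r := (mem_ball_iff_norm.1 hx).le
      have := hγin (x - x₀) hv 1 (by simp)
      rw [one_smul, add_sub_cancel] at this
      exact (hball _ (hsub₂ this)).1
    filter_upwards [isOpen_ball.mem_nhds (mem_ball_self hr)] with x hx
    exact ⟨hsm.contDiffAt (isOpen_ball.mem_nhds hx), key x hx⟩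

end Frobenius

/-! ### Submersions in normal form -/

section Submersions
open Set Metric

variable {X W : Type*} [NormedAddCommGroup X] [NormedSpace ℝ X] [NormedAddCommGroup W]
  [NormedSpace ℝ W]

theorem ContinuousLinearMap.isInvertible_of_bijective [FiniteDimensional ℝ X] {L : X →L[ℝ] W}
    (h : Function.Bijective L) : L.IsInvertible := by
  refine ⟨(LinearEquiv.ofBijective L.toLinearMap h).toContinuousLinearEquiv, ?_⟩
  ext v
  rfl

theorem ContinuousAt.eventually_isInvertible {T : Type*} [TopologicalSpace T] [CompleteSpace X]
    {L : T → X →L[ℝ] W} {t : T} (hL : ContinuousAt L t) (h : (L t).IsInvertible) :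
    ∀ᶠ s in 𝓝 t, (L s).IsInvertible :=
  hL.eventually (ContinuousLinearEquiv.isOpen.mem_nhds h)

/-- The inverse function theorem, with a smooth inverse on the whole target. -/
theorem exists_openPartialHomeomorph_of_isInvertible_fderiv [CompleteSpace X] {f : X → W} {x₀ : X}
    (hf : ∀ᶠ x in 𝓝 x₀, ContDiffAt ℝ ∞ f x) (hf' : (fderiv ℝ f x₀).IsInvertible) {U : Set X}
    (hU : U ∈ 𝓝 x₀) :
    ∃ Φ : OpenPartialHomeomorph X W, (Φ : X → W) = f ∧ x₀ ∈ Φ.source ∧ Φ.source ⊆ U ∧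
      ContDiffOn ℝ ∞ Φ Φ.source ∧ ContDiffOn ℝ ∞ Φ.symm Φ.target := by
  have h0 := hf.self_of_nhds
  obtain ⟨e, he⟩ := hf'
  have hd : HasFDerivAt f (e : X →L[ℝ] W) x₀ := by
    rw [he]
    exact (h0.differentiableAt (by simp)).hasFDerivAt
  have hc : ContinuousAt (fderiv ℝ f) x₀ := h0.continuousAt_fderiv (by simp)
  have hi : ∀ᶠ x in 𝓝 x₀, (fderiv ℝ f x).IsInvertible :=
    hc.eventually_isInvertible ⟨e, he⟩
  -- Restricting to points where `f` is smooth with invertible derivative makes the inverse smooth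
  -- on the whole target, not only at the image of `x₀`.
  obtain ⟨O, hO, hOo, hxO⟩ := _root_.mem_nhds_iff.1 (hf.and (hi.and hU))
  set Φ := (h0.toOpenPartialHomeomorph f hd (by simp)).restrOpen O hOo with hΦ
  have hΦf : (Φ : X → W) = f := rfl
  have hs : Φ.source ⊆ O := fun x hx => hx.2
  refine ⟨Φ, hΦf, ⟨h0.mem_toOpenPartialHomeomorph_source hd (by simp), hxO⟩,
    fun x hx => (hO (hs hx)).2.2, fun x hx => (hO (hs hx)).1.contDiffWithinAt, fun y hy => ?_⟩
  obtain ⟨h1, ⟨e', he'⟩, -⟩ := hO (hs (Φ.map_target hy))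
  refine (Φ.contDiffAt_symm (f₀' := e') hy ?_ h1).contDiffWithinAt
  rw [he']
  exact (h1.differentiableAt (by simp)).hasFDerivAt

/-- An open set `O` on which `J` is, up to a diffeomorphism, the projection of a product onto the
first factor `B`, with a section `σ`; the fibres of `J` in `O` are connected by curves. -/
structure IsFiberedBox (J : X → W) (O : Set X) (B : Set W) (σ : W → X) : Prop where
  isOpen : IsOpen O
  isOpen_base : IsOpen B
  mapsTo : MapsTo J O B
  mapsTo_section : MapsTo σ B O
  section_right_inv : ∀ b ∈ B, J (σ b) = b
  smooth_section : ContDiffOn ℝ ∞ σ B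
  exists_curve : ∀ x ∈ O, ∃ c : ℝ → X, c 0 = σ (J x) ∧ c 1 = x ∧ ∀ t ∈ Icc (0 : ℝ) 1,
    c t ∈ O ∧ ∃ c', HasDerivAt c c' t ∧ fderiv ℝ J (c t) c' = 0

/-- A function whose differential vanishes along the fibres of `J` is a function of `J`. -/
theorem IsFiberedBox.eq_section {J : X → W} {O : Set X} {B : Set W} {σ : W → X}
    (h : IsFiberedBox J O B σ) {Y : Type*} [NormedAddCommGroup Y] [NormedSpace ℝ Y] {f : X → Y}
    (hf : ∀ x ∈ O, DifferentiableAt ℝ f x)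
    (hker : ∀ x ∈ O, ∀ v, fderiv ℝ J x v = 0 → fderiv ℝ f x v = 0) {x : X} (hx : x ∈ O) :
    f x = f (σ (J x)) := by
  obtain ⟨c, h0, h1, hc⟩ := h.exists_curve x hx
  have hd : ∀ t ∈ Icc (0 : ℝ) 1, HasDerivAt (fun t => f (c t)) 0 t := by
    intro t ht
    obtain ⟨hcO, c', hc', hJ⟩ := hc t ht
    have := (hf _ hcO).hasFDerivAt.comp_hasDerivAt t hc'
    rwa [hker _ hcO _ hJ] at this
  have := constant_of_has_deriv_right_zero (f := fun t => f (c t)) (a := 0) (b := 1)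
    (fun t ht => (hd t ht).continuousAt.continuousWithinAt)
    (fun t ht => (hd t (Ico_subset_Icc_self ht)).hasDerivWithinAt) 1 (by simp)
  rw [h0, h1] at this
  exact this

/-- A projection `π` onto the kernel of the derivative at `x₀` completes `J` to a local
diffeomorphism `(J, π)`. The box is the preimage of a product of balls. The section holds `π` at its
value at `x₀`, and straight segments in the kernel factor join it to the other points while `J`
stays constant. -/
theorem exists_isFiberedBox [FiniteDimensional ℝ X] {J : X → W} {x₀ : X}
    (hJ : ∀ᶠ x in 𝓝 x₀, ContDiffAt ℝ ∞ J x) (hs : Function.Surjective (fderiv ℝ J x₀))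
    {U : Set X} (hU : U ∈ 𝓝 x₀) :
    ∃ (O : Set X) (B : Set W) (σ : W → X), IsFiberedBox J O B σ ∧ x₀ ∈ O ∧ O ⊆ U ∧
      σ (J x₀) = x₀ := by
  have := FiniteDimensional.complete ℝ X
  set L := fderiv ℝ J x₀ with hL
  obtain ⟨R, hR⟩ := L.toLinearMap.exists_rightInverse_of_surjective (LinearMap.range_eq_top.2 hs)
  have hR : ∀ w, L (R w) = w := fun w => LinearMap.congr_fun hR w
  obtain ⟨π₀, hπ₀⟩ := L.ker.subtype.exists_leftInverse_of_injective L.ker.ker_subtype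
  set π : X →L[ℝ] L.ker := LinearMap.toContinuousLinearMap π₀ with hπdef
  have hπ : ∀ v : L.ker, π v = v := fun v => LinearMap.congr_fun hπ₀ v
  have hbij : Function.Bijective (L.prod π) := by
    constructor
    · rw [injective_iff_map_eq_zero]
      intro v hv
      have h1 : L v = 0 := congrArg Prod.fst hv
      have h2 : π v = 0 := congrArg Prod.snd hv
      have h3 := hπ ⟨v, h1⟩
      rw [show π ((⟨v, h1⟩ : L.ker) : X) = π v from rfl, h2] at h3
      exact (congrArg Subtype.val h3).symm
    · rintro ⟨w, k⟩
      -- `R w` has the right image under `L`; its kernel component is replaced by `k`.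
      refine ⟨R w - π (R w) + k, ?_⟩
      have h1 : ∀ k : L.ker, L (k : X) = 0 := fun k => k.2
      change (L _, π _) = _
      rw [map_add, map_sub, map_add, map_sub, h1, h1, hR, hπ, hπ]
      simp
  have hΨd : ∀ x, DifferentiableAt ℝ J x →
      HasFDerivAt (fun x => (J x, π x)) ((fderiv ℝ J x).prod π) x := fun x hx =>
    hx.hasFDerivAt.prodMk π.hasFDerivAt
  have hJd₀ : DifferentiableAt ℝ J x₀ := hJ.self_of_nhds.differentiableAt (by simp)
  obtain ⟨Φ, hΦ, hx₀, hΦU, hΦs, hΦs'⟩ := exists_openPartialHomeomorph_of_isInvertible_fderiv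
    (f := fun x => (J x, π x)) (x₀ := x₀) (hJ.mono fun x hx => hx.prodMk π.contDiff.contDiffAt)
    (by rw [(hΨd x₀ hJd₀).fderiv]; exact ContinuousLinearMap.isInvertible_of_bijective hbij)
    (inter_mem hU hJ)
  have hΦ1 : ∀ x, (Φ x).1 = J x := fun x => by rw [hΦ]
  have hΦ2 : ∀ x, (Φ x).2 = π x := fun x => by rw [hΦ]
  obtain ⟨r, hr, hball⟩ := Metric.isOpen_iff.1 Φ.open_target _ (Φ.map_source hx₀)
  have hin : ∀ {b : W} {k : L.ker}, b ∈ ball (J x₀) r → k ∈ ball (π x₀) r →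
      (b, k) ∈ Φ.target := by
    intro b k hb hk
    apply hball
    rw [hΦ, ← ball_prod_same]
    exact ⟨hb, hk⟩
  refine ⟨Φ.source ∩ Φ ⁻¹' (ball (J x₀) r ×ˢ ball (π x₀) r), ball (J x₀) r,
    fun b => Φ.symm (b, π x₀), ⟨Φ.isOpen_inter_preimage (isOpen_ball.prod isOpen_ball),
      isOpen_ball, ?_, ?_, ?_, ?_, ?_⟩, ⟨hx₀, ?_⟩, fun x hx => (hΦU hx.1).1, ?_⟩
  · rintro x ⟨-, hx, -⟩
    rwa [hΦ1] at hx
  · intro b hb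
    have h1 := hin hb (mem_ball_self hr)
    refine ⟨Φ.map_target h1, ?_⟩
    rw [mem_preimage, Φ.right_inv h1]
    exact ⟨hb, mem_ball_self hr⟩
  · intro b hb
    rw [← hΦ1, Φ.right_inv (hin hb (mem_ball_self hr))]
  · exact hΦs'.comp (contDiffOn_id.prodMk contDiffOn_const) fun b hb => hin hb (mem_ball_self hr)
  · rintro x ⟨hx, hxJ, hxπ⟩
    rw [hΦ1] at hxJ
    rw [hΦ2] at hxπ
    set d : ℝ → W × L.ker := fun t => (J x, π x₀ + t • (π x - π x₀)) with hd
    have hdd : ∀ t, HasDerivAt d (0, π x - π x₀) t := fun t =>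
      (hasDerivAt_const t (J x)).prodMk
        (by simpa using ((hasDerivAt_id t).smul_const (π x - π x₀)).const_add (π x₀))
    have hdb : ∀ t ∈ Icc (0 : ℝ) 1, d t ∈ ball (J x₀) r ×ˢ ball (π x₀) r := by
      intro t ht
      refine ⟨hxJ, ?_⟩
      have := (convex_ball (π x₀) r).add_smul_sub_mem (mem_ball_self hr) hxπ ht
      exact this
    refine ⟨fun t => Φ.symm (d t), by simp [hd], ?_, fun t ht => ?_⟩
    · have : d 1 = Φ x := by rw [hΦ]; simp [hd]
      simp only [this, Φ.left_inv hx]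
    · have hdt : d t ∈ Φ.target := hin (hdb t ht).1 (hdb t ht).2
      have hct : Φ.symm (d t) ∈ Φ.source := Φ.map_target hdt
      refine ⟨⟨hct, by rw [mem_preimage, Φ.right_inv hdt]; exact hdb t ht⟩, ?_⟩
      have hdiff := (hΦs'.contDiffAt (Φ.open_target.mem_nhds hdt)).differentiableAt (by simp)
      have hc := hdiff.hasFDerivAt.comp_hasDerivAt t (hdd t)
      refine ⟨_, hc, ?_⟩
      have hJc : ContDiffAt ℝ ∞ J (Φ.symm (d t)) := (hΦU hct).2
      have hJd := (hJc.differentiableAt (by simp)).hasFDerivAt.comp_hasDerivAt t hc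
      have hev : (fun s => J (Φ.symm (d s))) =ᶠ[𝓝 t] fun _ => J x := by
        filter_upwards [(hdd t).continuousAt.preimage_mem_nhds (Φ.open_target.mem_nhds hdt)]
          with s hs
        rw [← hΦ1, Φ.right_inv hs]
      exact hJd.unique ((hasDerivAt_const t (J x)).congr_of_eventuallyEq hev)
  · rw [mem_preimage, hΦ]
    exact ⟨mem_ball_self hr, mem_ball_self hr⟩
  · have : (J x₀, π x₀) = Φ x₀ := by rw [hΦ]
    simp only [this, Φ.left_inv hx₀]

end Submersions

/-! ### Cartan's equivalence method in a chart -/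

section CoframesInCharts
open Set Metric

variable {E V W : Type*} [NormedAddCommGroup E] [NormedSpace ℝ E]
  [NormedAddCommGroup V] [NormedSpace ℝ V] [NormedAddCommGroup W] [NormedSpace ℝ W]

theorem minSmoothness_two_le_infty : minSmoothness ℝ 2 ≤ (∞ : WithTop ℕ∞) := by
  rw [minSmoothness_of_isRCLikeNormedField]
  exact WithTop.coe_le_coe.2 le_top

theorem ContDiffAt.fderiv_infty {f : E → V} {x : E} (h : ContDiffAt ℝ ∞ f x) :
    ContDiffAt ℝ ∞ (fderiv ℝ f) x :=
  h.fderiv_right (by simp)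

/-- The structure functions `dα(α⁻¹ a, α⁻¹ b)` of a coframe `α` on a vector space. -/
noncomputable def coframeStructure (α : E → E →L[ℝ] V) (x : E) (a b : V) : V :=
  fderiv ℝ α x ((α x).inverse a) ((α x).inverse b) - fderiv ℝ α x ((α x).inverse b) ((α x).inverse a)

theorem coframeStructure_apply {α : E → E →L[ℝ] V} {x : E} (h : (α x).IsInvertible) (v w : E) :
    coframeStructure α x (α x v) (α x w) = fderiv ℝ α x v w - fderiv ℝ α x w v := by
  simp only [coframeStructure, h.inverse_apply_self]

/-- The derivatives of `J` along the frame dual to `α`. -/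
noncomputable def frameDeriv (α : E → E →L[ℝ] V) (J : E → W) (x : E) : V →L[ℝ] W :=
  (fderiv ℝ J x).comp (α x).inverse

variable [CompleteSpace E] {α : E → E →L[ℝ] V} {J : E → W} {O : Set E} {B : Set W} {σ : W → E}

theorem ContDiffAt.clm_inverse {T : Type*} [NormedAddCommGroup T] [NormedSpace ℝ T]
    {α : T → E →L[ℝ] V} {x : T} (h : ContDiffAt ℝ ∞ α x) (hi : (α x).IsInvertible) :
    ContDiffAt ℝ ∞ (fun x => (α x).inverse) x :=
  ContDiffAt.comp x hi.contDiffAt_map_inverse h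

theorem contDiffAt_coframeStructure {x : E} (h : ContDiffAt ℝ ∞ α x) (hi : (α x).IsInvertible)
    (a b : V) : ContDiffAt ℝ ∞ (fun x => coframeStructure α x a b) x := by
  have h1 := h.clm_inverse hi
  have h2 : ∀ a, ContDiffAt ℝ ∞ (fun x => (α x).inverse a) x := fun a =>
    h1.clm_apply contDiffAt_const
  exact ((h.fderiv_infty.clm_apply (h2 a)).clm_apply (h2 b)).sub
    ((h.fderiv_infty.clm_apply (h2 b)).clm_apply (h2 a))

theorem contDiffAt_frameDeriv {x : E} (h : ContDiffAt ℝ ∞ α x) (hi : (α x).IsInvertible)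
    (hJ : ContDiffAt ℝ ∞ J x) : ContDiffAt ℝ ∞ (frameDeriv α J) x :=
  hJ.fderiv_infty.clm_comp (h.clm_inverse hi)

/-- A coframe `α` and a submersion `J` on a box such that the derivatives of `J` along the frame and
the structure functions are functions of `J`. -/
structure IsRegularCoframeBox (α : E → E →L[ℝ] V) (J : E → W) (O : Set E) (B : Set W)
    (σ : W → E) : Prop where
  box : IsFiberedBox J O B σ
  smooth : ∀ x ∈ O, ContDiffAt ℝ ∞ α x
  invertible : ∀ x ∈ O, (α x).IsInvertible
  smooth_J : ∀ x ∈ O, ContDiffAt ℝ ∞ J x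
  frameDeriv_ker : ∀ x ∈ O, ∀ v, fderiv ℝ J x v = 0 → fderiv ℝ (frameDeriv α J) x v = 0
  structure_ker : ∀ x ∈ O, ∀ a b v, fderiv ℝ J x v = 0 →
    fderiv ℝ (fun x => coframeStructure α x a b) x v = 0

namespace IsRegularCoframeBox

/-- Since `dJ` is `frameDeriv` composed with `α`, the matrix of `dJ` in the coframe depends on `J`
alone. This makes the constraints of the two Frobenius arguments below propagate. -/
theorem frameDeriv_eq (h : IsRegularCoframeBox α J O B σ) {x : E} (hx : x ∈ O) :
    frameDeriv α J x = frameDeriv α J (σ (J x)) :=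
  h.box.eq_section (fun x hx => (contDiffAt_frameDeriv (h.smooth x hx) (h.invertible x hx)
    (h.smooth_J x hx)).differentiableAt (by simp)) h.frameDeriv_ker hx

theorem coframeStructure_eq (h : IsRegularCoframeBox α J O B σ) {x y : E} (hx : x ∈ O) (hy : y ∈ O)
    (hxy : J x = J y) (a b : V) : coframeStructure α x a b = coframeStructure α y a b := by
  have key : ∀ x ∈ O, coframeStructure α x a b = coframeStructure α (σ (J x)) a b := fun x hx =>
    h.box.eq_section (f := fun x => coframeStructure α x a b)
      (fun x hx => (contDiffAt_coframeStructure (h.smooth x hx) (h.invertible x hx) a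
        b).differentiableAt (by simp)) (fun x hx => h.structure_ker x hx a b) hx
  rw [key x hx, key y hy, hxy]

theorem contDiffAt_frameDeriv_section (h : IsRegularCoframeBox α J O B σ) {b : W} (hb : b ∈ B) :
    ContDiffAt ℝ ∞ (fun b => frameDeriv α J (σ b)) b := by
  have hσ := h.box.mapsTo_section hb
  exact ContDiffAt.comp b (contDiffAt_frameDeriv (h.smooth _ hσ) (h.invertible _ hσ)
    (h.smooth_J _ hσ)) (h.box.smooth_section.contDiffAt (h.box.isOpen_base.mem_nhds hb))

/-- Points in the same fibre of `J` are related by a local equivalence of the coframe. -/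
theorem exists_equivalence (h : IsRegularCoframeBox α J O B σ) {x₀ y₀ : E} (hx₀ : x₀ ∈ O)
    (hy₀ : y₀ ∈ O) (hJ : J x₀ = J y₀) :
    ∃ f : E → E, f x₀ = y₀ ∧ ∀ᶠ x in 𝓝 x₀, ContDiffAt ℝ ∞ f x ∧ f x ∈ O ∧
      ∀ v, α (f x) (fderiv ℝ f x v) = α x v := by
  -- Cartan's graph method: a map `f` preserves the coframe if and only if `Df = A (x, f)`, because
  -- `A (x, y)` is the only linear map whose composition with `α y` is `α x`.
  set A : E × E → E →L[ℝ] E := fun z => (α z.2).inverse.comp (α z.1) with hA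
  have hO : ∀ᶠ z in 𝓝 (x₀, y₀), z.1 ∈ O ∧ z.2 ∈ O :=
    (h.box.isOpen.prod h.box.isOpen).mem_nhds ⟨hx₀, hy₀⟩
  have hAs : ∀ z : E × E, z.1 ∈ O → z.2 ∈ O → ContDiffAt ℝ ∞ A z := fun z h1 h2 =>
    (ContDiffAt.clm_inverse (α := fun z : E × E => α z.2)
      (ContDiffAt.comp z (h.smooth _ h2) contDiffAt_snd) (h.invertible _ h2)).clm_comp
      (ContDiffAt.comp z (h.smooth _ h1) contDiffAt_fst)
  have hαA : ∀ z : E × E, z.2 ∈ O → ∀ v, α z.2 (A z v) = α z.1 v := fun z h2 v =>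
    (h.invertible _ h2).self_apply_inverse _
  have hb₀ : J x₀ ∈ B := h.box.mapsTo hx₀
  -- The matrix of `dJ` in the coframe is a smooth, hence locally Lipschitz, function of `J`.
  -- Therefore the derivative of the constraint `J x - J y` along a solution is bounded by a
  -- multiple of the constraint.
  obtain ⟨K, s, hs, hK⟩ :=
    ((h.contDiffAt_frameDeriv_section hb₀).of_le (by simp : (1 : WithTop ℕ∞) ≤ ∞)).exists_lipschitzOnWith
  have hJc : ∀ x ∈ O, ContinuousAt J x := fun x hx => (h.smooth_J x hx).continuousAt
  have hgev : ∀ᶠ z in 𝓝 (x₀, y₀), J z.1 ∈ s ∧ J z.2 ∈ s := by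
    have h1 : ContinuousAt (fun z : E × E => J z.1) (x₀, y₀) :=
      ContinuousAt.comp (f := Prod.fst) (hJc x₀ hx₀) continuousAt_fst
    have h2 : ContinuousAt (fun z : E × E => J z.2) (x₀, y₀) :=
      ContinuousAt.comp (f := Prod.snd) (hJc y₀ hy₀) continuousAt_snd
    exact (h1.eventually hs).and (h2.eventually (show s ∈ 𝓝 (J y₀) by rw [← hJ]; exact hs))
  have hbd : ∀ᶠ z in 𝓝 (x₀, y₀), ‖α z.1‖ ≤ ‖α x₀‖ + 1 := by
    have h1 : ContinuousAt (fun z : E × E => ‖α z.1‖) (x₀, y₀) :=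
      ContinuousAt.norm (ContinuousAt.comp (f := Prod.fst) (h.smooth x₀ hx₀).continuousAt
        continuousAt_fst)
    exact (h1.eventually_lt continuousAt_const (by simp)).mono fun z hz => le_of_lt hz
  have hfrob := exists_hasFDerivAt_eq_of_integrable (A := A) (x₀ := x₀) (y₀ := y₀)
    (g := fun z => J z.1 - J z.2) (K := K * (‖α x₀‖ + 1)) (hO.mono fun z hz => hAs z hz.1 hz.2)
    (by simp [hJ])
  refine (hfrob ?_ ?_).elim fun f hf => ?_
  · filter_upwards [hO, hgev, hbd] with z hz hzs hzb
    have hd : HasFDerivAt (fun z : E × E => J z.1 - J z.2)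
        ((fderiv ℝ J z.1).comp (ContinuousLinearMap.fst ℝ E E) -
          (fderiv ℝ J z.2).comp (ContinuousLinearMap.snd ℝ E E)) z :=
      (((h.smooth_J _ hz.1).differentiableAt (by simp)).hasFDerivAt.comp z hasFDerivAt_fst).sub
        (((h.smooth_J _ hz.2).differentiableAt (by simp)).hasFDerivAt.comp z hasFDerivAt_snd)
    refine ⟨hd.differentiableAt, fun v => ?_⟩
    rw [hd.fderiv]
    have e1 : fderiv ℝ J z.1 v = frameDeriv α J z.1 (α z.1 v) := by
      simp [frameDeriv, (h.invertible _ hz.1).inverse_apply_self]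
    have e2 : fderiv ℝ J z.2 (A z v) = frameDeriv α J z.2 (α z.1 v) := rfl
    have e3 : ((fderiv ℝ J z.1).comp (ContinuousLinearMap.fst ℝ E E) -
          (fderiv ℝ J z.2).comp (ContinuousLinearMap.snd ℝ E E)) (v, A z v) =
        (frameDeriv α J (σ (J z.1)) - frameDeriv α J (σ (J z.2))) (α z.1 v) := by
      rw [← h.frameDeriv_eq hz.1, ← h.frameDeriv_eq hz.2]
      change fderiv ℝ J z.1 v - fderiv ℝ J z.2 (A z v) = _
      rw [e1, e2]; rfl
    rw [e3]
    have := hK.dist_le_mul _ hzs.1 _ hzs.2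
    rw [dist_eq_norm, dist_eq_norm] at this
    calc _ ≤ ‖frameDeriv α J (σ (J z.1)) - frameDeriv α J (σ (J z.2))‖ * ‖α z.1 v‖ :=
          ContinuousLinearMap.le_opNorm _ _
      _ ≤ (K * ‖J z.1 - J z.2‖) * ((‖α x₀‖ + 1) * ‖v‖) :=
          mul_le_mul this ((α z.1).le_of_opNorm_le hzb v) (norm_nonneg _) (by positivity)
      _ = _ := by ring
  · filter_upwards [hO.eventually_nhds] with z hz hgz v w
    have hz0 := hz.self_of_nhds
    have hdA := ((hAs z hz0.1 hz0.2).differentiableAt (by simp)).hasFDerivAt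
    have hd1 : HasFDerivAt (fun z : E × E => α z.1)
        ((fderiv ℝ α z.1).comp (ContinuousLinearMap.fst ℝ E E)) z :=
      ((h.smooth _ hz0.1).differentiableAt (by simp)).hasFDerivAt.comp z hasFDerivAt_fst
    have hd2 : HasFDerivAt (fun z : E × E => α z.2)
        ((fderiv ℝ α z.2).comp (ContinuousLinearMap.snd ℝ E E)) z :=
      ((h.smooth _ hz0.2).differentiableAt (by simp)).hasFDerivAt.comp z hasFDerivAt_snd
    -- The derivative of `α y (A (x, y) w) = α x w` in the direction `(v, A v)`. Antisymmetrising in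
    -- `v` and `w` turns the failure of integrability into the difference of the structure functions
    -- at `x` and `y`, which is zero where `J x = J y`.
    have key : ∀ v w : E, fderiv ℝ α z.2 (A z v) (A z w) + α z.2 (fderiv ℝ A z (v, A z v) w) =
        fderiv ℝ α z.1 v w := by
      intro v w
      have l := hd2.clm_apply (hdA.clm_apply (hasFDerivAt_const w z))
      have r := hd1.clm_apply (hasFDerivAt_const w z)
      have hev : (fun z : E × E => α z.2 (A z w)) =ᶠ[𝓝 z] fun z => α z.1 w := by
        filter_upwards [hz] with z' hz' using hαA z' hz'.2 w
      have := congrArg (fun T => T (v, A z v)) (l.unique (r.congr_of_eventuallyEq hev))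
      simpa [add_comm] using this
    have k1 := key v w
    have k2 := key w v
    have k3 := h.coframeStructure_eq hz0.1 hz0.2 (sub_eq_zero.1 hgz) (α z.1 v) (α z.1 w)
    rw [coframeStructure_apply (h.invertible _ hz0.1), ← hαA z hz0.2 v, ← hαA z hz0.2 w,
      coframeStructure_apply (h.invertible _ hz0.2), ← k1, ← k2] at k3
    apply (h.invertible _ hz0.2).injective
    rw [← sub_eq_zero] at k3 ⊢
    rw [← k3]
    abel
  · obtain ⟨hf₀, hf⟩ := hf
    refine ⟨f, hf₀, ?_⟩
    have hfc : ContinuousAt f x₀ := hf.self_of_nhds.1.continuousAt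
    filter_upwards [hf, hfc.eventually (by rw [hf₀]; exact h.box.isOpen.mem_nhds hy₀)]
      with x hx hxO
    refine ⟨hx.1, hxO, fun v => ?_⟩
    rw [hx.2.fderiv]
    exact hαA (x, f x) hxO v

/-- A vector tangent to the fibres of `J` extends to an infinitesimal symmetry of the coframe. -/
theorem exists_symmetry (h : IsRegularCoframeBox α J O B σ) {x₀ v₀ : E} (hx₀ : x₀ ∈ O)
    (hv₀ : fderiv ℝ J x₀ v₀ = 0) :
    ∃ ξ : E → E, ξ x₀ = v₀ ∧ ∀ᶠ x in 𝓝 x₀, ContDiffAt ℝ ∞ ξ x ∧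
      ∀ w, fderiv ℝ α x (ξ x) w + α x (fderiv ℝ ξ x w) = 0 := by
  -- The linearised problem: solving the symmetry equation for the derivative of `ξ` gives `Dξ = A
  -- (x, ξ)`. The constraint is that `ξ` be tangent to the fibres of `J`.
  set A : E × E → E →L[ℝ] E := fun z => -(α z.1).inverse.comp (fderiv ℝ α z.1 z.2) with hA
  have hO : ∀ᶠ z in 𝓝 (x₀, v₀), z.1 ∈ O := by
    filter_upwards [(h.box.isOpen.prod isOpen_univ).mem_nhds ⟨hx₀, mem_univ v₀⟩] with z hz
      using hz.1
  have hD : ∀ z : E × E, z.1 ∈ O → ContDiffAt ℝ ∞ (fun z : E × E => fderiv ℝ α z.1 z.2) z :=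
    fun z hz => (ContDiffAt.comp z (h.smooth _ hz).fderiv_infty contDiffAt_fst).clm_apply
      contDiffAt_snd
  have hAs : ∀ z : E × E, z.1 ∈ O → ContDiffAt ℝ ∞ A z := fun z h1 =>
    ((ContDiffAt.clm_inverse (α := fun z : E × E => α z.1)
      (ContDiffAt.comp z (h.smooth _ h1) contDiffAt_fst) (h.invertible _ h1)).clm_comp
      (hD z h1)).neg
  have hαA : ∀ z : E × E, z.1 ∈ O → ∀ v, α z.1 (A z v) = - fderiv ℝ α z.1 z.2 v := by
    intro z h1 v
    simp [hA, (h.invertible _ h1).self_apply_inverse]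
  have hb₀ : J x₀ ∈ B := h.box.mapsTo hx₀
  set Γ : W → V →L[ℝ] W := fun b => frameDeriv α J (σ b) with hΓ
  have hΓc : ContinuousAt (fun z : E × E => ‖fderiv ℝ Γ (J z.1)‖) (x₀, v₀) := by
    have h1 : ContinuousAt (fun z : E × E => J z.1) (x₀, v₀) :=
      ContinuousAt.comp (f := Prod.fst) (h.smooth_J x₀ hx₀).continuousAt continuousAt_fst
    exact (ContinuousAt.comp (f := fun z : E × E => J z.1) (x := (x₀, v₀))
      (h.contDiffAt_frameDeriv_section hb₀).fderiv_infty.continuousAt h1).norm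
  have hbd : ∀ᶠ z in 𝓝 (x₀, v₀), ‖α z.1‖ < ‖α x₀‖ + 1 := by
    have h1 : ContinuousAt (fun z : E × E => ‖α z.1‖) (x₀, v₀) :=
      ContinuousAt.norm (ContinuousAt.comp (f := Prod.fst) (h.smooth x₀ hx₀).continuousAt
        continuousAt_fst)
    exact h1.eventually_lt continuousAt_const (by simp)
  have hbΓ : ∀ᶠ z in 𝓝 (x₀, v₀), ‖fderiv ℝ Γ (J z.1)‖ < ‖fderiv ℝ Γ (J x₀)‖ + 1 :=
    hΓc.eventually_lt continuousAt_const (by simp)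
  have hfrob := exists_hasFDerivAt_eq_of_integrable (A := A) (x₀ := x₀) (y₀ := v₀)
    (g := fun z => fderiv ℝ J z.1 z.2) (K := (‖fderiv ℝ Γ (J x₀)‖ + 1) * (‖α x₀‖ + 1))
    (hO.mono fun z hz => hAs z hz) hv₀
  refine (hfrob ?_ ?_).elim fun f hf => ?_
  · filter_upwards [hO, hbd, hbΓ] with z hz hzb hzΓ
    have hdJ : HasFDerivAt (fderiv ℝ J) (fderiv ℝ (fderiv ℝ J) z.1) z.1 :=
      ((h.smooth_J _ hz).fderiv_infty.differentiableAt (by simp)).hasFDerivAt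
    have hd : HasFDerivAt (fun z : E × E => fderiv ℝ J z.1 z.2) _ z :=
      (hdJ.comp z hasFDerivAt_fst).clm_apply hasFDerivAt_snd
    refine ⟨hd.differentiableAt, fun w => ?_⟩
    have hsymm : fderiv ℝ (fderiv ℝ J) z.1 w z.2 = fderiv ℝ (fderiv ℝ J) z.1 z.2 w :=
      ((h.smooth_J _ hz).isSymmSndFDerivAt minSmoothness_two_le_infty) w z.2
    have hG := ((contDiffAt_frameDeriv (h.smooth _ hz) (h.invertible _ hz)
      (h.smooth_J _ hz)).differentiableAt (by simp)).hasFDerivAt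
    have hα := ((h.smooth _ hz).differentiableAt (by simp)).hasFDerivAt
    have e1 : fderiv ℝ (fderiv ℝ J) z.1 z.2 w = fderiv ℝ (frameDeriv α J) z.1 z.2 (α z.1 w) +
        frameDeriv α J z.1 (fderiv ℝ α z.1 z.2 w) := by
      have l := hdJ.clm_apply (hasFDerivAt_const w z.1)
      have r := hG.clm_apply (hα.clm_apply (hasFDerivAt_const w z.1))
      have hev : (fun x => fderiv ℝ J x w) =ᶠ[𝓝 z.1] fun x => frameDeriv α J x (α x w) := by
        filter_upwards [h.box.isOpen.mem_nhds hz] with x hx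
        simp [frameDeriv, (h.invertible _ hx).inverse_apply_self]
      have := congrArg (fun T => T z.2) (l.unique (r.congr_of_eventuallyEq hev))
      simpa [add_comm] using this
    have e2 : fderiv ℝ J z.1 (A z w) = - frameDeriv α J z.1 (fderiv ℝ α z.1 z.2 w) := by
      simp [hA, frameDeriv]
    have e3 : fderiv ℝ (frameDeriv α J) z.1 = (fderiv ℝ Γ (J z.1)).comp (fderiv ℝ J z.1) := by
      have l := ((h.contDiffAt_frameDeriv_section (h.box.mapsTo hz)).differentiableAt
        (by simp)).hasFDerivAt.comp z.1 ((h.smooth_J _ hz).differentiableAt (by simp)).hasFDerivAt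
      refine (l.congr_of_eventuallyEq ?_).fderiv
      filter_upwards [h.box.isOpen.mem_nhds hz] with x hx using h.frameDeriv_eq hx
    -- By symmetry of the second derivative of `J` and the formula `dJ = Γ(J) ∘ α`, everything
    -- cancels except a term linear in the constraint `dJ(ξ)`.
    have e4 : fderiv ℝ (fun z : E × E => fderiv ℝ J z.1 z.2) z (w, A z w) =
        fderiv ℝ Γ (J z.1) (fderiv ℝ J z.1 z.2) (α z.1 w) := by
      rw [hd.fderiv]
      have : fderiv ℝ (fderiv ℝ J) z.1 w z.2 + fderiv ℝ J z.1 (A z w) =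
          fderiv ℝ Γ (J z.1) (fderiv ℝ J z.1 z.2) (α z.1 w) := by
        rw [hsymm, e1, e2, e3]
        simp
      rw [← this]
      simp [add_comm]
    rw [e4]
    calc _ ≤ ‖fderiv ℝ Γ (J z.1) (fderiv ℝ J z.1 z.2)‖ * ‖α z.1 w‖ :=
          ContinuousLinearMap.le_opNorm _ _
      _ ≤ ((‖fderiv ℝ Γ (J x₀)‖ + 1) * ‖fderiv ℝ J z.1 z.2‖) * ((‖α x₀‖ + 1) * ‖w‖) :=
          mul_le_mul ((fderiv ℝ Γ (J z.1)).le_of_opNorm_le hzΓ.le _)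
            ((α z.1).le_of_opNorm_le hzb.le w) (norm_nonneg _) (by positivity)
      _ = _ := by ring
  · filter_upwards [hO.eventually_nhds] with z hz hgz w₁ w₂
    have hz0 := hz.self_of_nhds
    have hi := h.invertible _ hz0
    have hdA := ((hAs z hz0).differentiableAt (by simp)).hasFDerivAt
    have hα := ((h.smooth _ hz0).differentiableAt (by simp)).hasFDerivAt
    have hα2 := ((h.smooth _ hz0).fderiv_infty.differentiableAt (by simp)).hasFDerivAt
    have hd1 : HasFDerivAt (fun z : E × E => α z.1)
        ((fderiv ℝ α z.1).comp (ContinuousLinearMap.fst ℝ E E)) z := hα.comp z hasFDerivAt_fst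
    have hd2 : HasFDerivAt (fun z : E × E => fderiv ℝ α z.1 z.2) _ z :=
      (hα2.comp z hasFDerivAt_fst).clm_apply hasFDerivAt_snd
    have key : ∀ v w : E, fderiv ℝ α z.1 v (A z w) + α z.1 (fderiv ℝ A z (v, A z v) w) =
        -(fderiv ℝ (fderiv ℝ α) z.1 v z.2 w + fderiv ℝ α z.1 (A z v) w) := by
      intro v w
      have l := hd1.clm_apply (hdA.clm_apply (hasFDerivAt_const w z))
      have r := (hd2.clm_apply (hasFDerivAt_const w z)).neg
      have hev : (fun z : E × E => α z.1 (A z w)) =ᶠ[𝓝 z] -fun z => fderiv ℝ α z.1 z.2 w := by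
        filter_upwards [hz] with z' hz' using hαA z' hz' w
      have := congrArg (fun T => T (v, A z v)) (l.unique (r.congr_of_eventuallyEq hev))
      simpa [add_comm] using this
    -- the structure functions are constant in the direction `z.2`
    have hinv : ∀ w : E, HasFDerivAt (fun x => (α x).inverse (α z.1 w))
        (fderiv ℝ (fun x => (α x).inverse (α z.1 w)) z.1) z.1 := fun w =>
      ((((h.smooth _ hz0).clm_inverse hi).clm_apply
        contDiffAt_const).differentiableAt (by simp)).hasFDerivAt
    have hinv' : ∀ w : E, fderiv ℝ (fun x => (α x).inverse (α z.1 w)) z.1 z.2 = A z w := by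
      intro w
      have l := hα.clm_apply (hinv w)
      have hev : (fun x => α x ((α x).inverse (α z.1 w))) =ᶠ[𝓝 z.1] fun _ => α z.1 w := by
        filter_upwards [h.box.isOpen.mem_nhds hz0] with x hx
          using (h.invertible _ hx).self_apply_inverse _
      have := congrArg (fun T => T z.2)
        (l.unique ((hasFDerivAt_const (α z.1 w) z.1).congr_of_eventuallyEq hev))
      apply hi.injective
      rw [hαA z hz0]
      simp only [add_apply, ContinuousLinearMap.comp_apply,
        ContinuousLinearMap.flip_apply, hi.inverse_apply_self, zero_apply] at this
      exact eq_neg_of_add_eq_zero_left this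
    have hc : fderiv ℝ (fun x => coframeStructure α x (α z.1 w₁) (α z.1 w₂)) z.1 z.2 =
        (fderiv ℝ (fderiv ℝ α) z.1 z.2 w₁ w₂ + fderiv ℝ α z.1 (A z w₁) w₂ +
          fderiv ℝ α z.1 w₁ (A z w₂)) - (fderiv ℝ (fderiv ℝ α) z.1 z.2 w₂ w₁ +
          fderiv ℝ α z.1 (A z w₂) w₁ + fderiv ℝ α z.1 w₂ (A z w₁)) := by
      have := ((hα2.clm_apply (hinv w₁)).clm_apply (hinv w₂)).sub
        ((hα2.clm_apply (hinv w₂)).clm_apply (hinv w₁))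
      have e := this.fderiv
      change fderiv ℝ (fun x => coframeStructure α x (α z.1 w₁) (α z.1 w₂)) z.1 = _ at e
      rw [e]
      simp only [add_apply, sub_apply, ContinuousLinearMap.comp_apply,
        ContinuousLinearMap.flip_apply, hi.inverse_apply_self, hinv']
      abel
    -- On the constraint set the structure functions have derivative zero along `z.2`. Up to the
    -- symmetry of the second derivative of `α`, this is the integrability condition.
    rw [h.structure_ker _ hz0 _ _ _ hgz] at hc
    have hsymm : ∀ w, fderiv ℝ (fderiv ℝ α) z.1 w z.2 = fderiv ℝ (fderiv ℝ α) z.1 z.2 w :=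
      fun w => ((h.smooth _ hz0).isSymmSndFDerivAt minSmoothness_two_le_infty) w z.2
    have k1 := key w₁ w₂
    have k2 := key w₂ w₁
    rw [hsymm] at k1 k2
    apply hi.injective
    rw [← eq_sub_iff_add_eq'] at k1 k2
    rw [k1, k2, ← sub_eq_zero, ← neg_eq_zero, hc]
    abel
  · obtain ⟨hf₀, hf⟩ := hf
    refine ⟨f, hf₀, ?_⟩
    filter_upwards [hf, h.box.isOpen.mem_nhds hx₀] with x hx hxO
    refine ⟨hx.1, fun w => ?_⟩
    rw [hx.2.fderiv, hαA (x, f x) hxO, add_neg_cancel]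

end IsRegularCoframeBox

/-- A map whose derivative is bounded by its value vanishes near a zero. -/
theorem eventually_eq_zero_of_norm_fderiv_le {X Y : Type*} [NormedAddCommGroup X]
    [NormedSpace ℝ X] [NormedAddCommGroup Y] [NormedSpace ℝ Y] {f : X → Y} {x₀ : X} {C : ℝ} (h0 : f x₀ = 0)
    (hf : ∀ᶠ x in 𝓝 x₀, DifferentiableAt ℝ f x ∧ ∀ v, ‖fderiv ℝ f x v‖ ≤ C * ‖f x‖ * ‖v‖) :
    ∀ᶠ x in 𝓝 x₀, f x = 0 := by
  obtain ⟨r, hr, hball⟩ := Metric.eventually_nhds_iff_ball.1 hf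
  filter_upwards [ball_mem_nhds x₀ hr] with x hx
  have hin : ∀ t ∈ Icc (0 : ℝ) 1, x₀ + t • (x - x₀) ∈ ball x₀ r := fun t ht =>
    (convex_ball x₀ r).add_smul_sub_mem (mem_ball_self hr) hx ht
  have hd : ∀ t ∈ Icc (0 : ℝ) 1, HasDerivAt (fun t : ℝ => f (x₀ + t • (x - x₀)))
      (fderiv ℝ f (x₀ + t • (x - x₀)) (x - x₀)) t := fun t ht =>
    (hball _ (hin t ht)).1.hasFDerivAt.comp_hasDerivAt t
      (by simpa using ((hasDerivAt_id t).smul_const (x - x₀)).const_add x₀)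
  have := eq_zero_of_abs_deriv_le_mul_abs_self_of_eq_zero_right (K := C * ‖x - x₀‖)
    (f := fun t : ℝ => f (x₀ + t • (x - x₀))) (a := 0) (b := 1)
    (fun t ht => (hd t ht).continuousAt.continuousWithinAt)
    (fun t ht => (hd t (Ico_subset_Icc_self ht)).hasDerivWithinAt) (by simp [h0])
    (fun t ht => ((hball _ (hin t (Ico_subset_Icc_self ht))).2 _).trans (le_of_eq (by ring)))
    1 (by simp)
  simpa using this

/-- An infinitesimal symmetry of a coframe that vanishes at a point vanishes near it. -/
theorem eventually_eq_zero_of_coframe_symmetry {ξ : E → E} {x₀ : E}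
    (hα : ContDiffAt ℝ ∞ α x₀) (hi : (α x₀).IsInvertible) (h0 : ξ x₀ = 0)
    (hξ : ∀ᶠ x in 𝓝 x₀, DifferentiableAt ℝ ξ x ∧
      ∀ w, fderiv ℝ α x (ξ x) w + α x (fderiv ℝ ξ x w) = 0) : ∀ᶠ x in 𝓝 x₀, ξ x = 0 := by
  have h1 : ∀ᶠ x in 𝓝 x₀, ‖(α x).inverse‖ < ‖(α x₀).inverse‖ + 1 :=
    (hα.clm_inverse hi).continuousAt.norm.eventually_lt continuousAt_const (by simp)
  have h2 : ∀ᶠ x in 𝓝 x₀, ‖fderiv ℝ α x‖ < ‖fderiv ℝ α x₀‖ + 1 :=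
    hα.fderiv_infty.continuousAt.norm.eventually_lt continuousAt_const (by simp)
  refine eventually_eq_zero_of_norm_fderiv_le
    (C := (‖(α x₀).inverse‖ + 1) * (‖fderiv ℝ α x₀‖ + 1)) h0 ?_
  filter_upwards [hξ, h1, h2, hα.continuousAt.eventually_isInvertible hi] with x hx h1 h2 hxi
  refine ⟨hx.1, fun w => ?_⟩
  -- The symmetry equation expresses the derivative of `ξ` linearly in `ξ`, with locally bounded
  -- coefficients.
  have e : fderiv ℝ ξ x w = - (α x).inverse (fderiv ℝ α x (ξ x) w) := by
    apply hxi.injective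
    rw [map_neg, hxi.self_apply_inverse]
    exact eq_neg_of_add_eq_zero_right (hx.2 w)
  rw [e, norm_neg]
  calc _ ≤ (‖(α x₀).inverse‖ + 1) * ‖fderiv ℝ α x (ξ x) w‖ :=
        ContinuousLinearMap.le_of_opNorm_le _ h1.le _
    _ ≤ (‖(α x₀).inverse‖ + 1) * (((‖fderiv ℝ α x₀‖ + 1) * ‖ξ x‖) * ‖w‖) := by
        gcongr
        exact ContinuousLinearMap.le_of_opNorm_le _ ((fderiv ℝ α x).le_of_opNorm_le h2.le _) _
    _ = _ := by ring

end CoframesInCharts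

/-! ### The chain rule and naturality of the Lie bracket -/

section ManifoldCalculus

variable {E : Type*} [NormedAddCommGroup E] [NormedSpace ℝ E]
  {M : Type*} [TopologicalSpace M] [ChartedSpace E M]
  {E' : Type*} [NormedAddCommGroup E'] [NormedSpace ℝ E']
  {N : Type*} [TopologicalSpace N] [ChartedSpace E' N]
  {V : Type*} [NormedAddCommGroup V] [NormedSpace ℝ V]

theorem mvfderiv_comp_mfderiv {g : N → V} {h : M → N} {p : M}
    (hg : MDifferentiableAt 𝓘(ℝ, E') 𝓘(ℝ, V) g (h p))
    (hh : MDifferentiableAt 𝓘(ℝ, E) 𝓘(ℝ, E') h p) (v : TangentSpace 𝓘(ℝ, E) p) :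
    mvfderiv 𝓘(ℝ, E) (fun q => g (h q)) p v =
      mvfderiv 𝓘(ℝ, E') g (h p) (mfderiv 𝓘(ℝ, E) 𝓘(ℝ, E') h p v) :=
  congrArg (fun L => L v) (mfderiv_comp p hg hh)

theorem Filter.EventuallyEq.mvfderiv_eq {f g : M → V} {p : M} (h : f =ᶠ[𝓝 p] g) :
    mvfderiv 𝓘(ℝ, E) f p = mvfderiv 𝓘(ℝ, E) g p := by
  ext v
  exact congrArg (fun L : E →L[ℝ] V => L v) (h.mfderiv_eq (I := 𝓘(ℝ, E)) (I' := 𝓘(ℝ, V)))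

theorem mvfderiv_clm_comp {W : Type*} [NormedAddCommGroup W] [NormedSpace ℝ W] (L : V →L[ℝ] W)
    {f : M → V} {p : M} (hf : MDifferentiableAt 𝓘(ℝ, E) 𝓘(ℝ, V) f p)
    (v : TangentSpace 𝓘(ℝ, E) p) :
    mvfderiv 𝓘(ℝ, E) (fun q => L (f q)) p v = L (mvfderiv 𝓘(ℝ, E) f p v) := by
  have := mfderiv_comp p (I := 𝓘(ℝ, E)) (I' := 𝓘(ℝ, V)) (I'' := 𝓘(ℝ, W)) (g := L)
    (f := f) L.differentiableAt.mdifferentiableAt hf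
  rw [mfderiv_eq_fderiv, L.fderiv] at this
  exact congrArg (fun L => L v) this

/-- Only smoothness at the base point is required, so that charts and other partially defined maps
are covered. -/
theorem ContMDiffAt.contMDiffAt_tangentMap [IsManifold 𝓘(ℝ, E) ∞ M] [IsManifold 𝓘(ℝ, E') ∞ N]
    {f : M → N} {v : TangentBundle 𝓘(ℝ, E) M}
    (hf : ContMDiffAt 𝓘(ℝ, E) 𝓘(ℝ, E') ∞ f v.proj) :
    ContMDiffAt 𝓘(ℝ, E).tangent 𝓘(ℝ, E').tangent ∞ (tangentMap 𝓘(ℝ, E) 𝓘(ℝ, E') f) v := by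
  have : IsManifold 𝓘(ℝ, E) 1 M := IsManifold.of_le (n := ∞) (WithTop.coe_le_coe.2 le_top)
  have : IsManifold 𝓘(ℝ, E') 1 N := IsManifold.of_le (n := ∞) (WithTop.coe_le_coe.2 le_top)
  refine ContMDiffAt.clm_apply_of_inCoordinates
    (b₁ := fun w : TangentBundle 𝓘(ℝ, E) M => w.proj) (b₂ := fun w => f w.proj)
    (ϕ := fun w => mfderiv 𝓘(ℝ, E) 𝓘(ℝ, E') f w.proj) (v := fun w => w.snd)
    (E₁ := (TangentSpace 𝓘(ℝ, E) : M → Type _)) (E₂ := (TangentSpace 𝓘(ℝ, E') : N → Type _))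
    ?_ contMDiffAt_id ?_
  · exact ContMDiffAt.comp v (hf.mfderiv_const (m := ∞) (by simp))
      (Bundle.contMDiff_proj _).contMDiffAt
  · exact ContMDiffAt.comp v hf (Bundle.contMDiff_proj _).contMDiffAt

theorem mdifferentiableAt_of_contMDiffAt_infty {f : M → N} {q : M}
    (hf : ContMDiffAt 𝓘(ℝ, E) 𝓘(ℝ, E') ∞ f q) : MDifferentiableAt 𝓘(ℝ, E) 𝓘(ℝ, E') f q :=
  hf.mdifferentiableAt (by simp)

section
variable [IsManifold 𝓘(ℝ, E) ∞ M]

theorem SmoothVFAt.mvfderiv {f : M → V} {ξ : Π q : M, TangentSpace 𝓘(ℝ, E) q} {q : M}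
    (hf : ContMDiffAt 𝓘(ℝ, E) 𝓘(ℝ, V) ∞ f q) (hξ : SmoothVFAt ξ q) :
    ContMDiffAt 𝓘(ℝ, E) 𝓘(ℝ, V) ∞ (fun r => mvfderiv 𝓘(ℝ, E) f r (ξ r)) q :=
  ContMDiffAt.comp q (contMDiff_snd_tangentBundle_modelSpace V 𝓘(ℝ, V)).contMDiffAt
    (ContMDiffAt.comp q (g := tangentMap 𝓘(ℝ, E) 𝓘(ℝ, V) f)
      (ContMDiffAt.contMDiffAt_tangentMap (v := ⟨q, ξ q⟩) hf) hξ)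

theorem contMDiffAt_chartAt {p q : M} (hq : q ∈ (chartAt E p).source) :
    ContMDiffAt 𝓘(ℝ, E) 𝓘(ℝ, E) ∞ (chartAt E p) q :=
  contMDiffOn_chart.contMDiffAt ((chartAt E p).open_source.mem_nhds hq)

theorem contMDiffAt_chartAt_symm {p : M} {x : E} (hx : x ∈ (chartAt E p).target) :
    ContMDiffAt 𝓘(ℝ, E) 𝓘(ℝ, E) ∞ (chartAt E p).symm x :=
  contMDiffOn_chart_symm.contMDiffAt ((chartAt E p).open_target.mem_nhds hx)

theorem mdifferentiable_chartAt (p : M) :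
    (chartAt E p).MDifferentiable 𝓘(ℝ, E) 𝓘(ℝ, E) :=
  have : IsManifold 𝓘(ℝ, E) 1 M := IsManifold.of_le (n := ∞) (WithTop.coe_le_coe.2 le_top)
  mdifferentiable_chart p

/-- The Lie bracket is compatible with maps: brackets of related vector fields are related. -/
theorem mfderiv_mlieBracket_of_related [CompleteSpace E] [CompleteSpace E']
    [IsManifold 𝓘(ℝ, E') ∞ N] {h : M → N} {p : M} {ξ η : Π q : M, TangentSpace 𝓘(ℝ, E) q}
    {ξ' η' : Π q : N, TangentSpace 𝓘(ℝ, E') q}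
    (hh : ∀ᶠ q in 𝓝 p, ContMDiffAt 𝓘(ℝ, E) 𝓘(ℝ, E') ∞ h q)
    (hξ : ∀ᶠ q in 𝓝 p, SmoothVFAt ξ q) (hη : ∀ᶠ q in 𝓝 p, SmoothVFAt η q)
    (hξ' : ∀ᶠ q in 𝓝 (h p), SmoothVFAt ξ' q) (hη' : ∀ᶠ q in 𝓝 (h p), SmoothVFAt η' q)
    (hξξ' : ∀ᶠ q in 𝓝 p, mfderiv 𝓘(ℝ, E) 𝓘(ℝ, E') h q (ξ q) = ξ' (h q))
    (hηη' : ∀ᶠ q in 𝓝 p, mfderiv 𝓘(ℝ, E) 𝓘(ℝ, E') h q (η q) = η' (h q)) :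
    mfderiv 𝓘(ℝ, E) 𝓘(ℝ, E') h p (mlieBracket 𝓘(ℝ, E) ξ η p) =
      mlieBracket 𝓘(ℝ, E') ξ' η' (h p) := by
  have hhp := hh.self_of_nhds
  have hhc : ContinuousAt h p := hhp.continuousAt
  apply ((mdifferentiable_chartAt (h p)).mfderiv_injective (mem_chart_source E' (h p)))
  have hsep : ∀ {v w : E'}, (∀ ℓ : E' →L[ℝ] ℝ, ℓ v = ℓ w) → v = w :=
    (SeparatingDual.eq_iff_forall_dual_eq (R := ℝ)).2
  -- Tangent vectors are separated by the functions `ℓ ∘ φ`, and on functions a bracket acts as a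
  -- commutator. Both commutators, in the source and in the target, give the same number.
  refine hsep fun ℓ => ?_
  set φ := chartAt E' (h p) with hφ
  have hf : ∀ r ∈ φ.source, ContMDiffAt 𝓘(ℝ, E') 𝓘(ℝ, ℝ) ∞ (fun s => ℓ (φ s)) r := fun r hr =>
    ContMDiffAt.comp r ℓ.contDiff.contMDiff.contMDiffAt (contMDiffAt_chartAt hr)
  have hsrc : ∀ᶠ r in 𝓝 (h p), r ∈ φ.source := φ.open_source.mem_nhds (mem_chart_source E' (h p))
  have hev : ∀ w : TangentSpace 𝓘(ℝ, E') (h p), mvfderiv 𝓘(ℝ, E') (fun s => ℓ (φ s)) (h p) w =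
      ℓ (mfderiv 𝓘(ℝ, E') 𝓘(ℝ, E') φ (h p) w) := fun w =>
    mvfderiv_clm_comp ℓ ((mdifferentiable_chartAt (h p)).mdifferentiableAt
      (mem_chart_source E' (h p))) w
  have hd : ∀ {g : N → ℝ} {q : M}, ContMDiffAt 𝓘(ℝ, E') 𝓘(ℝ, ℝ) ∞ g (h q) →
      ContMDiffAt 𝓘(ℝ, E) 𝓘(ℝ, E') ∞ h q → ∀ v, mvfderiv 𝓘(ℝ, E) (fun r => g (h r)) q v =
      mvfderiv 𝓘(ℝ, E') g (h q) (mfderiv 𝓘(ℝ, E) 𝓘(ℝ, E') h q v) := fun hg hq v =>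
    mvfderiv_comp_mfderiv (mdifferentiableAt_of_contMDiffAt_infty hg)
      (mdifferentiableAt_of_contMDiffAt_infty hq) v
  set f : N → ℝ := fun s => ℓ (φ s) with hfdef
  set a : N → ℝ := fun r => mvfderiv 𝓘(ℝ, E') f r (η' r) with ha
  set b : N → ℝ := fun r => mvfderiv 𝓘(ℝ, E') f r (ξ' r) with hb
  have hfp := hf _ (mem_chart_source E' (h p))
  have hap : ContMDiffAt 𝓘(ℝ, E') 𝓘(ℝ, ℝ) ∞ a (h p) := SmoothVFAt.mvfderiv hfp hη'.self_of_nhds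
  have hbp : ContMDiffAt 𝓘(ℝ, E') 𝓘(ℝ, ℝ) ∞ b (h p) := SmoothVFAt.mvfderiv hfp hξ'.self_of_nhds
  have k1 := mvfderiv_mlieBracket (f := f) (a := a) (b := b) hξ'.self_of_nhds hη'.self_of_nhds hξ'
    hη' (hsrc.mono hf) hap hbp (Eventually.of_forall fun r => rfl) (Eventually.of_forall fun r => rfl)
  have k2 := mvfderiv_mlieBracket (f := fun q => f (h q)) (a := fun q => a (h q))
    (b := fun q => b (h q)) hξ.self_of_nhds hη.self_of_nhds hξ hη
    (by filter_upwards [hh, hhc.eventually hsrc] with q h1 h2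
        exact ContMDiffAt.comp (g := f) q (hf _ h2) h1)
    (ContMDiffAt.comp p hap hhp) (ContMDiffAt.comp p hbp hhp)
    (by filter_upwards [hh, hhc.eventually hsrc, hηη'] with q h1 h2 h3
        rw [hd (hf _ h2) h1, h3])
    (by filter_upwards [hh, hhc.eventually hsrc, hξξ'] with q h1 h2 h3
        rw [hd (hf _ h2) h1, h3])
  rw [hd hfp hhp, hd hap hhp, hd hbp hhp, hξξ'.self_of_nhds, hηη'.self_of_nhds, ← k1, hev, hev] at k2
  exact k2

end
end ManifoldCalculus

/-! ### Vector fields and 1-forms in a chart -/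

section Coframes

variable {E : Type*} [NormedAddCommGroup E] [NormedSpace ℝ E] [FiniteDimensional ℝ E]
  {M : Type*} [TopologicalSpace M] [ChartedSpace E M] [IsManifold 𝓘(ℝ, E) ∞ M]
  {V : Type*} [NormedAddCommGroup V] [NormedSpace ℝ V]

/-- The representation of a vector field in the chart at `p`. -/
noncomputable def vfInChart (p : M) (ξ : Π q : M, TangentSpace 𝓘(ℝ, E) q) (x : E) : E :=
  mfderiv 𝓘(ℝ, E) 𝓘(ℝ, E) (chartAt E p) ((chartAt E p).symm x) (ξ ((chartAt E p).symm x))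

/-- The vector field represented by `ζ` in the chart at `p`. -/
noncomputable def vfOfChart (p : M) (ζ : E → E) (q : M) : TangentSpace 𝓘(ℝ, E) q :=
  (mfderiv 𝓘(ℝ, E) 𝓘(ℝ, E) (chartAt E p) q).inverse (ζ (chartAt E p q))

/-- The representation of a 1-form in the chart at `p`. -/
noncomputable def formInChart (Θ : Π q : M, TangentSpace 𝓘(ℝ, E) q →L[ℝ] V) (p : M) (x : E) :
    E →L[ℝ] V :=
  (Θ ((chartAt E p).symm x)).comp (mfderiv 𝓘(ℝ, E) 𝓘(ℝ, E) (chartAt E p).symm x)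

theorem mfderiv_chartAt_symm_mfderiv_chartAt {p q : M} (hq : q ∈ (chartAt E p).source)
    (v : TangentSpace 𝓘(ℝ, E) q) :
    mfderiv 𝓘(ℝ, E) 𝓘(ℝ, E) (chartAt E p).symm (chartAt E p q)
      (mfderiv 𝓘(ℝ, E) 𝓘(ℝ, E) (chartAt E p) q v) = v :=
  congrArg (fun L : E →L[ℝ] E => L v) ((mdifferentiable_chartAt p).symm_comp_deriv hq)

theorem isInvertible_mfderiv_chartAt {p q : M} (hq : q ∈ (chartAt E p).source) :
    (mfderiv 𝓘(ℝ, E) 𝓘(ℝ, E) (chartAt E p) q).IsInvertible :=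
  ⟨(mdifferentiable_chartAt p).mfderiv hq, rfl⟩

theorem vfInChart_apply {p q : M} (ξ : Π q : M, TangentSpace 𝓘(ℝ, E) q)
    (hq : q ∈ (chartAt E p).source) :
    vfInChart p ξ (chartAt E p q) = mfderiv 𝓘(ℝ, E) 𝓘(ℝ, E) (chartAt E p) q (ξ q) := by
  unfold vfInChart
  rw [(chartAt E p).left_inv hq]

theorem formInChart_apply (Θ : Π q : M, TangentSpace 𝓘(ℝ, E) q →L[ℝ] V) {p q : M}
    (hq : q ∈ (chartAt E p).source) (v : TangentSpace 𝓘(ℝ, E) q) :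
    formInChart Θ p (chartAt E p q) (mfderiv 𝓘(ℝ, E) 𝓘(ℝ, E) (chartAt E p) q v) = Θ q v := by
  have h := mfderiv_chartAt_symm_mfderiv_chartAt hq v
  change Θ ((chartAt E p).symm (chartAt E p q)) (mfderiv 𝓘(ℝ, E) 𝓘(ℝ, E) (chartAt E p).symm
    (chartAt E p q) (mfderiv 𝓘(ℝ, E) 𝓘(ℝ, E) (chartAt E p) q v)) = _
  rw [h, (chartAt E p).left_inv hq]

theorem mfderiv_chartAt_vfOfChart {p q : M} (ζ : E → E) (hq : q ∈ (chartAt E p).source) :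
    mfderiv 𝓘(ℝ, E) 𝓘(ℝ, E) (chartAt E p) q (vfOfChart p ζ q) = ζ (chartAt E p q) :=
  (isInvertible_mfderiv_chartAt hq).self_apply_inverse _

theorem vfInChart_vfOfChart {p : M} (ζ : E → E) {x : E} (hx : x ∈ (chartAt E p).target) :
    vfInChart p (vfOfChart p ζ) x = ζ x := by
  have := vfInChart_apply (vfOfChart p ζ) ((chartAt E p).map_target hx)
  rw [mfderiv_chartAt_vfOfChart ζ ((chartAt E p).map_target hx), (chartAt E p).right_inv hx] at this
  exact this

theorem SmoothVFAt.contDiffAt_vfInChart {p q : M} {ξ : Π q : M, TangentSpace 𝓘(ℝ, E) q}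
    (hξ : SmoothVFAt ξ q) (hq : q ∈ (chartAt E p).source) :
    ContDiffAt ℝ ∞ (vfInChart p ξ) (chartAt E p q) := by
  refine ContMDiffAt.contDiffAt ?_
  have h1 := SmoothVFAt.mvfderiv (f := chartAt E p) (contMDiffAt_chartAt hq) hξ
  have h2 := contMDiffAt_chartAt_symm ((chartAt E p).map_source hq)
  exact ContMDiffAt.comp_of_eq h1 h2 ((chartAt E p).left_inv hq)

theorem smoothVFAt_vfOfChart {p q : M} {ζ : E → E} (hq : q ∈ (chartAt E p).source)
    (hζ : ContDiffAt ℝ ∞ ζ (chartAt E p q)) : SmoothVFAt (vfOfChart p ζ) q := by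
  have h1 : ContMDiffAt 𝓘(ℝ, E) 𝓘(ℝ, E).tangent ∞
      (fun x => (⟨x, ζ x⟩ : TangentBundle 𝓘(ℝ, E) E)) (chartAt E p q) :=
    contMDiffAt_vectorSpace_iff_contDiffAt.2 hζ
  have h2 : ContMDiffAt 𝓘(ℝ, E) 𝓘(ℝ, E).tangent ∞ (fun r => tangentMap 𝓘(ℝ, E) 𝓘(ℝ, E)
      (chartAt E p).symm ⟨chartAt E p r, ζ (chartAt E p r)⟩) q :=
    ContMDiffAt.comp q (ContMDiffAt.contMDiffAt_tangentMap
      (contMDiffAt_chartAt_symm ((chartAt E p).map_source hq)))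
      (ContMDiffAt.comp q h1 (contMDiffAt_chartAt hq))
  refine h2.congr_of_eventuallyEq ?_
  filter_upwards [(chartAt E p).open_source.mem_nhds hq] with r hr
  have e := mfderiv_chartAt_symm_mfderiv_chartAt hr (vfOfChart p ζ r)
  rw [mfderiv_chartAt_vfOfChart ζ hr] at e
  have e' := (chartAt E p).left_inv hr
  change (⟨r, vfOfChart p ζ r⟩ : TangentBundle 𝓘(ℝ, E) M) = ⟨(chartAt E p).symm (chartAt E p r),
    mfderiv 𝓘(ℝ, E) 𝓘(ℝ, E) (chartAt E p).symm (chartAt E p r) (ζ (chartAt E p r))⟩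
  refine Bundle.TotalSpace.ext e'.symm (heq_of_eq ?_)
  exact e.symm

/-- In finite dimension an operator-valued map is smooth as soon as its values on fixed vectors are;
these are the values of `Θ` on the images of constant fields. -/
theorem SmoothForm.contDiffAt_formInChart {Θ : Π q : M, TangentSpace 𝓘(ℝ, E) q →L[ℝ] V}
    (hΘ : SmoothForm Θ) {p : M} {x : E} (hx : x ∈ (chartAt E p).target) :
    ContDiffAt ℝ ∞ (formInChart Θ p) x := by
  have : ContDiffOn ℝ ∞ (formInChart Θ p) (chartAt E p).target := by
    rw [contDiffOn_clm_apply]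
    intro v y hy
    have h1 : ContMDiffAt 𝓘(ℝ, E) 𝓘(ℝ, E).tangent ∞
        (fun x => (⟨x, v⟩ : TangentBundle 𝓘(ℝ, E) E)) y :=
      contMDiffAt_vectorSpace_iff_contDiffAt.2 contDiffAt_const
    have h2 := ContMDiffAt.comp y (ContMDiffAt.contMDiffAt_tangentMap
      (v := (⟨y, v⟩ : TangentBundle 𝓘(ℝ, E) E)) (contMDiffAt_chartAt_symm hy)) h1
    exact (ContMDiffAt.contDiffAt (ContMDiffAt.comp y
      (ContMDiff.contMDiffAt hΘ) h2)).contDiffWithinAt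
  exact this.contDiffAt ((chartAt E p).open_target.mem_nhds hx)

theorem isInvertible_formInChart {Θ : Π q : M, TangentSpace 𝓘(ℝ, E) q →L[ℝ] V} {p : M} {x : E}
    (hx : x ∈ (chartAt E p).target) (hb : Function.Bijective (Θ ((chartAt E p).symm x))) :
    (formInChart Θ p x).IsInvertible :=
  ContinuousLinearMap.isInvertible_of_bijective
    (hb.comp ((mdifferentiable_chartAt p).symm.mfderiv_bijective hx))

theorem mvfderiv_eq_fderiv_chart {f : M → V} {p q : M} (hq : q ∈ (chartAt E p).source)
    (hf : ContMDiffAt 𝓘(ℝ, E) 𝓘(ℝ, V) ∞ f q) (v : TangentSpace 𝓘(ℝ, E) q) :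
    mvfderiv 𝓘(ℝ, E) f q v = fderiv ℝ (fun x => f ((chartAt E p).symm x)) (chartAt E p q)
      (mfderiv 𝓘(ℝ, E) 𝓘(ℝ, E) (chartAt E p) q v) := by
  have hφ : MDifferentiableAt 𝓘(ℝ, E) 𝓘(ℝ, E) (chartAt E p) q :=
    mdifferentiableAt_of_contMDiffAt_infty (contMDiffAt_chartAt hq)
  have hg : ContMDiffAt 𝓘(ℝ, E) 𝓘(ℝ, V) ∞ (fun x => f ((chartAt E p).symm x))
      (chartAt E p q) :=
    ContMDiffAt.comp_of_eq hf (contMDiffAt_chartAt_symm ((chartAt E p).map_source hq))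
      ((chartAt E p).left_inv hq)
  have h := mvfderiv_comp_mfderiv (mdifferentiableAt_of_contMDiffAt_infty hg) hφ v
  have hev : (fun r => f ((chartAt E p).symm (chartAt E p r))) =ᶠ[𝓝 q] f := by
    filter_upwards [(chartAt E p).open_source.mem_nhds hq] with r hr
    rw [(chartAt E p).left_inv hr]
  rw [hev.mvfderiv_eq] at h
  rw [h]
  exact congrArg (fun L : E →L[ℝ] V => L _) mfderiv_eq_fderiv

theorem contDiffAt_comp_chart_symm {f : M → V} {p q : M} (hq : q ∈ (chartAt E p).source)
    (hf : ContMDiffAt 𝓘(ℝ, E) 𝓘(ℝ, V) ∞ f q) :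
    ContDiffAt ℝ ∞ (fun x => f ((chartAt E p).symm x)) (chartAt E p q) :=
  ContMDiffAt.contDiffAt (ContMDiffAt.comp_of_eq hf
    (contMDiffAt_chartAt_symm ((chartAt E p).map_source hq)) ((chartAt E p).left_inv hq))

theorem mlieBracket_modelSpace_apply (ξ η : Π x : E, TangentSpace 𝓘(ℝ, E) x) (x : E) :
    mlieBracket 𝓘(ℝ, E) ξ η x = lieBracket ℝ (fun x => (ξ x : E)) (fun x => (η x : E)) x := by
  rw [← mlieBracketWithin_univ, mlieBracketWithin_eq_lieBracketWithin]
  exact congrFun (lieBracketWithin_univ (𝕜 := ℝ)) x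

/-- The chart relates a field to its representation, so naturality reduces the claim to the bracket
of the model space. -/
theorem mfderiv_chartAt_mlieBracket {p q : M} {ξ η : Π q : M, TangentSpace 𝓘(ℝ, E) q}
    (hq : q ∈ (chartAt E p).source) (hξ : ∀ᶠ r in 𝓝 q, SmoothVFAt ξ r)
    (hη : ∀ᶠ r in 𝓝 q, SmoothVFAt η r) :
    mfderiv 𝓘(ℝ, E) 𝓘(ℝ, E) (chartAt E p) q (mlieBracket 𝓘(ℝ, E) ξ η q) =
      fderiv ℝ (vfInChart p η) (chartAt E p q) (vfInChart p ξ (chartAt E p q)) -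
      fderiv ℝ (vfInChart p ξ) (chartAt E p q) (vfInChart p η (chartAt E p q)) := by
  have := FiniteDimensional.complete ℝ E
  have hs : ∀ᶠ r in 𝓝 q, r ∈ (chartAt E p).source := (chartAt E p).open_source.mem_nhds hq
  have key : ∀ {ξ : Π q : M, TangentSpace 𝓘(ℝ, E) q}, (∀ᶠ r in 𝓝 q, SmoothVFAt ξ r) →
      ∀ᶠ x in 𝓝 (chartAt E p q),
        SmoothVFAt (M := E) (E := E) (vfInChart p ξ) x := by
    intro ξ hξ
    filter_upwards [(chartAt E p).tendsto_symm hq |>.eventually hξ,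
      (chartAt E p).open_target.mem_nhds ((chartAt E p).map_source hq)] with x h1 h2
    have := h1.contDiffAt_vfInChart ((chartAt E p).map_target h2)
    rw [(chartAt E p).right_inv h2] at this
    exact contMDiffAt_vectorSpace_iff_contDiffAt.2 this
  have h := mfderiv_mlieBracket_of_related (h := chartAt E p) (p := q)
    (hs.mono fun r hr => contMDiffAt_chartAt hr) hξ hη (key hξ) (key hη)
    (hs.mono fun r hr => (vfInChart_apply ξ hr).symm) (hs.mono fun r hr => (vfInChart_apply η hr).symm)
  exact h.trans (mlieBracket_modelSpace_apply _ _ _)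

end Coframes

/-! ### Coframes, dual frames and structure functions -/

section Frames

variable {E : Type*} [NormedAddCommGroup E] [NormedSpace ℝ E] [FiniteDimensional ℝ E]
  {M : Type*} [TopologicalSpace M] [ChartedSpace E M] [IsManifold 𝓘(ℝ, E) ∞ M]
  {V : Type*} [NormedAddCommGroup V] [NormedSpace ℝ V]

/-- A coframe: a smooth 1-form that is an isomorphism at each point. -/
structure IsCoframe (H : Π q : M, TangentSpace 𝓘(ℝ, E) q →L[ℝ] V) : Prop where
  smooth : SmoothForm H
  bijective : ∀ q, Function.Bijective (H q)

/-- The vector field with components `u` with respect to the frame dual to the coframe `H`. -/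
noncomputable def frameVF (H : Π q : M, TangentSpace 𝓘(ℝ, E) q →L[ℝ] V) (u : M → V) (q : M) :
    TangentSpace 𝓘(ℝ, E) q :=
  (H q).inverse (u q)

/-- The components of the bracket of two vector fields of the frame dual to the coframe `H`. -/
noncomputable def frameBracket (H : Π q : M, TangentSpace 𝓘(ℝ, E) q →L[ℝ] V) (q : M) (a b : V) :
    V :=
  H q (mlieBracket 𝓘(ℝ, E) (frameVF H fun _ => a) (frameVF H fun _ => b) q)

theorem contMDiffAt_tangentBundle_modelSpace {T : Type*} [NormedAddCommGroup T] [NormedSpace ℝ T]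
    {F : Type*} [NormedAddCommGroup F] [NormedSpace ℝ F] {f g : T → F} {t : T}
    (hf : ContDiffAt ℝ ∞ f t) (hg : ContDiffAt ℝ ∞ g t) :
    ContMDiffAt 𝓘(ℝ, T) 𝓘(ℝ, F).tangent ∞
      (fun t => (⟨f t, g t⟩ : TangentBundle 𝓘(ℝ, F) F)) t := by
  rw [Bundle.contMDiffAt_totalSpace]
  refine ⟨hf.contMDiffAt, ?_⟩
  simp only [trivializationAt_model_space_apply]
  exact hg.contMDiffAt

theorem mvfderiv_form_apply {Θ : Π q : M, TangentSpace 𝓘(ℝ, E) q →L[ℝ] V} (hΘ : SmoothForm Θ)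
    {p q : M} {Y : Π q : M, TangentSpace 𝓘(ℝ, E) q} (hq : q ∈ (chartAt E p).source)
    (hY : SmoothVFAt Y q) (v : TangentSpace 𝓘(ℝ, E) q) :
    mvfderiv 𝓘(ℝ, E) (fun r => Θ r (Y r)) q v =
      fderiv ℝ (formInChart Θ p) (chartAt E p q)
        (mfderiv 𝓘(ℝ, E) 𝓘(ℝ, E) (chartAt E p) q v) (vfInChart p Y (chartAt E p q)) +
      formInChart Θ p (chartAt E p q) (fderiv ℝ (vfInChart p Y) (chartAt E p q)
        (mfderiv 𝓘(ℝ, E) 𝓘(ℝ, E) (chartAt E p) q v)) := by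
  have hα := ((hΘ.contDiffAt_formInChart ((chartAt E p).map_source hq)).differentiableAt
    (by simp)).hasFDerivAt
  have hYc := ((hY.contDiffAt_vfInChart hq).differentiableAt (by simp)).hasFDerivAt
  rw [mvfderiv_eq_fderiv_chart hq (hΘ.apply hY)]
  have hev : (fun x => Θ ((chartAt E p).symm x) (Y ((chartAt E p).symm x)))
      =ᶠ[𝓝 (chartAt E p q)] fun x => formInChart Θ p x (vfInChart p Y x) := by
    filter_upwards [(chartAt E p).open_target.mem_nhds ((chartAt E p).map_source hq)] with x hx
    have := formInChart_apply Θ ((chartAt E p).map_target hx) (Y ((chartAt E p).symm x))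
    rw [(chartAt E p).right_inv hx] at this
    exact this.symm
  rw [hev.fderiv_eq, (hα.clm_apply hYc).fderiv, add_comm]
  rfl

/-- The Lie derivative of a form in a chart. -/
theorem lieDerivForm_eq {Θ : Π q : M, TangentSpace 𝓘(ℝ, E) q →L[ℝ] V} (hΘ : SmoothForm Θ) {p q : M}
    {ξ Y : Π q : M, TangentSpace 𝓘(ℝ, E) q} (hq : q ∈ (chartAt E p).source)
    (hξ : ∀ᶠ r in 𝓝 q, SmoothVFAt ξ r) (hY : ∀ᶠ r in 𝓝 q, SmoothVFAt Y r) :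
    lieDerivForm Θ ξ Y q = fderiv ℝ (formInChart Θ p) (chartAt E p q)
        (vfInChart p ξ (chartAt E p q)) (vfInChart p Y (chartAt E p q)) +
      formInChart Θ p (chartAt E p q)
        (fderiv ℝ (vfInChart p ξ) (chartAt E p q) (vfInChart p Y (chartAt E p q))) := by
  unfold lieDerivForm
  rw [mvfderiv_form_apply hΘ hq hY.self_of_nhds, ← vfInChart_apply ξ hq,
    ← formInChart_apply Θ hq (mlieBracket 𝓘(ℝ, E) ξ Y q), mfderiv_chartAt_mlieBracket hq hξ hY,
    map_sub]
  abel

/-- The Lie derivative is tensorial in the test field: by `lieDerivForm_eq` only the value at the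
point enters, and fields constant in the chart realise every value. Invariance becomes a linear
equation on the 1-jet of `ξ`. -/
theorem preservesFormAt_iff {Θ : Π q : M, TangentSpace 𝓘(ℝ, E) q →L[ℝ] V} (hΘ : SmoothForm Θ)
    {p q : M} {ξ : Π q : M, TangentSpace 𝓘(ℝ, E) q} (hq : q ∈ (chartAt E p).source)
    (hξ : ∀ᶠ r in 𝓝 q, SmoothVFAt ξ r) :
    PreservesFormAt Θ ξ q ↔ ∀ w : E, fderiv ℝ (formInChart Θ p) (chartAt E p q)
        (vfInChart p ξ (chartAt E p q)) w +
      formInChart Θ p (chartAt E p q) (fderiv ℝ (vfInChart p ξ) (chartAt E p q) w) = 0 := by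
  constructor
  · intro h w
    have hY : ∀ᶠ r in 𝓝 q, SmoothVFAt (vfOfChart p fun _ => w) r := by
      filter_upwards [(chartAt E p).open_source.mem_nhds hq] with r hr
      exact smoothVFAt_vfOfChart hr contDiffAt_const
    have e := h _ hY
    rw [lieDerivForm_eq hΘ hq hξ hY, vfInChart_vfOfChart _ ((chartAt E p).map_source hq)] at e
    exact e
  · intro h Y hY
    rw [lieDerivForm_eq hΘ hq hξ hY]
    exact h _

namespace IsCoframe

variable {H : Π q : M, TangentSpace 𝓘(ℝ, E) q →L[ℝ] V}

theorem isInvertible (hH : IsCoframe H) (q : M) : (H q : E →L[ℝ] V).IsInvertible :=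
  ContinuousLinearMap.isInvertible_of_bijective (X := E) (hH.bijective q)

theorem apply_inverse (hH : IsCoframe H) (q : M) (a : V) : H q ((H q).inverse a) = a :=
  (hH.isInvertible q).self_apply_inverse a

theorem inverse_apply (hH : IsCoframe H) (q : M) (v : TangentSpace 𝓘(ℝ, E) q) : (H q).inverse (H q v) = v :=
  (hH.isInvertible q).inverse_apply_self v

theorem apply_frameVF (hH : IsCoframe H) (u : M → V) (q : M) : H q (frameVF H u q) = u q := hH.apply_inverse q _

theorem frameVF_eq (hH : IsCoframe H) {ξ : Π q : M, TangentSpace 𝓘(ℝ, E) q} :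
    frameVF H (fun q => H q (ξ q)) = ξ := funext fun q => hH.inverse_apply q _

theorem isInvertible_formInChart (hH : IsCoframe H) {p : M} {x : E} (hx : x ∈ (chartAt E p).target) :
    (formInChart H p x).IsInvertible :=
  _root_.isInvertible_formInChart hx (hH.bijective _)

/-- In a chart this is smoothness of operator inversion, carried back by the tangent map of the
inverse chart. Joint smoothness in point and components is what the anchor needs later. -/
theorem contMDiff_inverse (hH : IsCoframe H) : ContMDiff (𝓘(ℝ, E).prod 𝓘(ℝ, V)) 𝓘(ℝ, E).tangent ∞
    (fun z : M × V => (⟨z.1, (H z.1).inverse z.2⟩ : TangentBundle 𝓘(ℝ, E) M)) := by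
  rintro ⟨q, a⟩
  have hq := mem_chart_source E q
  have := FiniteDimensional.complete ℝ E
  have hx := (chartAt E q).map_source hq
  have h1 : ContMDiffAt (𝓘(ℝ, E).prod 𝓘(ℝ, V)) 𝓘(ℝ, E × V) ∞
      (fun z : M × V => (chartAt E q z.1, z.2)) (q, a) :=
    ContMDiffAt.prodMk_space (ContMDiffAt.comp (q, a) (contMDiffAt_chartAt hq) contMDiffAt_fst)
      contMDiffAt_snd
  have h2 : ContMDiffAt 𝓘(ℝ, E × V) 𝓘(ℝ, E).tangent ∞
      (fun z : E × V => (⟨z.1, (formInChart H q z.1).inverse z.2⟩ : TangentBundle 𝓘(ℝ, E) E))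
      (chartAt E q q, a) := by
    refine contMDiffAt_tangentBundle_modelSpace contDiffAt_fst (ContDiffAt.clm_apply ?_ contDiffAt_snd)
    refine ContDiffAt.comp _ (g := fun x => (formInChart H q x).inverse) ?_ contDiffAt_fst
    exact (hH.smooth.contDiffAt_formInChart hx).clm_inverse (hH.isInvertible_formInChart hx)
  have h3 : ContMDiffAt (𝓘(ℝ, E).prod 𝓘(ℝ, V)) 𝓘(ℝ, E).tangent ∞ (fun z : M × V =>
      tangentMap 𝓘(ℝ, E) 𝓘(ℝ, E) (chartAt E q).symm
        ⟨chartAt E q z.1, (formInChart H q (chartAt E q z.1)).inverse z.2⟩) (q, a) :=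
    ContMDiffAt.comp (q, a) (ContMDiffAt.contMDiffAt_tangentMap (contMDiffAt_chartAt_symm hx))
      (ContMDiffAt.comp (q, a) h2 h1)
  refine h3.congr_of_eventuallyEq ?_
  filter_upwards [((chartAt E q).open_source.prod isOpen_univ).mem_nhds
    (⟨hq, trivial⟩ : (q, a) ∈ (chartAt E q).source ×ˢ Set.univ)] with z hz
  have e := (chartAt E q).left_inv hz.1
  refine Bundle.TotalSpace.ext e.symm (heq_of_eq ?_)
  change (H z.1).inverse z.2 = mfderiv 𝓘(ℝ, E) 𝓘(ℝ, E) (chartAt E q).symm (chartAt E q z.1)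
    ((formInChart H q (chartAt E q z.1)).inverse z.2)
  set v := (H z.1).inverse z.2 with hv
  have e1 : z.2 = formInChart H q (chartAt E q z.1)
      (mfderiv 𝓘(ℝ, E) 𝓘(ℝ, E) (chartAt E q) z.1 v) := by
    rw [formInChart_apply H hz.1, hv, hH.apply_inverse]
  have e2 : (formInChart H q (chartAt E q z.1)).inverse z.2 =
      mfderiv 𝓘(ℝ, E) 𝓘(ℝ, E) (chartAt E q) z.1 v := by
    conv_lhs => rw [e1]
    exact (hH.isInvertible_formInChart ((chartAt E q).map_source hz.1)).inverse_apply_self _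
  rw [e2]
  exact (mfderiv_chartAt_symm_mfderiv_chartAt hz.1 v).symm

theorem smoothVFAt_frameVF (hH : IsCoframe H) {u : M → V} {q : M} (hu : ContMDiffAt 𝓘(ℝ, E) 𝓘(ℝ, V) ∞ u q) :
    SmoothVFAt (frameVF H u) q :=
  ContMDiffAt.comp q (g := fun z : M × V => (⟨z.1, (H z.1).inverse z.2⟩ : TangentBundle 𝓘(ℝ, E) M))
    (f := fun q => (q, u q)) hH.contMDiff_inverse.contMDiffAt (contMDiffAt_id.prodMk hu)

theorem smoothVFAt_frameVF_const (hH : IsCoframe H) (a : V) (q : M) : SmoothVFAt (frameVF H fun _ => a) q :=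
  hH.smoothVFAt_frameVF contMDiffAt_const

/-- This is Cartan's formula for `dH`, with the exterior derivative computed in a chart by
`coframeStructure`. -/
theorem apply_mlieBracket_aux (hH : IsCoframe H) {p q : M} {ξ η : Π q : M, TangentSpace 𝓘(ℝ, E) q}
    (hq : q ∈ (chartAt E p).source) (hξ : ∀ᶠ r in 𝓝 q, SmoothVFAt ξ r)
    (hη : ∀ᶠ r in 𝓝 q, SmoothVFAt η r) :
    H q (mlieBracket 𝓘(ℝ, E) ξ η q) = mvfderiv 𝓘(ℝ, E) (fun r => H r (η r)) q (ξ q) -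
      mvfderiv 𝓘(ℝ, E) (fun r => H r (ξ r)) q (η q) -
      coframeStructure (formInChart H p) (chartAt E p q) (H q (ξ q)) (H q (η q)) := by
  have e : ∀ ζ : Π q : M, TangentSpace 𝓘(ℝ, E) q, H q (ζ q) =
      formInChart H p (chartAt E p q) (vfInChart p ζ (chartAt E p q)) := fun ζ => by
    rw [vfInChart_apply ζ hq, formInChart_apply H hq]
  rw [e ξ, e η, coframeStructure_apply
    (hH.isInvertible_formInChart ((chartAt E p).map_source hq)),
    mvfderiv_form_apply hH.smooth hq hξ.self_of_nhds, mvfderiv_form_apply hH.smooth hq hη.self_of_nhds,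
    ← formInChart_apply H hq (mlieBracket 𝓘(ℝ, E) ξ η q), mfderiv_chartAt_mlieBracket hq hξ hη,
    map_sub, ← vfInChart_apply ξ hq, ← vfInChart_apply η hq]
  abel

/-- Frame fields have constant components, so only the `dH` term of the bracket formula survives. -/
theorem frameBracket_eq (hH : IsCoframe H) {p q : M} (hq : q ∈ (chartAt E p).source) (a b : V) :
    frameBracket H q a b = -coframeStructure (formInChart H p) (chartAt E p q) a b := by
  have h := hH.apply_mlieBracket_aux hq
    (Eventually.of_forall (hH.smoothVFAt_frameVF_const a))
    (Eventually.of_forall (hH.smoothVFAt_frameVF_const b))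
  simp only [hH.apply_frameVF] at h
  rw [frameBracket, h, mvfderiv_const, mvfderiv_const]
  simp

/-- The components of the bracket of two vector fields with respect to a coframe. -/
theorem apply_mlieBracket (hH : IsCoframe H) {q : M} {ξ η : Π q : M, TangentSpace 𝓘(ℝ, E) q}
    (hξ : ∀ᶠ r in 𝓝 q, SmoothVFAt ξ r) (hη : ∀ᶠ r in 𝓝 q, SmoothVFAt η r) :
    H q (mlieBracket 𝓘(ℝ, E) ξ η q) = mvfderiv 𝓘(ℝ, E) (fun r => H r (η r)) q (ξ q) -
      mvfderiv 𝓘(ℝ, E) (fun r => H r (ξ r)) q (η q) +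
      frameBracket H q (H q (ξ q)) (H q (η q)) := by
  rw [hH.frameBracket_eq (mem_chart_source E q), hH.apply_mlieBracket_aux (mem_chart_source E q) hξ hη]
  abel

theorem contMDiff_frameBracket (hH : IsCoframe H) (a b : V) :
    ContMDiff 𝓘(ℝ, E) 𝓘(ℝ, V) ∞ (fun q => frameBracket H q a b) := fun q =>
  have := FiniteDimensional.complete ℝ E
  hH.smooth.apply ((hH.smoothVFAt_frameVF_const a q).lie (hH.smoothVFAt_frameVF_const b q))

end IsCoframe

end Frames

/-! ### Independence and surjectivity -/

section LinearAlgebra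

variable {E F : Type*} [NormedAddCommGroup E] [NormedSpace ℝ E] [NormedAddCommGroup F]
  [NormedSpace ℝ F]

/-- A linear relation between the `g i` is the same as a functional that kills the range of `L`; a
nonzero one exists exactly if `L` is not onto. -/
theorem linearIndependent_iff_surjective_of_apply {d : ℕ} {g : Fin d → E →L[ℝ] ℝ}
    {L : E →L[ℝ] EuclideanSpace ℝ (Fin d)} (hL : ∀ i v, L v i = g i v) :
    LinearIndependent ℝ g ↔ Function.Surjective L := by
  rw [Fintype.linearIndependent_iff]
  constructor
  · intro h
    by_contra hs
    have hlt : LinearMap.range L.toLinearMap < ⊤ := by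
      rw [lt_top_iff_ne_top]
      exact fun h => hs (LinearMap.range_eq_top.1 h)
    obtain ⟨f, hf0, hf⟩ := Submodule.exists_le_ker_of_lt_top _ hlt
    have hsum : ∀ w : EuclideanSpace ℝ (Fin d),
        f w = ∑ i, f (EuclideanSpace.single i 1) * w i := by
      intro w
      have hw := (EuclideanSpace.basisFun (Fin d) ℝ).sum_repr w
      conv_lhs => rw [← hw]
      rw [map_sum]
      refine Finset.sum_congr rfl fun i _ => ?_
      simp [mul_comm]
    have h0 := h (fun i => f (EuclideanSpace.single i 1)) (by
      ext v
      have := hf (LinearMap.mem_range_self L.toLinearMap v)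
      rw [LinearMap.mem_ker, hsum] at this
      simpa [hL] using this)
    refine hf0 (LinearMap.ext fun w => ?_)
    rw [hsum]
    simp [h0]
  · intro hs c hc
    -- Evaluating the relation with coefficients `c` at a preimage of `c` makes a sum of squares
    -- vanish.
    obtain ⟨v, hv⟩ := hs (WithLp.toLp 2 c)
    have h1 := congrArg (fun φ : E →L[ℝ] ℝ => φ v) hc
    simp only [FunLike.coe_sum, Finset.sum_apply, smul_apply, ← hL, hv,
      zero_apply, smul_eq_mul] at h1
    intro i
    exact mul_self_eq_zero.1
      ((Finset.sum_eq_zero_iff_of_nonneg fun i _ => mul_self_nonneg (c i)).1 h1 i (Finset.mem_univ i))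

/-- Composed with a right inverse of `L t`, the operators `L s` become the identity at `t`, hence
are invertible nearby. -/
theorem ContinuousAt.eventually_surjective {T : Type*} [TopologicalSpace T]
    [FiniteDimensional ℝ F] {L : T → E →L[ℝ] F} {t : T} (hL : ContinuousAt L t)
    (h : Function.Surjective (L t)) : ∀ᶠ s in 𝓝 t, Function.Surjective (L s) := by
  have := FiniteDimensional.complete ℝ F
  obtain ⟨R, hR⟩ := (L t).toLinearMap.exists_rightInverse_of_surjective (LinearMap.range_eq_top.2 h)
  have hc : ContinuousAt (fun s => (L s).comp (LinearMap.toContinuousLinearMap R)) t :=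
    hL.clm_comp continuousAt_const
  have hi : ((L t).comp (LinearMap.toContinuousLinearMap R)).IsInvertible := by
    refine ⟨ContinuousLinearEquiv.refl ℝ F, ?_⟩
    ext w
    exact (congrArg (fun f : F →ₗ[ℝ] F => f w) hR).symm
  filter_upwards [hc.eventually_isInvertible hi] with s hs w
  exact ⟨_, hs.self_apply_inverse w⟩

theorem apply_eq_zero_of_mem_span {S : Set (E →L[ℝ] ℝ)} {v : E} (h : ∀ φ ∈ S, φ v = 0)
    {φ : E →L[ℝ] ℝ} (hφ : φ ∈ Submodule.span ℝ S) : φ v = 0 := by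
  induction hφ using Submodule.span_induction with
  | mem φ hφ => exact h φ hφ
  | zero => rfl
  | add φ ψ _ _ h1 h2 => rw [add_apply, h1, h2, add_zero]
  | smul c φ _ h1 => rw [smul_apply, h1, smul_zero]

end LinearAlgebra

/-! ### Families of functions closed under frame derivatives -/

section ClosedFamilies

variable {E : Type*} [NormedAddCommGroup E] [NormedSpace ℝ E] [FiniteDimensional ℝ E]
  {M : Type*} [TopologicalSpace M] [ChartedSpace E M] [IsManifold 𝓘(ℝ, E) ∞ M]
  {V : Type*} [NormedAddCommGroup V] [NormedSpace ℝ V]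

/-- A local equivalence of a coframe: a diffeomorphism between open sets that preserves it. -/
structure IsCoframeEquiv (H : Π q : M, TangentSpace 𝓘(ℝ, E) q →L[ℝ] V)
    (Φ : OpenPartialHomeomorph M M) : Prop where
  smooth : ContMDiffOn 𝓘(ℝ, E) 𝓘(ℝ, E) ∞ Φ Φ.source
  smooth_symm : ContMDiffOn 𝓘(ℝ, E) 𝓘(ℝ, E) ∞ Φ.symm Φ.target
  pullback : ∀ q ∈ Φ.source, ∀ v : TangentSpace 𝓘(ℝ, E) q,
    H (Φ q) (mfderiv 𝓘(ℝ, E) 𝓘(ℝ, E) Φ q v) = H q v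

/-- A family of functions, smooth on `U`, which contains the structure functions of the coframe
and is closed under derivatives along the dual frame. -/
structure IsClosedFamily (H : Π q : M, TangentSpace 𝓘(ℝ, E) q →L[ℝ] V) (A : Set (M → ℝ))
    (U : Set M) : Prop where
  smooth : ∀ f ∈ A, ∀ q ∈ U, ContMDiffAt 𝓘(ℝ, E) 𝓘(ℝ, ℝ) ∞ f q
  frame_mem : ∀ f ∈ A, ∀ a : V, (fun q => mvfderiv 𝓘(ℝ, E) f q ((H q).inverse a)) ∈ A
  bracket_mem : ∀ (ℓ : V →L[ℝ] ℝ) (a b : V), (fun q => ℓ (frameBracket H q a b)) ∈ A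

variable (E) in
/-- The span of the differentials at `q` of the functions in `A`. -/
noncomputable def differentials (A : Set (M → ℝ)) (q : M) : Submodule ℝ (E →L[ℝ] ℝ) :=
  Submodule.span ℝ ((fun f : M → ℝ => (mvfderiv 𝓘(ℝ, E) f q : E →L[ℝ] ℝ)) '' A)

/-- An open set with finitely many functions of the family `A`, combined into a map `J` that has a
smooth section `τ`, such that the coframe has all the equivalences and infinitesimal symmetries
compatible with `J`. -/
structure IsClassifyingBox (H : Π q : M, TangentSpace 𝓘(ℝ, E) q →L[ℝ] V) (A : Set (M → ℝ)) {d : ℕ}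
    (J : M → EuclideanSpace ℝ (Fin d)) (O : Set M) (B : Set (EuclideanSpace ℝ (Fin d)))
    (τ : EuclideanSpace ℝ (Fin d) → M) : Prop where
  isOpen : IsOpen O
  isOpen_base : IsOpen B
  mapsTo : Set.MapsTo J O B
  mapsTo_section : Set.MapsTo τ B O
  section_right_inv : ∀ b ∈ B, J (τ b) = b
  smooth_section : ∀ b ∈ B, ContMDiffAt 𝓘(ℝ, EuclideanSpace ℝ (Fin d)) 𝓘(ℝ, E) ∞ τ b
  mem_family : ∀ i, (fun q => J q i) ∈ A
  smooth : ∀ q ∈ O, ContMDiffAt 𝓘(ℝ, E) 𝓘(ℝ, EuclideanSpace ℝ (Fin d)) ∞ J q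
  exists_equiv : ∀ q ∈ O, ∀ q' ∈ O, J q = J q' → ∃ Φ : OpenPartialHomeomorph M M,
    IsCoframeEquiv H Φ ∧ q ∈ Φ.source ∧ Φ q = q'
  exists_symmetry : ∀ q ∈ O, ∀ v : TangentSpace 𝓘(ℝ, E) q,
    (mvfderiv 𝓘(ℝ, E) J q v : EuclideanSpace ℝ (Fin d)) = 0 →
    ∃ ξ : Π q : M, TangentSpace 𝓘(ℝ, E) q, ξ q = v ∧
      ∀ᶠ r in 𝓝 q, SmoothVFAt ξ r ∧ PreservesFormAt H ξ r

theorem mvfderiv_euclidean_apply {d : ℕ} {J : M → EuclideanSpace ℝ (Fin d)} {q : M}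
    (hJ : ContMDiffAt 𝓘(ℝ, E) 𝓘(ℝ, EuclideanSpace ℝ (Fin d)) ∞ J q) (v : TangentSpace 𝓘(ℝ, E) q)
    (i : Fin d) : mvfderiv 𝓘(ℝ, E) (fun q => J q i) q v = (mvfderiv 𝓘(ℝ, E) J q v) i :=
  mvfderiv_clm_comp (EuclideanSpace.proj i : EuclideanSpace ℝ (Fin d) →L[ℝ] ℝ)
    (mdifferentiableAt_of_contMDiffAt_infty hJ) v

/-- Near a point where the rank of a family of functions is maximal, the functions depend on
finitely many of them. -/
theorem exists_independent_functions {A : Set (M → ℝ)} {p : M}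
    (hA : ∀ f ∈ A, ∀ᶠ q in 𝓝 p, ContMDiffAt 𝓘(ℝ, E) 𝓘(ℝ, ℝ) ∞ f q) {d : ℕ}
    (hd : Module.finrank ℝ (differentials E A p) = d)
    (hmax : ∀ᶠ q in 𝓝 p, Module.finrank ℝ (differentials E A q) ≤ d) :
    ∃ J : M → EuclideanSpace ℝ (Fin d), (∀ i, (fun q => J q i) ∈ A) ∧
      Function.Surjective (mvfderiv 𝓘(ℝ, E) J p) ∧
      ∀ᶠ q in 𝓝 p, ContMDiffAt 𝓘(ℝ, E) 𝓘(ℝ, EuclideanSpace ℝ (Fin d)) ∞ J q ∧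
        ∀ f ∈ A, ∀ v : TangentSpace 𝓘(ℝ, E) q,
          (mvfderiv 𝓘(ℝ, E) J q v : EuclideanSpace ℝ (Fin d)) = 0 → mvfderiv 𝓘(ℝ, E) f q v = 0 := by
  have hex : ∃ g : Fin d → E →L[ℝ] ℝ,
      (∀ i, g i ∈ (fun f : M → ℝ => (mvfderiv 𝓘(ℝ, E) f p : E →L[ℝ] ℝ)) '' A) ∧
      LinearIndependent ℝ g := by
    subst hd
    obtain ⟨g, hgA, -, hgi⟩ := Submodule.exists_fun_fin_finrank_span_eq ℝ (M := E →L[ℝ] ℝ)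
      ((fun f : M → ℝ => (mvfderiv 𝓘(ℝ, E) f p : E →L[ℝ] ℝ)) '' A)
    exact ⟨g, hgA, hgi⟩
  obtain ⟨g, hgA, hgi⟩ := hex
  choose j hjA hj using hgA
  set J : M → EuclideanSpace ℝ (Fin d) :=
    fun q => WithLp.toLp 2 fun i => j i q with hJ
  have hJs : ∀ᶠ q in 𝓝 p, ContMDiffAt 𝓘(ℝ, E) 𝓘(ℝ, EuclideanSpace ℝ (Fin d)) ∞ J q := by
    filter_upwards [eventually_all.2 fun i => hA (j i) (hjA i)] with q hq
    exact ContMDiffAt.comp q (g := (PiLp.continuousLinearEquiv 2 ℝ _).symm)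
      (ContinuousLinearEquiv.contDiff _).contMDiff.contMDiffAt (contMDiffAt_pi_space.2 hq)
  set D : M → Fin d → E →L[ℝ] ℝ := fun q i => mvfderiv 𝓘(ℝ, E) (j i) q with hD
  have hap : ∀ {q : M}, ContMDiffAt 𝓘(ℝ, E) 𝓘(ℝ, EuclideanSpace ℝ (Fin d)) ∞ J q →
      (LinearIndependent ℝ (D q) ↔ Function.Surjective (mvfderiv 𝓘(ℝ, E) J q)) := fun {q} hq =>
    linearIndependent_iff_surjective_of_apply (E := E) (L := mvfderiv 𝓘(ℝ, E) J q)
      fun i v => (mvfderiv_euclidean_apply hq v i).symm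
  have hsp : Function.Surjective (mvfderiv 𝓘(ℝ, E) J p) := by
    rw [← hap hJs.self_of_nhds]
    rw [show D p = g from funext hj]
    exact hgi
  refine ⟨J, hjA, hsp, ?_⟩
  have hp := mem_chart_source E p
  have hsurj : ∀ {q : M}, q ∈ (chartAt E p).source →
      ContMDiffAt 𝓘(ℝ, E) 𝓘(ℝ, EuclideanSpace ℝ (Fin d)) ∞ J q →
      (Function.Surjective (mvfderiv 𝓘(ℝ, E) J q) ↔ Function.Surjective
        (fderiv ℝ (fun x => J ((chartAt E p).symm x)) (chartAt E p q))) := by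
    intro q hq hJq
    have e : ⇑(mvfderiv 𝓘(ℝ, E) J q) = fderiv ℝ (fun x => J ((chartAt E p).symm x)) (chartAt E p q)
        ∘ mfderiv 𝓘(ℝ, E) 𝓘(ℝ, E) (chartAt E p) q :=
      funext fun v => mvfderiv_eq_fderiv_chart hq hJq v
    rw [e]
    exact ((mdifferentiable_chartAt p).mfderiv_surjective hq).of_comp_iff _
  have hJc := contDiffAt_comp_chart_symm hp hJs.self_of_nhds
  have hev := (chartAt E p).continuousAt hp |>.eventually
    (hJc.fderiv_infty.continuousAt.eventually_surjective ((hsurj hp hJs.self_of_nhds).1 hsp))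
  filter_upwards [hJs, hmax, hev, (chartAt E p).open_source.mem_nhds hp] with q h1 h2 h3 h4
  refine ⟨h1, fun f hf v hv => ?_⟩
  -- The chosen differentials remain independent near `p`. Being `d` in number, they span the
  -- differentials of the whole family, whose rank is at most `d`.
  have hli := (hap h1).2 ((hsurj h4 h1).2 h3)
  have hle : Submodule.span ℝ (Set.range (D q)) ≤
      differentials E A q := by
    refine Submodule.span_mono ?_
    rintro _ ⟨i, rfl⟩
    exact ⟨j i, hjA i, rfl⟩
  have heq := Submodule.eq_of_le_of_finrank_le hle (by
    rw [finrank_span_eq_card hli, Fintype.card_fin]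
    exact h2)
  have hmem : (mvfderiv 𝓘(ℝ, E) f q : E →L[ℝ] ℝ) ∈ differentials E A q :=
    Submodule.subset_span ⟨f, hf, rfl⟩
  rw [← heq] at hmem
  refine apply_eq_zero_of_mem_span (E := E) ?_ hmem
  rintro _ ⟨i, rfl⟩
  refine (mvfderiv_euclidean_apply h1 v i).trans ?_
  rw [hv]
  rfl

end ClosedFamilies

/-! ### Local classification by a closed family -/

section ClassifyingBoxes

variable {E : Type*} [NormedAddCommGroup E] [NormedSpace ℝ E] [FiniteDimensional ℝ E]
  {M : Type*} [TopologicalSpace M] [ChartedSpace E M] [IsManifold 𝓘(ℝ, E) ∞ M]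
  {V : Type*} [NormedAddCommGroup V] [NormedSpace ℝ V]
  {H : Π q : M, TangentSpace 𝓘(ℝ, E) q →L[ℝ] V} {A : Set (M → ℝ)} {d : ℕ}

/-- An equivalence of coframes in a chart gives a local equivalence. -/
theorem IsCoframe.exists_isCoframeEquiv_of_chart (hH : IsCoframe H) {p q q' : M}
    (hq : q ∈ (chartAt E p).source) (hq' : q' ∈ (chartAt E p).source) {f : E → E}
    (hf : f (chartAt E p q) = chartAt E p q')
    (hfs : ∀ᶠ x in 𝓝 (chartAt E p q), ContDiffAt ℝ ∞ f x ∧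
      ∀ v, formInChart H p (f x) (fderiv ℝ f x v) = formInChart H p x v) :
    ∃ Φ : OpenPartialHomeomorph M M, IsCoframeEquiv H Φ ∧ q ∈ Φ.source ∧ Φ q = q' := by
  have := FiniteDimensional.complete ℝ E
  set φ := chartAt E p with hφ
  -- The derivative of `f` followed by one coframe is the other coframe, so it is an isomorphism and
  -- `f` is a local diffeomorphism.
  have hinv : (fderiv ℝ f (φ q)).IsInvertible := by
    refine ContinuousLinearMap.isInvertible_of_bijective ?_
    have h1 := (hH.isInvertible_formInChart (φ.map_source hq')).bijective
    have h2 := (hH.isInvertible_formInChart (φ.map_source hq)).bijective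
    rw [← hf] at h1
    rw [← Function.Bijective.of_comp_iff' h1]
    convert h2 using 1
    exact funext hfs.self_of_nhds.2
  obtain ⟨Ψ, hΨ, hqΨ, hΨU, hΨs, hΨs'⟩ := exists_openPartialHomeomorph_of_isInvertible_fderiv
    (hfs.mono fun x h => h.1) hinv hfs
  have hΨc : ∀ x ∈ Ψ.source, ContDiffAt ℝ ∞ Ψ x := fun x hx =>
    hΨs.contDiffAt (Ψ.open_source.mem_nhds hx)
  have hΨc' : ∀ x ∈ Ψ.target, ContDiffAt ℝ ∞ Ψ.symm x := fun x hx =>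
    hΨs'.contDiffAt (Ψ.open_target.mem_nhds hx)
  refine ⟨φ.trans (Ψ.trans φ.symm), ⟨fun r hr => ?_, fun r hr => ?_, fun r hr v => ?_⟩, ?_, ?_⟩
  · simp only [OpenPartialHomeomorph.trans_source, Set.mem_inter_iff, Set.mem_preimage,
      OpenPartialHomeomorph.symm_source] at hr
    exact (ContMDiffAt.comp r (contMDiffAt_chartAt_symm hr.2.2) (ContMDiffAt.comp r
      (hΨc _ hr.2.1).contMDiffAt (contMDiffAt_chartAt hr.1))).contMDiffWithinAt
  · simp only [OpenPartialHomeomorph.trans_target, Set.mem_inter_iff, Set.mem_preimage,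
      OpenPartialHomeomorph.symm_target, OpenPartialHomeomorph.coe_trans_symm,
      OpenPartialHomeomorph.symm_symm, Function.comp_apply] at hr
    exact (ContMDiffAt.comp r (contMDiffAt_chartAt_symm hr.2) (ContMDiffAt.comp r
      (hΨc' _ hr.1.2).contMDiffAt (contMDiffAt_chartAt hr.1.1))).contMDiffWithinAt
  · simp only [OpenPartialHomeomorph.trans_source, Set.mem_inter_iff, Set.mem_preimage,
      OpenPartialHomeomorph.symm_source] at hr
    have m1 := mdifferentiableAt_of_contMDiffAt_infty (contMDiffAt_chartAt hr.1)
    have m2 := mdifferentiableAt_of_contMDiffAt_infty (hΨc _ hr.2.1).contMDiffAt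
    have m3 := mdifferentiableAt_of_contMDiffAt_infty (contMDiffAt_chartAt_symm hr.2.2)
    have e : (mfderiv 𝓘(ℝ, E) 𝓘(ℝ, E) (φ.trans (Ψ.trans φ.symm)) r v : E) =
        mfderiv 𝓘(ℝ, E) 𝓘(ℝ, E) φ.symm (Ψ (φ r)) (fderiv ℝ Ψ (φ r)
          (mfderiv 𝓘(ℝ, E) 𝓘(ℝ, E) φ r v)) := by
      have e1 := mfderiv_comp r m3 (m2.comp r m1)
      have e2 := mfderiv_comp r m2 m1
      rw [mfderiv_eq_fderiv] at e2
      rw [e2] at e1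
      exact congrArg (fun L : E →L[ℝ] E => L v) e1
    have h4 := (hΨU hr.2.1).2 (mfderiv 𝓘(ℝ, E) 𝓘(ℝ, E) φ r v)
    rw [formInChart_apply H hr.1 v, ← hΨ] at h4
    rw [← h4]
    exact congrArg (H (φ.symm (Ψ (φ r)))) e
  · simp only [OpenPartialHomeomorph.trans_source, Set.mem_inter_iff, Set.mem_preimage,
      OpenPartialHomeomorph.symm_source]
    rw [hΨ, hf]
    exact ⟨hq, hqΨ, φ.map_source hq'⟩
  · change φ.symm (Ψ (φ q)) = q'
    rw [hΨ, hf, φ.left_inv hq']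

/-- The local classification. Where the rank is locally maximal, the differentials of the family
vanish on the kernel of `dJ` for a submersion `J` made of finitely many members. Closure of the
family applies this to the frame derivatives of `J` and to the structure functions, which is what
`IsRegularCoframeBox` demands. The equivalences and symmetries it provides are carried back from the
chart. -/
theorem IsCoframe.exists_isClassifyingBox (hH : IsCoframe H) {U : Set M}
    (hA : IsClosedFamily H A U) {p : M} (hU : U ∈ 𝓝 p)
    (hd : Module.finrank ℝ (differentials E A p) = d)
    (hmax : ∀ᶠ q in 𝓝 p, Module.finrank ℝ (differentials E A q) ≤ d) {W : Set M}
    (hW : W ∈ 𝓝 p) :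
    ∃ (J : M → EuclideanSpace ℝ (Fin d)) (O : Set M) (B : Set (EuclideanSpace ℝ (Fin d)))
      (τ : EuclideanSpace ℝ (Fin d) → M), IsClassifyingBox H A J O B τ ∧ p ∈ O ∧ O ⊆ W ∧
        τ (J p) = p := by
  have := FiniteDimensional.complete ℝ E
  obtain ⟨J, hJA, hJs, hJ⟩ := exists_independent_functions (E := E)
    (fun f hf => by filter_upwards [hU] with q hq using hA.smooth f hf q hq) hd hmax
  set φ := chartAt E p with hφ
  have hp : p ∈ φ.source := mem_chart_source E p
  set Jc : E → EuclideanSpace ℝ (Fin d) := fun x => J (φ.symm x) with hJc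
  have hU' : ∀ᶠ x in 𝓝 (φ p), x ∈ φ.target ∧ φ.symm x ∈ U ∧ φ.symm x ∈ W ∧
      ContMDiffAt 𝓘(ℝ, E) 𝓘(ℝ, EuclideanSpace ℝ (Fin d)) ∞ J (φ.symm x) ∧
        ∀ f ∈ A, ∀ v : TangentSpace 𝓘(ℝ, E) (φ.symm x),
          (mvfderiv 𝓘(ℝ, E) J (φ.symm x) v : EuclideanSpace ℝ (Fin d)) = 0 →
            mvfderiv 𝓘(ℝ, E) f (φ.symm x) v = 0 := by
    filter_upwards [φ.open_target.mem_nhds (φ.map_source hp),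
      (φ.tendsto_symm hp).eventually (hJ.and ((eventually_mem_set.2 hU).and
        (eventually_mem_set.2 hW)))] with x h1 h2 using ⟨h1, h2.2.1, h2.2.2, h2.1⟩
  have hfc : ∀ {x : E}, x ∈ φ.target → ∀ {Y : Type} [NormedAddCommGroup Y] [NormedSpace ℝ Y]
      {f : M → Y}, ContMDiffAt 𝓘(ℝ, E) 𝓘(ℝ, Y) ∞ f (φ.symm x) →
      ContDiffAt ℝ ∞ (fun x => f (φ.symm x)) x ∧ ∀ v, mvfderiv 𝓘(ℝ, E) f (φ.symm x) v =
        fderiv ℝ (fun x => f (φ.symm x)) x (mfderiv 𝓘(ℝ, E) 𝓘(ℝ, E) φ (φ.symm x) v) := by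
    intro x hx Y _ _ f hf
    have h1 := contDiffAt_comp_chart_symm (φ.map_target hx) hf
    have h2 := mvfderiv_eq_fderiv_chart (φ.map_target hx) hf
    rw [φ.right_inv hx] at h1 h2
    exact ⟨h1, h2⟩
  have hsJ : Function.Surjective (fderiv ℝ Jc (φ p)) := by
    intro w
    obtain ⟨v, hv⟩ := hJs w
    rw [mvfderiv_eq_fderiv_chart hp hJ.self_of_nhds.1] at hv
    exact ⟨_, hv⟩
  obtain ⟨O, B, σ, hbox, hpO, hOU, hσ⟩ := exists_isFiberedBox (J := Jc)
    (hU'.mono fun x hx => (hfc hx.1 hx.2.2.2.1).1) hsJ hU'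
  have hker : ∀ x ∈ O, ∀ f ∈ A, ∀ v, fderiv ℝ Jc x v = 0 →
      fderiv ℝ (fun x => f (φ.symm x)) x v = 0 := by
    intro x hx f hf v hv
    obtain ⟨h1, h2, -, h4, h5⟩ := hOU hx
    obtain ⟨v, rfl⟩ := (mdifferentiable_chartAt p).mfderiv_surjective (φ.map_target h1) v
    rw [← (hfc h1 (hA.smooth f hf _ h2)).2 v]
    exact h5 f hf v (((hfc h1 h4).2 v).trans hv)
  have hreg : IsRegularCoframeBox (formInChart H p) Jc O B σ := by
    refine ⟨hbox, fun x hx => hH.smooth.contDiffAt_formInChart (hOU hx).1,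
      fun x hx => hH.isInvertible_formInChart (hOU hx).1,
      fun x hx => (hfc (hOU hx).1 (hOU hx).2.2.2.1).1, fun x hx v hv => ?_, fun x hx a b v hv => ?_⟩
    · have hx1 := (hOU hx).1
      have hD := (contDiffAt_frameDeriv (hH.smooth.contDiffAt_formInChart hx1)
        (hH.isInvertible_formInChart hx1) (hfc hx1 (hOU hx).2.2.2.1).1).differentiableAt
        (by simp)
      ext a i
      have e1 : fderiv ℝ (fun y => (EuclideanSpace.proj i : EuclideanSpace ℝ (Fin d) →L[ℝ] ℝ)
          (frameDeriv (formInChart H p) Jc y a)) x v =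
          (fderiv ℝ (frameDeriv (formInChart H p) Jc) x v a) i := by
        have h1 := (hD.hasFDerivAt.clm_apply (hasFDerivAt_const a x))
        have h2 := ((EuclideanSpace.proj i : EuclideanSpace ℝ (Fin d) →L[ℝ] ℝ).hasFDerivAt.comp x
          h1).fderiv
        have h3 := congrArg (fun L : E →L[ℝ] ℝ => L v) h2
        simp at h3
        exact h3
      rw [← e1]
      have e2 : (fun y => (EuclideanSpace.proj i : EuclideanSpace ℝ (Fin d) →L[ℝ] ℝ)
          (frameDeriv (formInChart H p) Jc y a)) =ᶠ[𝓝 x] fun y =>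
          (fun q => mvfderiv 𝓘(ℝ, E) (fun q => J q i) q ((H q).inverse a)) (φ.symm y) := by
        filter_upwards [hbox.isOpen.mem_nhds hx] with y hy
        have hy1 := (hOU hy).1
        have hy2 := φ.map_target hy1
        have e3 := mvfderiv_euclidean_apply (hOU hy).2.2.2.1 ((H (φ.symm y)).inverse a) i
        rw [(hfc hy1 (hOU hy).2.2.2.1).2] at e3
        have e4 : (formInChart H p y).inverse a =
            mfderiv 𝓘(ℝ, E) 𝓘(ℝ, E) φ (φ.symm y) ((H (φ.symm y)).inverse a) := by
          have := formInChart_apply H hy2 ((H (φ.symm y)).inverse a)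
          rw [hH.apply_inverse, φ.right_inv hy1] at this
          have e5 := (hH.isInvertible_formInChart hy1).inverse_apply_self
            (mfderiv 𝓘(ℝ, E) 𝓘(ℝ, E) φ (φ.symm y) ((H (φ.symm y)).inverse a))
          exact (congrArg (formInChart H p y).inverse this).symm.trans e5
        refine Eq.trans ?_ e3.symm
        change (fderiv ℝ Jc y ((formInChart H p y).inverse a)) i = _
        rw [e4]
      -- The frame derivatives of the components of `J` again belong to the family.
      rw [e2.fderiv_eq]
      exact hker x hx _ (hA.frame_mem _ (hJA i) a) v hv
    · have hx1 := (hOU hx).1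
      have hD := (contDiffAt_coframeStructure (hH.smooth.contDiffAt_formInChart hx1)
        (hH.isInvertible_formInChart hx1) a b).differentiableAt (by simp)
      refine (SeparatingDual.eq_iff_forall_dual_eq (R := ℝ)).2 fun ℓ => ?_
      have e1 : fderiv ℝ (fun y => ℓ (coframeStructure (formInChart H p) y a b)) x v =
          ℓ (fderiv ℝ (fun y => coframeStructure (formInChart H p) y a b) x v) :=
        congrArg (fun L : E →L[ℝ] ℝ => L v) (ℓ.hasFDerivAt.comp x hD.hasFDerivAt).fderiv
      -- `coframeStructure` is minus `frameBracket`, so membership in the family is used for the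
      -- functional `-ℓ`.
      have e2 : (fun y => ℓ (coframeStructure (formInChart H p) y a b)) =ᶠ[𝓝 x] fun y =>
          (fun q => (-ℓ) (frameBracket H q a b)) (φ.symm y) := by
        filter_upwards [hbox.isOpen.mem_nhds hx] with y hy
        have hy1 := (hOU hy).1
        rw [hH.frameBracket_eq (φ.map_target hy1), ← hφ, φ.right_inv hy1]
        simp
      rw [map_zero, ← e1, e2.fderiv_eq]
      exact hker x hx _ (hA.bracket_mem (-ℓ) a b) v hv
  have hJφ : ∀ {q : M}, q ∈ φ.source → J q = Jc (φ q) := fun {q} hq => by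
    rw [hJc]; simp only [φ.left_inv hq]
  refine ⟨J, φ.source ∩ φ ⁻¹' O, B, fun b => φ.symm (σ b), ?_, ⟨hp, hpO⟩, ?_, ?_⟩
  · refine ⟨φ.isOpen_inter_preimage hbox.isOpen, hbox.isOpen_base, ?_, ?_, ?_, ?_, hJA, ?_, ?_, ?_⟩
    · intro q hq
      rw [hJφ hq.1]
      exact hbox.mapsTo hq.2
    · intro b hb
      have h1 := hbox.mapsTo_section hb
      refine ⟨φ.map_target (hOU h1).1, ?_⟩
      rw [Set.mem_preimage, φ.right_inv (hOU h1).1]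
      exact h1
    · intro b hb
      exact hbox.section_right_inv b hb
    · intro b hb
      exact ContMDiffAt.comp b (contMDiffAt_chartAt_symm (hOU (hbox.mapsTo_section hb)).1)
        (hbox.smooth_section.contDiffAt (hbox.isOpen_base.mem_nhds hb)).contMDiffAt
    · intro q hq
      have := (hOU hq.2).2.2.2.1
      rwa [φ.left_inv hq.1] at this
    · intro q hq q' hq' hqq'
      rw [hJφ hq.1, hJφ hq'.1] at hqq'
      obtain ⟨f, hf1, hf2⟩ := hreg.exists_equivalence hq.2 hq'.2 hqq'
      exact hH.exists_isCoframeEquiv_of_chart hq.1 hq'.1 hf1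
        (hf2.mono fun x hx => ⟨hx.1, hx.2.2⟩)
    · intro q hq v hv
      have hJq := (hOU hq.2).2.2.2.1
      rw [φ.left_inv hq.1] at hJq
      rw [mvfderiv_eq_fderiv_chart hq.1 hJq] at hv
      obtain ⟨ξ, hξ1, hξ2⟩ := hreg.exists_symmetry hq.2 hv
      refine ⟨vfOfChart p ξ, ?_, ?_⟩
      · change (mfderiv 𝓘(ℝ, E) 𝓘(ℝ, E) φ q).inverse (ξ (φ q)) = v
        rw [hξ1]
        exact (isInvertible_mfderiv_chartAt hq.1).inverse_apply_self v
      · have h1 : ∀ᶠ r in 𝓝 q, r ∈ φ.source ∧ SmoothVFAt (vfOfChart p ξ) r ∧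
            ∀ w, fderiv ℝ (formInChart H p) (φ r) (ξ (φ r)) w +
              formInChart H p (φ r) (fderiv ℝ ξ (φ r) w) = 0 := by
          filter_upwards [φ.open_source.mem_nhds hq.1, (φ.continuousAt hq.1).eventually hξ2]
            with r h1 h2 using ⟨h1, smoothVFAt_vfOfChart h1 h2.1, h2.2⟩
        filter_upwards [h1.eventually_nhds] with r hr
        obtain ⟨hr1, hr2, hr3⟩ := hr.self_of_nhds
        refine ⟨hr2, (preservesFormAt_iff hH.smooth hr1 (hr.mono fun _ h => h.2.1)).2 fun w => ?_⟩
        have hev : vfInChart p (vfOfChart p ξ) =ᶠ[𝓝 (φ r)] ξ := by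
          filter_upwards [φ.open_target.mem_nhds (φ.map_source hr1)] with x hx
            using vfInChart_vfOfChart ξ hx
        rw [hev.fderiv_eq, hev.self_of_nhds]
        exact hr3 w
  · intro q hq
    have := (hOU hq.2).2.2.1
    rwa [φ.left_inv hq.1] at this
  · simp only [hJφ hp, hσ, φ.left_inv hp]

end ClassifyingBoxes

/-! ### Invariants and infinitesimal symmetries of a coframe -/

section Invariants

variable {E : Type*} [NormedAddCommGroup E] [NormedSpace ℝ E] [FiniteDimensional ℝ E]
  {M : Type*} [TopologicalSpace M] [ChartedSpace E M] [IsManifold 𝓘(ℝ, E) ∞ M]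
  {V : Type*} [NormedAddCommGroup V] [NormedSpace ℝ V]
  {H : Π q : M, TangentSpace 𝓘(ℝ, E) q →L[ℝ] V}

/-- The functions that are invariant under the local equivalences of a coframe. -/
def coframeInvariants (H : Π q : M, TangentSpace 𝓘(ℝ, E) q →L[ℝ] V) : Set (M → ℝ) :=
  {f | ContMDiff 𝓘(ℝ, E) 𝓘(ℝ, ℝ) ∞ f ∧
    ∀ Φ : OpenPartialHomeomorph M M, IsCoframeEquiv H Φ → ∀ q ∈ Φ.source, f (Φ q) = f q}

theorem IsCoframeEquiv.contMDiffAt {Φ : OpenPartialHomeomorph M M} (h : IsCoframeEquiv H Φ) {q : M}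
    (hq : q ∈ Φ.source) : ContMDiffAt 𝓘(ℝ, E) 𝓘(ℝ, E) ∞ Φ q :=
  h.smooth.contMDiffAt (Φ.open_source.mem_nhds hq)

theorem IsCoframeEquiv.mfderiv_inverse (hH : IsCoframe H) {Φ : OpenPartialHomeomorph M M}
    (h : IsCoframeEquiv H Φ) {q : M} (hq : q ∈ Φ.source) (a : V) :
    mfderiv 𝓘(ℝ, E) 𝓘(ℝ, E) Φ q ((H q).inverse a) = (H (Φ q)).inverse a := by
  rw [← hH.inverse_apply (Φ q) (mfderiv 𝓘(ℝ, E) 𝓘(ℝ, E) Φ q ((H q).inverse a)), h.pullback q hq,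
    hH.apply_inverse]

/-- Frame fields are `Φ`-related to themselves, hence so are their brackets. -/
theorem IsCoframeEquiv.frameBracket_eq (hH : IsCoframe H) {Φ : OpenPartialHomeomorph M M}
    (h : IsCoframeEquiv H Φ) {q : M} (hq : q ∈ Φ.source) (a b : V) :
    frameBracket H (Φ q) a b = frameBracket H q a b := by
  have := FiniteDimensional.complete ℝ E
  have hs := Φ.open_source.mem_nhds hq
  have hsm : ∀ a, ∀ r : M, SmoothVFAt (frameVF H fun _ => a) r := hH.smoothVFAt_frameVF_const
  have e := mfderiv_mlieBracket_of_related (h := Φ) (p := q)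
    (by filter_upwards [hs] with r hr using h.contMDiffAt hr)
    (Eventually.of_forall (hsm a)) (Eventually.of_forall (hsm b))
    (Eventually.of_forall (hsm a)) (Eventually.of_forall (hsm b))
    (by filter_upwards [hs] with r hr using h.mfderiv_inverse hH hr a)
    (by filter_upwards [hs] with r hr using h.mfderiv_inverse hH hr b)
  rw [frameBracket, ← e, h.pullback q hq]
  rfl

theorem mvfderiv_comp_coframeEquiv {Φ : OpenPartialHomeomorph M M} (h : IsCoframeEquiv H Φ)
    {W : Type*} [NormedAddCommGroup W] [NormedSpace ℝ W] {f : M → W} {q : M} (hq : q ∈ Φ.source)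
    (hf : ContMDiffAt 𝓘(ℝ, E) 𝓘(ℝ, W) ∞ f (Φ q)) (hfΦ : ∀ r ∈ Φ.source, f (Φ r) = f r)
    (v : TangentSpace 𝓘(ℝ, E) q) :
    mvfderiv 𝓘(ℝ, E) f (Φ q) (mfderiv 𝓘(ℝ, E) 𝓘(ℝ, E) Φ q v) = mvfderiv 𝓘(ℝ, E) f q v := by
  rw [← mvfderiv_comp_mfderiv (mdifferentiableAt_of_contMDiffAt_infty hf)
    (mdifferentiableAt_of_contMDiffAt_infty (h.contMDiffAt hq))]
  have hev : (fun r => f (Φ r)) =ᶠ[𝓝 q] f := by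
    filter_upwards [Φ.open_source.mem_nhds hq] with r hr using hfΦ r hr
  rw [hev.mvfderiv_eq]

/-- An equivalence maps the frame to itself, so it preserves the frame derivatives of invariants as
well as the structure functions. -/
theorem IsCoframe.isClosedFamily_invariants (hH : IsCoframe H) :
    IsClosedFamily H (coframeInvariants H) Set.univ where
  smooth f hf q _ := hf.1 q
  frame_mem f hf a := by
    refine ⟨fun q => SmoothVFAt.mvfderiv (hf.1 q) (hH.smoothVFAt_frameVF_const a q),
      fun Φ hΦ q hq => ?_⟩
    beta_reduce
    rw [← hΦ.mfderiv_inverse hH hq]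
    exact mvfderiv_comp_coframeEquiv hΦ hq (hf.1 _) (hf.2 Φ hΦ) _
  bracket_mem ℓ a b := by
    refine ⟨fun q => ContMDiffAt.comp q ℓ.contDiff.contMDiff.contMDiffAt
      (hH.contMDiff_frameBracket a b q), fun Φ hΦ q hq => ?_⟩
    simp only [hΦ.frameBracket_eq hH hq]

theorem IsCoframe.frameBracket_neg_neg (hH : IsCoframe H) (q : M) (a b : V) :
    frameBracket H q (-a) (-b) = frameBracket H q a b := by
  rw [hH.frameBracket_eq (mem_chart_source E q), hH.frameBracket_eq (mem_chart_source E q)]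
  simp [coframeStructure]

section Symmetries

variable {ξ η : Π q : M, TangentSpace 𝓘(ℝ, E) q} {p : M}

/-- The components of a frame field are constant, so its bracket with `ξ` is all that remains in the
Lie derivative. -/
theorem IsCoframe.mlieBracket_frameVF_eq_zero (hH : IsCoframe H) (hξ : PreservesFormAt H ξ p)
    (a : V) : mlieBracket 𝓘(ℝ, E) ξ (frameVF H fun _ => a) p = 0 := by
  have h := hξ _ (Eventually.of_forall (hH.smoothVFAt_frameVF_const a))
  rw [lieDerivForm] at h
  simp only [hH.apply_frameVF, mvfderiv_const] at h
  apply (hH.bijective p).1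
  rw [map_zero, ← neg_eq_zero, ← h]
  simp

/-- The components of the bracket of two infinitesimal symmetries. -/
theorem IsCoframe.apply_mlieBracket_of_preserves (hH : IsCoframe H)
    (hξ : ∀ᶠ r in 𝓝 p, SmoothVFAt ξ r) (hη : ∀ᶠ r in 𝓝 p, SmoothVFAt η r)
    (hξ' : PreservesFormAt H ξ p) (hη' : PreservesFormAt H η p) :
    H p (mlieBracket 𝓘(ℝ, E) ξ η p) = -frameBracket H p (H p (ξ p)) (H p (η p)) := by
  have h1 := sub_eq_zero.1 (hξ' η hη)
  have h2 := sub_eq_zero.1 (hη' ξ hξ)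
  have h3 := hH.apply_mlieBracket hξ hη
  rw [h1, h2, mlieBracket_swap_apply (V := η), map_neg] at h3
  rw [eq_neg_iff_add_eq_zero]
  have : H p (mlieBracket 𝓘(ℝ, E) ξ η p) + (H p (mlieBracket 𝓘(ℝ, E) ξ η p) +
    frameBracket H p (H p (ξ p)) (H p (η p))) = H p (mlieBracket 𝓘(ℝ, E) ξ η p) := by
    nth_rw 3 [h3]
    abel
  exact add_eq_left.1 this

/-- A symmetry commutes with the frame, so it kills the frame derivatives of any function it kills.
By the Jacobi identity it also commutes with brackets of frame fields, hence kills the structure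
functions. This family takes the place of the flow of `ξ`. -/
theorem IsCoframe.isClosedFamily_symmetry (hH : IsCoframe H) {W : Set M} (hW : IsOpen W)
    (hξ : ∀ q ∈ W, SmoothVFAt ξ q ∧ PreservesFormAt H ξ q) :
    IsClosedFamily H {f : M → ℝ | ∀ q ∈ W, ContMDiffAt 𝓘(ℝ, E) 𝓘(ℝ, ℝ) ∞ f q ∧
      mvfderiv 𝓘(ℝ, E) f q (ξ q) = 0} W where
  smooth f hf q hq := (hf q hq).1
  frame_mem f hf a q hq := by
    have := FiniteDimensional.complete ℝ E
    have hs : ∀ r ∈ W, ContMDiffAt 𝓘(ℝ, E) 𝓘(ℝ, ℝ) ∞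
        (fun q => mvfderiv 𝓘(ℝ, E) f q ((H q).inverse a)) r := fun r hr =>
      SmoothVFAt.mvfderiv (hf r hr).1 (hH.smoothVFAt_frameVF_const a r)
    refine ⟨hs q hq, ?_⟩
    have e := mvfderiv_mlieBracket (ξ := ξ) (η := frameVF H fun _ => a) (q := q) (f := f)
      (a := fun q => mvfderiv 𝓘(ℝ, E) f q ((H q).inverse a)) (b := fun _ => 0)
      (hξ q hq).1 (hH.smoothVFAt_frameVF_const a q)
      (by filter_upwards [hW.mem_nhds hq] with r hr using (hξ r hr).1)
      (Eventually.of_forall (hH.smoothVFAt_frameVF_const a))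
      (by filter_upwards [hW.mem_nhds hq] with r hr using (hf r hr).1)
      (hs q hq) contMDiffAt_const (Eventually.of_forall fun r => rfl)
      (by filter_upwards [hW.mem_nhds hq] with r hr using (hf r hr).2)
    rw [hH.mlieBracket_frameVF_eq_zero (hξ q hq).2, map_zero, mvfderiv_const] at e
    rw [eq_comm, sub_eq_zero] at e
    exact e
  bracket_mem ℓ a b q hq := by
    have := FiniteDimensional.complete ℝ E
    have hs := hH.contMDiff_frameBracket a b q
    refine ⟨ContMDiffAt.comp q ℓ.contDiff.contMDiff.contMDiffAt hs, ?_⟩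
    rw [mvfderiv_clm_comp ℓ (mdifferentiableAt_of_contMDiffAt_infty hs)]
    have hz : ∀ a, mlieBracket 𝓘(ℝ, E) ξ (frameVF H fun _ => a) =ᶠ[𝓝 q] 0 := fun a => by
      filter_upwards [hW.mem_nhds hq] with r hr using hH.mlieBracket_frameVF_eq_zero (hξ r hr).2 a
    have z1 : mlieBracket 𝓘(ℝ, E) (mlieBracket 𝓘(ℝ, E) ξ (frameVF H fun _ => a))
        (frameVF H fun _ => b) q = 0 :=
      ((hz a).mlieBracket_vectorField_eq (EventuallyEq.refl _ (frameVF H fun _ => b))).trans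
        (congrFun (mlieBracket_zero_left (I := 𝓘(ℝ, E))) q)
    have z2 : mlieBracket 𝓘(ℝ, E) (frameVF H fun _ => a)
        (mlieBracket 𝓘(ℝ, E) ξ (frameVF H fun _ => b)) q = 0 :=
      ((EventuallyEq.refl _ (frameVF H fun _ => a)).mlieBracket_vectorField_eq (hz b)).trans
        (congrFun (mlieBracket_zero_right (I := 𝓘(ℝ, E))) q)
    have h1 := sub_eq_zero.1 ((hξ q hq).2 (mlieBracket 𝓘(ℝ, E) (frameVF H fun _ => a)
      (frameVF H fun _ => b)) (Eventually.of_forall fun r =>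
        (hH.smoothVFAt_frameVF_const a r).lie (hH.smoothVFAt_frameVF_const b r)))
    rw [SmoothVFAt.jacobi (hξ q hq).1 (hH.smoothVFAt_frameVF_const a q)
      (hH.smoothVFAt_frameVF_const b q), z1, z2, add_zero, map_zero] at h1
    change ℓ (mvfderiv 𝓘(ℝ, E) (fun r => H r (mlieBracket 𝓘(ℝ, E) (frameVF H fun _ => a)
      (frameVF H fun _ => b) r)) q (ξ q)) = 0
    rw [h1]
    simp

/-- On the box `f` factors as `(f ∘ τ) ∘ J`, and the chain rule applies. The target is any manifold,
so that `f` may be the quotient map. -/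
theorem IsClassifyingBox.mvfderiv_eq_zero {A : Set (M → ℝ)} {d : ℕ}
    {J : M → EuclideanSpace ℝ (Fin d)} {O : Set M} {B : Set (EuclideanSpace ℝ (Fin d))}
    {τ : EuclideanSpace ℝ (Fin d) → M} (h : IsClassifyingBox H A J O B τ)
    {E' : Type*} [NormedAddCommGroup E'] [NormedSpace ℝ E'] {N : Type*} [TopologicalSpace N]
    [ChartedSpace E' N] {f : M → N} {q : M} (hq : q ∈ O)
    (hf : ContMDiffAt 𝓘(ℝ, E) 𝓘(ℝ, E') ∞ f (τ (J q))) (hfJ : ∀ r ∈ O, f r = f (τ (J r)))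
    {v : TangentSpace 𝓘(ℝ, E) q}
    (hv : (mvfderiv 𝓘(ℝ, E) J q v : EuclideanSpace ℝ (Fin d)) = 0) :
    mfderiv 𝓘(ℝ, E) 𝓘(ℝ, E') f q v = 0 := by
  have h1 : ContMDiffAt 𝓘(ℝ, EuclideanSpace ℝ (Fin d)) 𝓘(ℝ, E') ∞ (f ∘ τ) (J q) :=
    ContMDiffAt.comp (J q) hf (h.smooth_section _ (h.mapsTo hq))
  have h2 := mfderiv_comp q (mdifferentiableAt_of_contMDiffAt_infty h1)
    (mdifferentiableAt_of_contMDiffAt_infty (h.smooth q hq))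
  have hev : f =ᶠ[𝓝 q] (f ∘ τ) ∘ J := by
    filter_upwards [h.isOpen.mem_nhds hq] with r hr using hfJ r hr
  have h3 : mfderiv 𝓘(ℝ, E) 𝓘(ℝ, E') f q = mfderiv 𝓘(ℝ, E) 𝓘(ℝ, E') ((f ∘ τ) ∘ J) q :=
    hev.mfderiv_eq
  have h4 := congrArg (fun L : E →L[ℝ] E' => L v) (h3.trans h2)
  refine h4.trans ?_
  change mfderiv 𝓘(ℝ, EuclideanSpace ℝ (Fin d)) 𝓘(ℝ, E') (f ∘ τ) (J q)
    (mvfderiv 𝓘(ℝ, E) J q v : EuclideanSpace ℝ (Fin d)) = 0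
  rw [hv]
  exact map_zero _

/-- Infinitesimal symmetries of a coframe annihilate its invariants. -/
theorem IsCoframe.mvfderiv_invariant_eq_zero (hH : IsCoframe H)
    (hξ : ∀ᶠ q in 𝓝 p, SmoothVFAt ξ q ∧ PreservesFormAt H ξ q) {f : M → ℝ}
    (hf : f ∈ coframeInvariants H) : mvfderiv 𝓘(ℝ, E) f p (ξ p) = 0 := by
  by_contra hne
  have hc : ContinuousAt (fun q => mvfderiv 𝓘(ℝ, E) f q (ξ q)) p :=
    (SmoothVFAt.mvfderiv (hf.1 p) hξ.self_of_nhds.1).continuousAt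
  obtain ⟨W, hW, hWo, hpW⟩ := _root_.mem_nhds_iff.1 (hξ.and (hc.eventually_ne hne))
  set A : Set (M → ℝ) := {f : M → ℝ | ∀ q ∈ W, ContMDiffAt 𝓘(ℝ, E) 𝓘(ℝ, ℝ) ∞ f q ∧
      mvfderiv 𝓘(ℝ, E) f q (ξ q) = 0} with hA
  have hcl : IsClosedFamily H A W := hH.isClosedFamily_symmetry hWo fun q hq => (hW hq).1
  have hbdd : BddAbove ((fun q => Module.finrank ℝ (differentials E A q)) '' W) :=
    ⟨Module.finrank ℝ (E →L[ℝ] ℝ), by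
      rintro _ ⟨q, -, rfl⟩
      exact Submodule.finrank_le _⟩
  -- The rank of the functions killed by `ξ` need not be constant, but it is bounded and so attains
  -- its maximum over `W` at some `q`. The derivative is still nonzero there, and a box exists
  -- around `q`.
  obtain ⟨q, hq, hqs⟩ := Nat.sSup_mem (Set.Nonempty.image _ ⟨p, hpW⟩) hbdd
  obtain ⟨J, O, B, τ, hbox, hqO, hOW, hτ⟩ := hH.exists_isClassifyingBox hcl (hWo.mem_nhds hq) rfl
    (by filter_upwards [hWo.mem_nhds hq] with r hr
        exact (le_csSup hbdd ⟨r, hr, rfl⟩).trans hqs.ge) (hWo.mem_nhds hq)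
  -- In the box `f` is a function of `J`, since points with equal `J` are equivalent; and `ξ` kills
  -- `J`, whose components lie in the family.
  refine (hW hq).2 (hbox.mvfderiv_eq_zero hqO (hf.1 _) (fun r hr => ?_) ?_)
  · obtain ⟨Φ, hΦ, hrΦ, hΦr⟩ := hbox.exists_equiv r hr (τ (J r))
      (hbox.mapsTo_section (hbox.mapsTo hr)) (hbox.section_right_inv _ (hbox.mapsTo hr)).symm
    rw [← hΦr, hf.2 Φ hΦ r hrΦ]
  · ext i
    rw [← mvfderiv_euclidean_apply (hbox.smooth q hqO)]
    exact (hbox.mem_family i q hq).2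

/-- An infinitesimal symmetry that vanishes at a point vanishes near it. -/
theorem IsCoframe.eventually_eq_zero_of_preserves (hH : IsCoframe H)
    (hξ : ∀ᶠ q in 𝓝 p, SmoothVFAt ξ q ∧ PreservesFormAt H ξ q) (h0 : ξ p = 0) :
    ∀ᶠ q in 𝓝 p, ξ q = 0 := by
  have := FiniteDimensional.complete ℝ E
  have hp := mem_chart_source E p
  have hx := (chartAt E p).map_source hp
  have h1 : ∀ᶠ q in 𝓝 p, DifferentiableAt ℝ (vfInChart p ξ) (chartAt E p q) ∧
      ∀ w, fderiv ℝ (formInChart H p) (chartAt E p q) (vfInChart p ξ (chartAt E p q)) w +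
      formInChart H p (chartAt E p q) (fderiv ℝ (vfInChart p ξ) (chartAt E p q) w) = 0 := by
    filter_upwards [hξ.eventually_nhds, (chartAt E p).open_source.mem_nhds hp] with q hq hqs
    exact ⟨(hq.self_of_nhds.1.contDiffAt_vfInChart hqs).differentiableAt (by simp),
      (preservesFormAt_iff hH.smooth hqs (hq.mono fun _ h => h.1)).1 hq.self_of_nhds.2⟩
  have h2 := eventually_eq_zero_of_coframe_symmetry (α := formInChart H p) (ξ := vfInChart p ξ)
    (hH.smooth.contDiffAt_formInChart hx) (hH.isInvertible_formInChart hx)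
    (by rw [vfInChart_apply ξ hp, h0]; exact map_zero _)
    (by filter_upwards [(chartAt E p).tendsto_symm hp |>.eventually h1,
          (chartAt E p).open_target.mem_nhds hx] with x h3 h4
        rwa [(chartAt E p).right_inv h4] at h3)
  filter_upwards [(chartAt E p).continuousAt hp |>.eventually h2,
    (chartAt E p).open_source.mem_nhds hp] with q h3 h4
  rw [vfInChart_apply ξ h4] at h3
  apply (mdifferentiable_chartAt p).mfderiv_injective h4
  rw [h3]
  exact (map_zero _).symm

end Symmetries
end Invariants

/-! ### The manifold structure of the quotient -/

section CoframeQuotient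

variable {E : Type*} [NormedAddCommGroup E] [NormedSpace ℝ E] [FiniteDimensional ℝ E]
  {M : Type*} [TopologicalSpace M] [ChartedSpace E M] [IsManifold 𝓘(ℝ, E) ∞ M]
  {V : Type*} [NormedAddCommGroup V] [NormedSpace ℝ V]
  {X : Type*} [TopologicalSpace X]

theorem surjective_mfderiv_of_section {E' : Type*} [NormedAddCommGroup E'] [NormedSpace ℝ E']
    [ChartedSpace E' X] {f : M → X} {s : X → M} {x : X} {q : M} (hsx : s x = q)
    (hf : ContMDiffAt 𝓘(ℝ, E) 𝓘(ℝ, E') ∞ f q) (hs : ContMDiffAt 𝓘(ℝ, E') 𝓘(ℝ, E) ∞ s x)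
    (hfs : ∀ᶠ y in 𝓝 x, f (s y) = y) : Function.Surjective (mfderiv 𝓘(ℝ, E) 𝓘(ℝ, E') f q) := by
  subst hsx
  intro w
  have h1 := mfderiv_comp x (mdifferentiableAt_of_contMDiffAt_infty hf)
    (mdifferentiableAt_of_contMDiffAt_infty hs)
  have hev : f ∘ s =ᶠ[𝓝 x] id := hfs
  rw [hev.mfderiv_eq, mfderiv_id] at h1
  exact ⟨mfderiv 𝓘(ℝ, E') 𝓘(ℝ, E) s x w, (congrArg (fun L : E' →L[ℝ] E' => L w) h1).symm⟩

/-- `h` is the quotient map for the local equivalence relation of a coframe. -/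
structure IsCoframeQuotientMap (H : Π q : M, TangentSpace 𝓘(ℝ, E) q →L[ℝ] V) (h : M → X) :
    Prop where
  isQuotientMap : Topology.IsQuotientMap h
  eq_iff : ∀ p q, h p = h q ↔ ∃ Φ : OpenPartialHomeomorph M M, IsCoframeEquiv H Φ ∧
    p ∈ Φ.source ∧ Φ p = q

variable {H : Π q : M, TangentSpace 𝓘(ℝ, E) q →L[ℝ] V} {h : M → X}

namespace IsCoframeQuotientMap

/-- Saturations of open sets are open: an equivalence taking a point into `O` takes a neighbourhood
of that point into `O`. -/
theorem isOpenMap (hh : IsCoframeQuotientMap H h) : IsOpenMap h := by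
  intro O hO
  rw [← hh.isQuotientMap.isOpen_preimage, isOpen_iff_mem_nhds]
  rintro q ⟨p, hp, hpq⟩
  obtain ⟨Φ, hΦ, hqΦ, hΦq⟩ := (hh.eq_iff q p).1 hpq.symm
  filter_upwards [Φ.open_source.mem_nhds hqΦ, (Φ.continuousAt hqΦ).preimage_mem_nhds
    (hO.mem_nhds (hΦq ▸ hp))] with r hr hr'
  exact ⟨Φ r, hr', ((hh.eq_iff r _).2 ⟨Φ, hΦ, hr, rfl⟩).symm⟩

theorem apply_equiv (hh : IsCoframeQuotientMap H h) {Φ : OpenPartialHomeomorph M M}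
    (hΦ : IsCoframeEquiv H Φ) {q : M} (hq : q ∈ Φ.source) : h (Φ q) = h q :=
  ((hh.eq_iff q _).2 ⟨Φ, hΦ, hq, rfl⟩).symm

theorem eq_section (hh : IsCoframeQuotientMap H h) {A : Set (M → ℝ)} {d : ℕ}
    {J : M → EuclideanSpace ℝ (Fin d)} {O : Set M} {B : Set (EuclideanSpace ℝ (Fin d))}
    {τ : EuclideanSpace ℝ (Fin d) → M} (hbox : IsClassifyingBox H A J O B τ) {q : M} (hq : q ∈ O) :
    h q = h (τ (J q)) :=
  (hh.eq_iff _ _).2 (hbox.exists_equiv q hq _ (hbox.mapsTo_section (hbox.mapsTo hq))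
    (hbox.section_right_inv _ (hbox.mapsTo hq)).symm)

/-- A function that is constant on the classes of local equivalence, as a function on the
quotient. -/
noncomputable def descend (hh : IsCoframeQuotientMap H h) {Y : Type*} (f : M → Y) (x : X) : Y :=
  f (Function.surjInv hh.isQuotientMap.surjective x)

theorem descend_apply (hh : IsCoframeQuotientMap H h) {Y : Type*} {f : M → Y}
    (hf : ∀ Φ : OpenPartialHomeomorph M M, IsCoframeEquiv H Φ → ∀ q ∈ Φ.source, f (Φ q) = f q)
    (q : M) : hh.descend f (h q) = f q := by
  obtain ⟨Φ, hΦ, hq, hq'⟩ := (hh.eq_iff q _).1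
    (Function.surjInv_eq hh.isQuotientMap.surjective (h q)).symm
  rw [descend, ← hq', hf Φ hΦ q hq]

end IsCoframeQuotientMap

theorem IsClassifyingBox.apply_equiv {d : ℕ} {J : M → EuclideanSpace ℝ (Fin d)} {O : Set M}
    {B : Set (EuclideanSpace ℝ (Fin d))} {τ : EuclideanSpace ℝ (Fin d) → M}
    (hbox : IsClassifyingBox H (coframeInvariants H) J O B τ) (Φ : OpenPartialHomeomorph M M)
    (hΦ : IsCoframeEquiv H Φ) (q : M) (hq : q ∈ Φ.source) : J (Φ q) = J q := by
  ext i
  exact (hbox.mem_family i).2 Φ hΦ q hq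

/-- The box is local, but the components of `J` are invariants and thus smooth on all of `M`. -/
theorem IsClassifyingBox.contMDiff {d : ℕ} {J : M → EuclideanSpace ℝ (Fin d)} {O : Set M}
    {B : Set (EuclideanSpace ℝ (Fin d))} {τ : EuclideanSpace ℝ (Fin d) → M}
    (hbox : IsClassifyingBox H (coframeInvariants H) J O B τ) :
    ContMDiff 𝓘(ℝ, E) 𝓘(ℝ, EuclideanSpace ℝ (Fin d)) ∞ J := fun q =>
  ContMDiffAt.comp q (g := (PiLp.continuousLinearEquiv 2 ℝ _).symm)
    (ContinuousLinearEquiv.contDiff _).contMDiff.contMDiffAt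
    (contMDiffAt_pi_space.2 fun i => (hbox.mem_family i).1 q)

/-- The chart of the quotient defined by a classifying box. -/
noncomputable def IsClassifyingBox.chart {d : ℕ} {J : M → EuclideanSpace ℝ (Fin d)} {O : Set M}
    {B : Set (EuclideanSpace ℝ (Fin d))} {τ : EuclideanSpace ℝ (Fin d) → M}
    (hbox : IsClassifyingBox H (coframeInvariants H) J O B τ) (hh : IsCoframeQuotientMap H h) :
    OpenPartialHomeomorph X (EuclideanSpace ℝ (Fin d)) where
  toFun := hh.descend J
  invFun := fun b => h (τ b)
  source := h '' O
  target := B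
  map_source' := by
    rintro _ ⟨q, hq, rfl⟩
    rw [hh.descend_apply hbox.apply_equiv]
    exact hbox.mapsTo hq
  map_target' b hb := ⟨τ b, hbox.mapsTo_section hb, rfl⟩
  left_inv' := by
    rintro _ ⟨q, hq, rfl⟩
    rw [hh.descend_apply hbox.apply_equiv]
    exact (hh.eq_section hbox hq).symm
  right_inv' b hb := by
    rw [hh.descend_apply hbox.apply_equiv, hbox.section_right_inv b hb]
  open_source := hh.isOpenMap _ hbox.isOpen
  open_target := hbox.isOpen_base
  continuousOn_toFun := by
    refine Continuous.continuousOn (hh.isQuotientMap.continuous_iff.2 ?_)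
    rw [show hh.descend J ∘ h = J from funext (hh.descend_apply hbox.apply_equiv)]
    exact hbox.contMDiff.continuous
  continuousOn_invFun b hb :=
    (hh.isQuotientMap.continuous.continuousAt.comp
      (hbox.smooth_section b hb).continuousAt).continuousWithinAt

/-- If the rank of the invariants of a coframe is constant, the quotient by local equivalence is
a manifold and the quotient map is a submersion. -/
theorem IsCoframe.exists_isManifold_quotient (hH : IsCoframe H) (hh : IsCoframeQuotientMap H h)
    {d : ℕ} (hd : ∀ q, Module.finrank ℝ (differentials E (coframeInvariants H) q) = d) :
    ∃ (_ : ChartedSpace (EuclideanSpace ℝ (Fin d)) X) (_ : IsManifold (𝓡 d) ∞ X),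
      ContMDiff 𝓘(ℝ, E) (𝓡 d) ∞ h ∧ ∀ p, Function.Surjective (mfderiv 𝓘(ℝ, E) (𝓡 d) h p) := by
  have hex := fun p => hH.exists_isClassifyingBox hH.isClosedFamily_invariants
    (p := p) univ_mem (hd p) (Eventually.of_forall fun q => (hd q).le) univ_mem
  choose J O B τ hbox hpO _ hτ using hex
  let c : M → OpenPartialHomeomorph X (EuclideanSpace ℝ (Fin d)) := fun p => (hbox p).chart hh
  let r : X → M := Function.surjInv hh.isQuotientMap.surjective
  have hr : ∀ x, h (r x) = x := Function.surjInv_eq hh.isQuotientMap.surjective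
  let CS : ChartedSpace (EuclideanSpace ℝ (Fin d)) X :=
    { atlas := Set.range fun x => c (r x)
      chartAt := fun x => c (r x)
      mem_chart_source := fun x => ⟨r x, hpO _, hr x⟩
      chart_mem_atlas := fun x => ⟨x, rfl⟩ }
  have hM : IsManifold (𝓡 d) ∞ X := by
    refine isManifold_of_contDiffOn (𝓡 d) ∞ X ?_
    rintro _ _ ⟨x, rfl⟩ ⟨y, rfl⟩ b hb
    simp only [modelWithCornersSelf_coe, Function.id_comp, modelWithCornersSelf_coe_symm,
      Function.comp_id, Set.preimage_id, Set.range_id, Set.inter_univ] at hb ⊢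
    have hb1 : b ∈ B (r x) := hb.1
    refine ContDiffAt.contDiffWithinAt (ContMDiffAt.contDiffAt ?_)
    -- A change of charts is the map `J` of one box composed with the section of the other. It is
    -- smooth because `J` is smooth and invariant on all of `M`, even where the boxes are disjoint.
    have h1 : ContMDiffAt 𝓘(ℝ, EuclideanSpace ℝ (Fin d)) 𝓘(ℝ, EuclideanSpace ℝ (Fin d)) ∞
        (J (r y) ∘ τ (r x)) b := ContMDiffAt.comp b ((hbox (r y)).contMDiff _)
      ((hbox (r x)).smooth_section b hb1)
    refine h1.congr_of_eventuallyEq (Eventually.of_forall fun b' => ?_)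
    exact hh.descend_apply (hbox (r y)).apply_equiv _
  have hhs : ContMDiff 𝓘(ℝ, E) (𝓡 d) ∞ h := by
    intro q
    rw [contMDiffAt_iff_target]
    refine ⟨hh.isQuotientMap.continuous.continuousAt, ?_⟩
    exact ((hbox (r (h q))).contMDiff q).congr_of_eventuallyEq
      (Eventually.of_forall fun q' => hh.descend_apply (hbox (r (h q))).apply_equiv q')
  refine ⟨CS, hM, hhs, fun q => ?_⟩
  -- `q` may lie outside the box of the chosen representative `p` of its class. A section of `h`
  -- through `q` arises from `τ p` by applying an equivalence from `p` to `q`.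
  obtain ⟨p, hp⟩ : ∃ p, p = r (h q) := ⟨_, rfl⟩
  have hpq : h p = h q := by rw [hp, hr]
  obtain ⟨Φ, hΦ, hpΦ, hΦp⟩ := (hh.eq_iff p q).1 hpq
  have hc1 : ContMDiffAt (𝓡 d) 𝓘(ℝ, EuclideanSpace ℝ (Fin d)) ∞ (c p) (h q) := by
    rw [hp]
    exact contMDiffAt_chartAt (mem_chart_source _ (h q))
  have hc2 : c p (h q) = J p p := by
    rw [← hpq]
    exact hh.descend_apply (hbox p).apply_equiv p
  have hτ' : ContMDiffAt (𝓡 d) 𝓘(ℝ, E) ∞ (fun x => τ p (c p x)) (h q) := by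
    refine ContMDiffAt.comp (h q) (g := τ p) ?_ hc1
    rw [hc2]
    exact (hbox p).smooth_section _ ((hbox p).mapsTo (hpO p))
  have hτp : τ p (c p (h q)) = p := by rw [hc2, hτ]
  have hsrc : h q ∈ (c p).source := ⟨p, hpO p, hpq⟩
  refine surjective_mfderiv_of_section (s := fun x => Φ (τ p (c p x))) (x := h q)
    (by rw [hτp, hΦp]) (hhs q) (ContMDiffAt.comp (h q) (g := Φ) ?_ hτ') ?_
  · rw [hτp]
    exact hΦ.contMDiffAt hpΦ
  · have hev : ∀ᶠ x in 𝓝 (h q), τ p (c p x) ∈ Φ.source := by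
      refine hτ'.continuousAt.eventually (Φ.open_source.mem_nhds ?_)
      beta_reduce
      rw [hτp]
      exact hpΦ
    filter_upwards [(c p).open_source.mem_nhds hsrc, hev] with x hx1 hx2
    rw [hh.apply_equiv hΦ hx2]
    exact (c p).left_inv hx1

end CoframeQuotient

/-! ### Local sections of submersions -/

section LocalSections

variable {E : Type*} [NormedAddCommGroup E] [NormedSpace ℝ E] [FiniteDimensional ℝ E]
  {M : Type*} [TopologicalSpace M] [ChartedSpace E M] [IsManifold 𝓘(ℝ, E) ∞ M]
  {F : Type*} [NormedAddCommGroup F] [NormedSpace ℝ F] [FiniteDimensional ℝ F]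
  {N : Type*} [TopologicalSpace N] [ChartedSpace F N] [IsManifold 𝓘(ℝ, F) ∞ N]

/-- A submersion has smooth local sections. -/
theorem exists_local_section {h : M → N} {p : M}
    (hh : ∀ᶠ q in 𝓝 p, ContMDiffAt 𝓘(ℝ, E) 𝓘(ℝ, F) ∞ h q)
    (hs : Function.Surjective (mfderiv 𝓘(ℝ, E) 𝓘(ℝ, F) h p)) :
    ∃ s : N → M, s (h p) = p ∧
      ∀ᶠ x in 𝓝 (h p), ContMDiffAt 𝓘(ℝ, F) 𝓘(ℝ, E) ∞ s x ∧ h (s x) = x := by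
  set φ := chartAt E p with hφ
  set ψ := chartAt F (h p) with hψ
  have hp : p ∈ φ.source := mem_chart_source E p
  have hhp : h p ∈ ψ.source := mem_chart_source F (h p)
  set J : E → F := fun x => ψ (h (φ.symm x)) with hJ
  have hU : ∀ᶠ x in 𝓝 (φ p), x ∈ φ.target ∧ h (φ.symm x) ∈ ψ.source ∧ ContDiffAt ℝ ∞ J x := by
    filter_upwards [φ.open_target.mem_nhds (φ.map_source hp), (φ.tendsto_symm hp).eventually
      (hh.and (hh.self_of_nhds.continuousAt.eventually (ψ.open_source.mem_nhds hhp)))] with x h1 h2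
    exact ⟨h1, h2.2, ContMDiffAt.contDiffAt (ContMDiffAt.comp x (contMDiffAt_chartAt h2.2)
      (ContMDiffAt.comp x h2.1 (contMDiffAt_chartAt_symm h1)))⟩
  have hψh : ContMDiffAt 𝓘(ℝ, E) 𝓘(ℝ, F) ∞ (fun q => ψ (h q)) p :=
    ContMDiffAt.comp p (contMDiffAt_chartAt hhp) hh.self_of_nhds
  have hsJ : Function.Surjective (fderiv ℝ J (φ p)) := by
    intro w
    obtain ⟨w, rfl⟩ := (mdifferentiable_chartAt (h p)).mfderiv_surjective hhp w
    obtain ⟨v, rfl⟩ := hs w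
    refine ⟨mfderiv 𝓘(ℝ, E) 𝓘(ℝ, E) φ p v, ?_⟩
    have e := mvfderiv_eq_fderiv_chart hp hψh v
    refine e.symm.trans ?_
    exact mvfderiv_comp_mfderiv
      (mdifferentiableAt_of_contMDiffAt_infty (contMDiffAt_chartAt hhp))
      (mdifferentiableAt_of_contMDiffAt_infty hh.self_of_nhds) v
  obtain ⟨O, B, σ, hbox, hpO, hOU, hσ⟩ := exists_isFiberedBox (J := J)
    (hU.mono fun x hx => hx.2.2) hsJ hU
  have hJp : J (φ p) = ψ (h p) := by rw [hJ]; simp only [φ.left_inv hp]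
  refine ⟨fun x => φ.symm (σ (ψ x)), ?_, ?_⟩
  · beta_reduce
    rw [← hJp, hσ, φ.left_inv hp]
  · have hB : ψ (h p) ∈ B := hJp ▸ hbox.mapsTo hpO
    filter_upwards [ψ.open_source.mem_nhds hhp,
      (ψ.continuousAt hhp).eventually (hbox.isOpen_base.mem_nhds hB)] with x h1 h2
    obtain ⟨h3, h4, -⟩ := hOU (hbox.mapsTo_section h2)
    refine ⟨ContMDiffAt.comp x (contMDiffAt_chartAt_symm h3) (ContMDiffAt.comp x
      (hbox.smooth_section.contDiffAt (hbox.isOpen_base.mem_nhds h2)).contMDiffAt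
      (contMDiffAt_chartAt h1)), ?_⟩
    have h5 := hbox.section_right_inv _ h2
    exact ψ.injOn h4 h1 h5

end LocalSections

/-! ### The Lie algebroid over the quotient -/

section QuotientAlgebroid

variable {E : Type*} [NormedAddCommGroup E] [NormedSpace ℝ E] [FiniteDimensional ℝ E]
  {M : Type*} [TopologicalSpace M] [ChartedSpace E M] [IsManifold 𝓘(ℝ, E) ∞ M]
  {V : Type*} [NormedAddCommGroup V] [NormedSpace ℝ V]
  {F : Type*} [NormedAddCommGroup F] [NormedSpace ℝ F] [FiniteDimensional ℝ F]
  {X : Type*} [TopologicalSpace X] [ChartedSpace F X] [IsManifold 𝓘(ℝ, F) ∞ X]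
  {H : Π q : M, TangentSpace 𝓘(ℝ, E) q →L[ℝ] V} {h : M → X}

variable (F) in
/-- `h` is a submersion onto a manifold, and the quotient map for the local equivalence relation
of the coframe `H`. -/
structure IsCoframeSubmersion (H : Π q : M, TangentSpace 𝓘(ℝ, E) q →L[ℝ] V) (h : M → X) : Prop where
  isCoframe : IsCoframe H
  isQuotient : IsCoframeQuotientMap H h
  smooth : ContMDiff 𝓘(ℝ, E) 𝓘(ℝ, F) ∞ h
  submersion : ∀ p, Function.Surjective (mfderiv 𝓘(ℝ, E) 𝓘(ℝ, F) h p)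

namespace IsCoframeSubmersion

theorem surjective (hh : IsCoframeSubmersion F H h) : Function.Surjective h :=
  hh.isQuotient.isQuotientMap.surjective

theorem mdifferentiableAt (hh : IsCoframeSubmersion F H h) (p : M) :
    MDifferentiableAt 𝓘(ℝ, E) 𝓘(ℝ, F) h p := mdifferentiableAt_of_contMDiffAt_infty (hh.smooth p)

/-- A function on the quotient is smooth if its pullback is smooth. -/
theorem contMDiffAt_of_comp (hh : IsCoframeSubmersion F H h) {Y : Type*} [NormedAddCommGroup Y]
    [NormedSpace ℝ Y] {f : X → Y} {p : M}
    (hf : ContMDiffAt 𝓘(ℝ, E) 𝓘(ℝ, Y) ∞ (fun q => f (h q)) p) :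
    ContMDiffAt 𝓘(ℝ, F) 𝓘(ℝ, Y) ∞ f (h p) := by
  obtain ⟨s, hs1, hs2⟩ := exists_local_section (Eventually.of_forall hh.smooth) (hh.submersion p)
  rw [← hs1] at hf
  refine (ContMDiffAt.comp (h p) hf hs2.self_of_nhds.1).congr_of_eventuallyEq ?_
  filter_upwards [hs2] with x hx
  simp only [Function.comp_apply, hx.2]

theorem mvfderiv_comp (hh : IsCoframeSubmersion F H h) {Y : Type*} [NormedAddCommGroup Y]
    [NormedSpace ℝ Y] {f : X → Y} {p : M} (hf : ContMDiffAt 𝓘(ℝ, F) 𝓘(ℝ, Y) ∞ f (h p))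
    (v : TangentSpace 𝓘(ℝ, E) p) : mvfderiv 𝓘(ℝ, E) (fun q => f (h q)) p v =
      mvfderiv 𝓘(ℝ, F) f (h p) (mfderiv 𝓘(ℝ, E) 𝓘(ℝ, F) h p v) :=
  mvfderiv_comp_mfderiv (mdifferentiableAt_of_contMDiffAt_infty hf) (hh.mdifferentiableAt p) v

/-- The anchor: the images under `dh` of the vectors of the frame. -/
noncomputable def anchor (hh : IsCoframeSubmersion F H h) (x : X) :
    V →L[ℝ] TangentSpace 𝓘(ℝ, F) x :=
  ((mfderiv 𝓘(ℝ, E) 𝓘(ℝ, F) h (Function.surjInv hh.surjective x) : E →L[ℝ] F).comp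
    (H (Function.surjInv hh.surjective x)).inverse : V →L[ℝ] F)

theorem mfderiv_equiv (hh : IsCoframeSubmersion F H h) {Φ : OpenPartialHomeomorph M M}
    (hΦ : IsCoframeEquiv H Φ) {q : M} (hq : q ∈ Φ.source) (v : TangentSpace 𝓘(ℝ, E) q) :
    (mfderiv 𝓘(ℝ, E) 𝓘(ℝ, F) h (Φ q) (mfderiv 𝓘(ℝ, E) 𝓘(ℝ, E) Φ q v) : F) =
      mfderiv 𝓘(ℝ, E) 𝓘(ℝ, F) h q v := by
  have h1 := mfderiv_comp q (hh.mdifferentiableAt (Φ q))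
    (mdifferentiableAt_of_contMDiffAt_infty (hΦ.contMDiffAt hq))
  have hev : h ∘ Φ =ᶠ[𝓝 q] h := by
    filter_upwards [Φ.open_source.mem_nhds hq] with r hr using hh.isQuotient.apply_equiv hΦ hr
  have h2 : (mfderiv 𝓘(ℝ, E) 𝓘(ℝ, F) (h ∘ Φ) q : E →L[ℝ] F) = mfderiv 𝓘(ℝ, E) 𝓘(ℝ, F) h q :=
    hev.mfderiv_eq
  exact congrArg (fun L : E →L[ℝ] F => L v) (h1.symm.trans h2)

/-- The choice of representative does not matter: an equivalence maps the frame to the frame and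
preserves `h`. -/
theorem anchor_apply (hh : IsCoframeSubmersion F H h) (p : M) (a : V) :
    hh.anchor (h p) a = mfderiv 𝓘(ℝ, E) 𝓘(ℝ, F) h p ((H p).inverse a) := by
  obtain ⟨Φ, hΦ, hq, hq'⟩ := (hh.isQuotient.eq_iff _ _).1 (Function.surjInv_eq hh.surjective (h p))
  have h1 := hh.mfderiv_equiv hΦ hq ((H _).inverse a)
  rw [hΦ.mfderiv_inverse hh.isCoframe hq, hq'] at h1
  exact h1.symm

theorem anchor_coframe (hh : IsCoframeSubmersion F H h) (p : M) (v : TangentSpace 𝓘(ℝ, E) p) :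
    hh.anchor (h p) (H p v) = mfderiv 𝓘(ℝ, E) 𝓘(ℝ, F) h p v := by
  rw [hh.anchor_apply, hh.isCoframe.inverse_apply]

/-- Along a local section of `h` the anchor is the tangent map of `h` applied to the inverse
coframe, and both are smooth. -/
theorem contMDiff_anchor (hh : IsCoframeSubmersion F H h) :
    ContMDiff (𝓘(ℝ, F).prod 𝓘(ℝ, V)) 𝓘(ℝ, F).tangent ∞
      (fun z : X × V => (⟨z.1, hh.anchor z.1 z.2⟩ : TangentBundle 𝓘(ℝ, F) X)) := by
  rintro ⟨x, a⟩
  obtain ⟨p, rfl⟩ := hh.surjective x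
  obtain ⟨s, hs1, hs2⟩ := exists_local_section (Eventually.of_forall hh.smooth) (hh.submersion p)
  have h1 : ContMDiffAt (𝓘(ℝ, F).prod 𝓘(ℝ, V)) (𝓘(ℝ, E).prod 𝓘(ℝ, V)) ∞
      (fun z : X × V => (s z.1, z.2)) (h p, a) :=
    (ContMDiffAt.comp (h p, a) hs2.self_of_nhds.1 contMDiffAt_fst).prodMk contMDiffAt_snd
  have h2 : ContMDiffAt (𝓘(ℝ, F).prod 𝓘(ℝ, V)) 𝓘(ℝ, E).tangent ∞
      (fun z : X × V => (⟨s z.1, (H (s z.1)).inverse z.2⟩ : TangentBundle 𝓘(ℝ, E) M)) (h p, a) :=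
    ContMDiffAt.comp (h p, a) (g := fun z : M × V =>
      (⟨z.1, (H z.1).inverse z.2⟩ : TangentBundle 𝓘(ℝ, E) M))
      hh.isCoframe.contMDiff_inverse.contMDiffAt h1
  have h3 : ContMDiffAt (𝓘(ℝ, F).prod 𝓘(ℝ, V)) 𝓘(ℝ, F).tangent ∞
      (fun z : X × V => tangentMap 𝓘(ℝ, E) 𝓘(ℝ, F) h ⟨s z.1, (H (s z.1)).inverse z.2⟩) (h p, a) :=
    ContMDiffAt.comp (h p, a) (ContMDiffAt.contMDiffAt_tangentMap (hh.smooth _)) h2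
  refine h3.congr_of_eventuallyEq ?_
  filter_upwards [continuousAt_fst.eventually hs2] with z hz
  have e := hh.anchor_apply (s z.1) z.2
  refine Bundle.TotalSpace.ext hz.2.symm (heq_of_eq ?_)
  rw [hz.2] at e
  exact e

/-- The vector field on the total space defined by a section. -/
noncomputable def lift (_ : IsCoframeSubmersion F H h) (s : X → V) :
    Π q : M, TangentSpace 𝓘(ℝ, E) q :=
  frameVF H fun q => s (h q)

section
variable {s t : X → V}

theorem smoothVFAt_lift (hh : IsCoframeSubmersion F H h) (hs : ContMDiff 𝓘(ℝ, F) 𝓘(ℝ, V) ∞ s) (q : M) :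
    SmoothVFAt (hh.lift s) q :=
  hh.isCoframe.smoothVFAt_frameVF (hs.comp hh.smooth).contMDiffAt

theorem mfderiv_lift (hh : IsCoframeSubmersion F H h) (s : X → V) (q : M) :
    mfderiv 𝓘(ℝ, E) 𝓘(ℝ, F) h q (hh.lift s q) = hh.anchor (h q) (s (h q)) :=
  (hh.anchor_apply q _).symm

/-- The components of the bracket of the lifts of two sections are functions on the quotient. -/
theorem apply_mlieBracket_lift (hh : IsCoframeSubmersion F H h) (hs : ContMDiff 𝓘(ℝ, F) 𝓘(ℝ, V) ∞ s)
    (ht : ContMDiff 𝓘(ℝ, F) 𝓘(ℝ, V) ∞ t) (Φ : OpenPartialHomeomorph M M)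
    (hΦ : IsCoframeEquiv H Φ) (q : M) (hq : q ∈ Φ.source) :
    H (Φ q) (mlieBracket 𝓘(ℝ, E) (hh.lift s) (hh.lift t) (Φ q)) =
      H q (mlieBracket 𝓘(ℝ, E) (hh.lift s) (hh.lift t) q) := by
  have := FiniteDimensional.complete ℝ E
  have hsrc := Φ.open_source.mem_nhds hq
  have hrel : ∀ s : X → V, ∀ᶠ r in 𝓝 q,
      mfderiv 𝓘(ℝ, E) 𝓘(ℝ, E) Φ r (hh.lift s r) = hh.lift s (Φ r) := fun s => by
    filter_upwards [hsrc] with r hr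
    unfold lift frameVF
    beta_reduce
    rw [hh.isQuotient.apply_equiv hΦ hr]
    exact hΦ.mfderiv_inverse hh.isCoframe hr _
  have e := mfderiv_mlieBracket_of_related (h := Φ) (p := q)
    (by filter_upwards [hsrc] with r hr using hΦ.contMDiffAt hr)
    (Eventually.of_forall (hh.smoothVFAt_lift hs)) (Eventually.of_forall (hh.smoothVFAt_lift ht))
    (Eventually.of_forall (hh.smoothVFAt_lift hs)) (Eventually.of_forall (hh.smoothVFAt_lift ht))
    (hrel s) (hrel t)
  rw [← e, hΦ.pullback q hq]

theorem contMDiffAt_mlieBracket_lift (hh : IsCoframeSubmersion F H h)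
    (hs : ContMDiff 𝓘(ℝ, F) 𝓘(ℝ, V) ∞ s) (ht : ContMDiff 𝓘(ℝ, F) 𝓘(ℝ, V) ∞ t) (q : M) :
    ContMDiffAt 𝓘(ℝ, E) 𝓘(ℝ, V) ∞
      (fun q => H q (mlieBracket 𝓘(ℝ, E) (hh.lift s) (hh.lift t) q)) q :=
  have := FiniteDimensional.complete ℝ E
  hh.isCoframe.smooth.apply ((hh.smoothVFAt_lift hs q).lie (hh.smoothVFAt_lift ht q))

end

/-- The bracket of two sections. -/
noncomputable def bracket (hh : IsCoframeSubmersion F H h) (s t : C^∞⟮𝓘(ℝ, F), X; 𝓘(ℝ, V), V⟯) :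
    C^∞⟮𝓘(ℝ, F), X; 𝓘(ℝ, V), V⟯ :=
  ⟨hh.isQuotient.descend fun q => H q (mlieBracket 𝓘(ℝ, E) (hh.lift s) (hh.lift t) q), by
    intro x
    obtain ⟨p, rfl⟩ := hh.surjective x
    refine hh.contMDiffAt_of_comp ?_
    have e := funext (hh.isQuotient.descend_apply
      (f := fun q => H q (mlieBracket 𝓘(ℝ, E) (hh.lift s) (hh.lift t) q))
      (hh.apply_mlieBracket_lift s.contMDiff t.contMDiff))
    rw [e]
    exact hh.contMDiffAt_mlieBracket_lift s.contMDiff t.contMDiff p⟩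

theorem bracket_apply (hh : IsCoframeSubmersion F H h) (s t : C^∞⟮𝓘(ℝ, F), X; 𝓘(ℝ, V), V⟯) (p : M) :
    hh.bracket s t (h p) = H p (mlieBracket 𝓘(ℝ, E) (hh.lift s) (hh.lift t) p) :=
  hh.isQuotient.descend_apply
    (f := fun q => H q (mlieBracket 𝓘(ℝ, E) (hh.lift s) (hh.lift t) q))
    (hh.apply_mlieBracket_lift s.contMDiff t.contMDiff) p

/-- Lifting respects brackets, so the Jacobi identity for sections is that of vector fields. -/
theorem lift_bracket (hh : IsCoframeSubmersion F H h) (s t : C^∞⟮𝓘(ℝ, F), X; 𝓘(ℝ, V), V⟯) :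
    hh.lift (hh.bracket s t) = mlieBracket 𝓘(ℝ, E) (hh.lift s) (hh.lift t) := by
  rw [← hh.isCoframe.frameVF_eq (ξ := mlieBracket 𝓘(ℝ, E) (hh.lift s) (hh.lift t))]
  exact congrArg (frameVF H) (funext (hh.bracket_apply s t))

theorem lift_add (hh : IsCoframeSubmersion F H h) (s t : C^∞⟮𝓘(ℝ, F), X; 𝓘(ℝ, V), V⟯) :
    hh.lift (s + t : C^∞⟮𝓘(ℝ, F), X; 𝓘(ℝ, V), V⟯) = hh.lift s + hh.lift t :=
  funext fun q => map_add (H q).inverse _ _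

theorem lift_const_smul (hh : IsCoframeSubmersion F H h) (c : ℝ)
    (s : C^∞⟮𝓘(ℝ, F), X; 𝓘(ℝ, V), V⟯) :
    hh.lift (c • s : C^∞⟮𝓘(ℝ, F), X; 𝓘(ℝ, V), V⟯) = c • hh.lift s :=
  funext fun q => map_smul (H q).inverse c (s (h q))

theorem lift_smul (hh : IsCoframeSubmersion F H h) (f : C^∞⟮𝓘(ℝ, F), X; 𝓘(ℝ, ℝ), ℝ⟯)
    (s : C^∞⟮𝓘(ℝ, F), X; 𝓘(ℝ, V), V⟯) :
    hh.lift (f • s : C^∞⟮𝓘(ℝ, F), X; 𝓘(ℝ, V), V⟯) = (fun q => f (h q)) • hh.lift s :=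
  funext fun q => map_smul (H q).inverse (f (h q)) (s (h q))

theorem bracket_ext (hh : IsCoframeSubmersion F H h) {s t : C^∞⟮𝓘(ℝ, F), X; 𝓘(ℝ, V), V⟯}
    (hst : ∀ p, s (h p) = t (h p)) : s = t := by
  ext x
  obtain ⟨p, rfl⟩ := hh.surjective x
  exact hst p

/-- The Lie algebroid structure on the trivial bundle over the quotient. -/
noncomputable def algebroid (hh : IsCoframeSubmersion F H h) : TrivialLieAlgebroid F X V where
  anchor := hh.anchor
  anchor_smooth := hh.contMDiff_anchor
  bracket := hh.bracket
  bracket_add s t u := hh.bracket_ext fun p => by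
    have := FiniteDimensional.complete ℝ E
    rw [bracket_apply, lift_add, mlieBracket_add_right (hh.smoothVFAt_lift t.contMDiff p).mdiff
      (hh.smoothVFAt_lift u.contMDiff p).mdiff, map_add]
    change _ = hh.bracket s t (h p) + hh.bracket s u (h p)
    rw [bracket_apply, bracket_apply]
  bracket_smul c s t := hh.bracket_ext fun p => by
    have := FiniteDimensional.complete ℝ E
    rw [bracket_apply, lift_const_smul, mlieBracket_const_smul_right
      (hh.smoothVFAt_lift t.contMDiff p).mdiff, map_smul]
    change _ = c • hh.bracket s t (h p)
    rw [bracket_apply]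
  bracket_skew s t := hh.bracket_ext fun p => by
    rw [bracket_apply, mlieBracket_swap_apply, map_neg]
    change _ = -hh.bracket s t (h p)
    rw [bracket_apply]
  bracket_jacobi s t u := hh.bracket_ext fun p => by
    have := FiniteDimensional.complete ℝ E
    change _ = hh.bracket (hh.bracket s t) u (h p) + hh.bracket t (hh.bracket s u) (h p)
    rw [bracket_apply, bracket_apply, bracket_apply, lift_bracket, lift_bracket, lift_bracket,
      ← map_add, SmoothVFAt.jacobi (hh.smoothVFAt_lift s.contMDiff p)
        (hh.smoothVFAt_lift t.contMDiff p) (hh.smoothVFAt_lift u.contMDiff p)]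
  bracket_leibniz f s t x := by
    have := FiniteDimensional.complete ℝ E
    obtain ⟨p, rfl⟩ := hh.surjective x
    have hf : ContMDiffAt 𝓘(ℝ, E) 𝓘(ℝ, ℝ) ∞ (fun q => f (h q)) p :=
      (f.contMDiff.comp hh.smooth).contMDiffAt
    rw [bracket_apply, lift_smul, mlieBracket_smul_right (mdifferentiableAt_of_contMDiffAt_infty hf)
      (hh.smoothVFAt_lift t.contMDiff p).mdiff, map_add, map_smul, map_smul, bracket_apply,
      hh.mvfderiv_comp f.contMDiff.contMDiffAt, hh.mfderiv_lift]
    rw [add_comm]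
    congr 2
    exact hh.isCoframe.apply_frameVF _ p
  anchor_bracket s t x := by
    have := FiniteDimensional.complete ℝ E
    have := FiniteDimensional.complete ℝ F
    obtain ⟨p, rfl⟩ := hh.surjective x
    have hsm : ∀ s : C^∞⟮𝓘(ℝ, F), X; 𝓘(ℝ, V), V⟯, ∀ y, SmoothVFAt (fun y => hh.anchor y (s y)) y :=
      fun s y => ContMDiffAt.comp y (g := fun z : X × V =>
        (⟨z.1, hh.anchor z.1 z.2⟩ : TangentBundle 𝓘(ℝ, F) X)) (f := fun y => (y, s y))
        hh.contMDiff_anchor.contMDiffAt (contMDiffAt_id.prodMk s.contMDiff.contMDiffAt)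
    rw [bracket_apply, hh.anchor_coframe]
    -- The lift of a section is `h`-related to the image of the section under the anchor.
    exact mfderiv_mlieBracket_of_related (Eventually.of_forall hh.smooth)
      (Eventually.of_forall (hh.smoothVFAt_lift s.contMDiff))
      (Eventually.of_forall (hh.smoothVFAt_lift t.contMDiff))
      (Eventually.of_forall (hsm s)) (Eventually.of_forall (hsm t))
      (Eventually.of_forall (hh.mfderiv_lift s)) (Eventually.of_forall (hh.mfderiv_lift t))

end IsCoframeSubmersion
end QuotientAlgebroid

/-! ### Uniqueness of the algebroid, and isotropy as symmetries -/

section IsotropyAlgebra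

variable {E : Type*} [NormedAddCommGroup E] [NormedSpace ℝ E] [FiniteDimensional ℝ E]
  {M : Type*} [TopologicalSpace M] [ChartedSpace E M] [IsManifold 𝓘(ℝ, E) ∞ M]
  {V : Type*} [NormedAddCommGroup V] [NormedSpace ℝ V]
  {F : Type*} [NormedAddCommGroup F] [NormedSpace ℝ F] [FiniteDimensional ℝ F]
  {X : Type*} [TopologicalSpace X] [ChartedSpace F X] [IsManifold 𝓘(ℝ, F) ∞ X]
  {H : Π q : M, TangentSpace 𝓘(ℝ, E) q →L[ℝ] V} {h : M → X}

theorem mvfderiv_apply_apply {W Y : Type*} [NormedAddCommGroup W] [NormedSpace ℝ W]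
    [NormedAddCommGroup Y] [NormedSpace ℝ Y] {g : M → W →L[ℝ] Y} {u : M → W} {p : M}
    (hg : ContMDiffAt 𝓘(ℝ, E) 𝓘(ℝ, W →L[ℝ] Y) ∞ g p) (hu : ContMDiffAt 𝓘(ℝ, E) 𝓘(ℝ, W) ∞ u p)
    (v : TangentSpace 𝓘(ℝ, E) p) :
    mvfderiv 𝓘(ℝ, E) (fun q => g q (u q)) p v =
      mvfderiv 𝓘(ℝ, E) g p v (u p) + g p (mvfderiv 𝓘(ℝ, E) u p v) := by
  have hp := mem_chart_source E p
  rw [mvfderiv_eq_fderiv_chart hp hg, mvfderiv_eq_fderiv_chart hp hu,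
    mvfderiv_eq_fderiv_chart hp (hg.clm_apply hu)]
  have h1 := ((contDiffAt_comp_chart_symm hp hg).differentiableAt (by simp)).hasFDerivAt
  have h2 := ((contDiffAt_comp_chart_symm hp hu).differentiableAt (by simp)).hasFDerivAt
  rw [(h1.clm_apply h2).fderiv, (chartAt E p).left_inv hp, add_comm]
  rfl

/-- The exterior derivative of the 1-form with components `g` with respect to a coframe. -/
theorem IsCoframe.extDerivForm_comp (hH : IsCoframe H) {g : M → V →L[ℝ] ℝ} {p : M}
    (hg : ContMDiffAt 𝓘(ℝ, E) 𝓘(ℝ, V →L[ℝ] ℝ) ∞ g p) {ξ η : Π q : M, TangentSpace 𝓘(ℝ, E) q}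
    (hξ : ∀ᶠ q in 𝓝 p, SmoothVFAt ξ q) (hη : ∀ᶠ q in 𝓝 p, SmoothVFAt η q) :
    extDerivForm (fun q => (g q).comp (H q)) ξ η p =
      mvfderiv 𝓘(ℝ, E) g p (ξ p) (H p (η p)) - mvfderiv 𝓘(ℝ, E) g p (η p) (H p (ξ p)) -
        g p (frameBracket H p (H p (ξ p)) (H p (η p))) := by
  have e1 := mvfderiv_apply_apply hg (hH.smooth.apply hη.self_of_nhds) (ξ p)
  have e2 := mvfderiv_apply_apply hg (hH.smooth.apply hξ.self_of_nhds) (η p)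
  unfold extDerivForm
  simp only [ContinuousLinearMap.comp_apply]
  rw [e1, e2, hH.apply_mlieBracket hξ hη, map_add, map_sub]
  ring

/-- The algebroid `A` over the quotient induces the differential of forms on the total space. -/
structure IsCoframeAlgebroid (A : TrivialLieAlgebroid F X V)
    (H : Π q : M, TangentSpace 𝓘(ℝ, E) q →L[ℝ] V) (h : M → X) : Prop where
  anchor_coframe : ∀ p (v : TangentSpace 𝓘(ℝ, E) p),
    A.anchor (h p) (H p v) = mfderiv 𝓘(ℝ, E) 𝓘(ℝ, F) h p v
  bracket_const : ∀ p (a b : V), A.bracket (TrivialLieAlgebroid.constSection F X a)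
    (TrivialLieAlgebroid.constSection F X b) (h p) = frameBracket H p a b

theorem IsCoframeSubmersion.isCoframeAlgebroid (hh : IsCoframeSubmersion F H h) :
    IsCoframeAlgebroid hh.algebroid H h where
  anchor_coframe := hh.anchor_coframe
  bracket_const p _ _ := hh.bracket_apply _ _ p

theorem IsCoframeAlgebroid.extDerivForm_eq {A : TrivialLieAlgebroid F X V}
    (hA : IsCoframeAlgebroid A H h) (hh : IsCoframeSubmersion F H h)
    (η : C^∞⟮𝓘(ℝ, F), X; 𝓘(ℝ, V →L[ℝ] ℝ), V →L[ℝ] ℝ⟯) {p : M}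
    {ξ₁ ξ₂ : Π q : M, TangentSpace 𝓘(ℝ, E) q} (h₁ : ∀ᶠ q in 𝓝 p, SmoothVFAt ξ₁ q)
    (h₂ : ∀ᶠ q in 𝓝 p, SmoothVFAt ξ₂ q) :
    extDerivForm (fun q => (η (h q)).comp (H q)) ξ₁ ξ₂ p =
      A.dForm η (h p) (H p (ξ₁ p)) (H p (ξ₂ p)) := by
  have hη : ContMDiffAt 𝓘(ℝ, F) 𝓘(ℝ, V →L[ℝ] ℝ) ∞ η (h p) := η.contMDiff.contMDiffAt
  have e : ∀ (b : V) (v : TangentSpace 𝓘(ℝ, F) (h p)),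
      mvfderiv 𝓘(ℝ, F) (fun y => η y b) (h p) v = mvfderiv 𝓘(ℝ, F) η (h p) v b := fun b v => by
    have := mvfderiv_apply_apply hη (contMDiffAt_const (c := b)) v
    rw [this, mvfderiv_const]
    simp
  rw [hh.isCoframe.extDerivForm_comp (g := fun q => η (h q)) (ContMDiffAt.comp p hη (hh.smooth p)) h₁ h₂,
    TrivialLieAlgebroid.dForm, hA.anchor_coframe, hA.anchor_coframe, e, e, hA.bracket_const]
  rw [← hh.mvfderiv_comp hη, ← hh.mvfderiv_comp hη]

/-- An algebroid that induces the differential of functions and of constant 1-forms on the total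
space is determined by the coframe, if the rank of the invariants is constant. -/
theorem IsCoframeSubmersion.isCoframeAlgebroid_of_pullback (hh : IsCoframeSubmersion F H h)
    {d : ℕ} (hd : ∀ q, Module.finrank ℝ (differentials E (coframeInvariants H) q) = d)
    {A : TrivialLieAlgebroid F X V}
    (hf : ∀ (f : C^∞⟮𝓘(ℝ, F), X; 𝓘(ℝ, ℝ), ℝ⟯) (p : M) (v : TangentSpace 𝓘(ℝ, E) p),
      mvfderiv 𝓘(ℝ, E) (fun q => f (h q)) p v = A.dFunction f (h p) (H p v))
    (hη : ∀ (ℓ : V →L[ℝ] ℝ) (p : M) (ξ₁ ξ₂ : Π q : M, TangentSpace 𝓘(ℝ, E) q),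
      (∀ᶠ q in 𝓝 p, SmoothVFAt ξ₁ q) → (∀ᶠ q in 𝓝 p, SmoothVFAt ξ₂ q) →
      extDerivForm (fun q => ℓ.comp (H q)) ξ₁ ξ₂ p =
        A.dForm (fun _ => ℓ) (h p) (H p (ξ₁ p)) (H p (ξ₂ p))) :
    IsCoframeAlgebroid A H h where
  anchor_coframe p v := by
    obtain ⟨J, O, B, τ, hbox, hpO, -, hτ⟩ := hh.isCoframe.exists_isClassifyingBox
      hh.isCoframe.isClosedFamily_invariants (p := p) univ_mem (hd p)
      (Eventually.of_forall fun q => (hd q).le) univ_mem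
    -- `w` lifts the value of the unknown anchor, and the claim is that `dh` agrees on `w` and `v`.
    -- By `hf` no invariant distinguishes `w` from `v`, since invariants descend to global smooth
    -- functions; and by constant rank `h` is locally a function of finitely many invariants.
    obtain ⟨w, hw⟩ := hh.submersion p (A.anchor (h p) (H p v))
    have key : ∀ f ∈ coframeInvariants H, mvfderiv 𝓘(ℝ, E) f p (w - v) = 0 := by
      intro f hfi
      have e := funext (hh.isQuotient.descend_apply hfi.2)
      let f' : C^∞⟮𝓘(ℝ, F), X; 𝓘(ℝ, ℝ), ℝ⟯ := ⟨hh.isQuotient.descend f, fun x => by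
        obtain ⟨q, rfl⟩ := hh.surjective x
        refine hh.contMDiffAt_of_comp ?_
        rw [e]
        exact hfi.1 q⟩
      have h1 := hf f' p v
      have h2 := hh.mvfderiv_comp (f := f') f'.contMDiff.contMDiffAt w
      rw [hw] at h2
      have h3 := h2.trans h1.symm
      change mvfderiv 𝓘(ℝ, E) (fun q => hh.isQuotient.descend f (h q)) p w =
        mvfderiv 𝓘(ℝ, E) (fun q => hh.isQuotient.descend f (h q)) p v at h3
      rw [e] at h3
      rw [map_sub, h3, sub_self]
    have h0 : mfderiv 𝓘(ℝ, E) 𝓘(ℝ, F) h p (w - v) = 0 := by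
      refine hbox.mvfderiv_eq_zero hpO (hh.smooth _) (fun r hr => hh.isQuotient.eq_section hbox hr) ?_
      ext i
      rw [← mvfderiv_euclidean_apply (hbox.smooth p hpO)]
      exact key _ (hbox.mem_family i)
    rw [map_sub, hw] at h0
    exact sub_eq_zero.1 h0
  bracket_const p a b := by
    refine (SeparatingDual.eq_iff_forall_dual_eq (R := ℝ)).2 fun ℓ => ?_
    -- On frame fields the differential of a constant form reduces on both sides to minus its value
    -- on the bracket.
    have h1 := hη ℓ p (frameVF H fun _ => a) (frameVF H fun _ => b)
      (Eventually.of_forall (hh.isCoframe.smoothVFAt_frameVF_const a))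
      (Eventually.of_forall (hh.isCoframe.smoothVFAt_frameVF_const b))
    rw [hh.isCoframe.extDerivForm_comp contMDiffAt_const
      (Eventually.of_forall (hh.isCoframe.smoothVFAt_frameVF_const a))
      (Eventually.of_forall (hh.isCoframe.smoothVFAt_frameVF_const b)),
      TrivialLieAlgebroid.dForm, hh.isCoframe.apply_frameVF, hh.isCoframe.apply_frameVF,
      mvfderiv_const, mvfderiv_const, mvfderiv_const] at h1
    simp only [zero_apply, sub_self, zero_sub, neg_inj] at h1
    exact h1.symm

/-- Minus the value at `p` of a germ of vector fields, in terms of a coframe. -/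
noncomputable def germComponents (H : Π q : M, TangentSpace 𝓘(ℝ, E) q →L[ℝ] V) (p : M) :
    VFGerm E p →ₗ[ℝ] V :=
  (nullVFNear E p).liftQ
    { toFun := fun ξ => -H p (ξ.1 p)
      map_add' := fun ξ η => by
        change -H p (ξ.1 p + η.1 p) = _
        rw [map_add, neg_add]
      map_smul' := fun c ξ => by
        change -H p (c • ξ.1 p) = c • -H p (ξ.1 p)
        rw [map_smul, smul_neg] }
    fun ξ hξ => by
      change -H p (ξ.1 p) = 0
      rw [Eventually.self_of_nhds hξ, map_zero, neg_zero]

theorem germComponents_mk (p : M) (ξ : smoothVFNear E p) :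
    germComponents H p (Submodule.Quotient.mk ξ) = -H p (ξ.1 p) := rfl

section
variable [FiniteDimensional ℝ V]

/-- The anchor is onto because `h` is a submersion, and the coframe identifies the dimension of `V`
with that of `M`. The integers avoid truncated subtraction. -/
theorem IsCoframeAlgebroid.finrank_isotropy {A : TrivialLieAlgebroid F X V}
    (hA : IsCoframeAlgebroid A H h) (hh : IsCoframeSubmersion F H h) (p : M) :
    (Module.finrank ℝ (A.Isotropy (h p)) : ℤ) = Module.finrank ℝ E - Module.finrank ℝ F := by
  have hs : Function.Surjective (A.anchor (h p)) := fun w => by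
    obtain ⟨v, rfl⟩ := hh.submersion p w
    exact ⟨H p v, hA.anchor_coframe p v⟩
  have h1 := LinearMap.finrank_range_add_finrank_ker (A.anchor (h p)).toLinearMap
  have h2 : Module.finrank ℝ (LinearMap.range (A.anchor (h p)).toLinearMap) = Module.finrank ℝ F := by
    rw [LinearMap.range_eq_top.2 hs]
    exact finrank_top ℝ F
  have h3 : Module.finrank ℝ E = Module.finrank ℝ V :=
    LinearEquiv.finrank_eq (LinearEquiv.ofBijective (H p : E →L[ℝ] V).toLinearMap
      (hh.isCoframe.bijective p))
  have h4 : Module.finrank ℝ F + Module.finrank ℝ (A.Isotropy (h p)) = Module.finrank ℝ E :=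
    (congrArg (· + Module.finrank ℝ (A.Isotropy (h p))) h2).symm.trans (h1.trans h3.symm)
  rw [← h4]
  push_cast
  ring

/-- The Lie algebra of germs of infinitesimal symmetries of a coframe is the isotropy Lie algebra
of the algebroid. -/
theorem IsCoframeAlgebroid.nonempty_lieEquiv {A : TrivialLieAlgebroid F X V}
    (hA : IsCoframeAlgebroid A H h) (hh : IsCoframeSubmersion F H h) {d : ℕ}
    (hd : ∀ q, Module.finrank ℝ (differentials E (coframeInvariants H) q) = d) (p : M) :
    Nonempty (germsPreserving H hh.isCoframe.smooth p ≃ₗ⁅ℝ⁆ A.Isotropy (h p)) := by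
  have hH := hh.isCoframe
  obtain ⟨J, O, B, τ, hbox, hpO, -, hτ⟩ := hH.exists_isClassifyingBox
    hH.isClosedFamily_invariants (p := p) univ_mem (hd p)
    (Eventually.of_forall fun q => (hd q).le) univ_mem
  set L := germsPreserving H hH.smooth p with hL
  -- A symmetry kills the invariants, hence `dJ` vanishes on it, hence so does `dh`, because `h` is
  -- a function of `J` in the box.
  have hker : ∀ x : L, A.anchor (h p) (germComponents H p x.1) = 0 := by
    rintro ⟨_, ξ, rfl, hξ⟩
    rw [germComponents_mk, map_neg, hA.anchor_coframe, neg_eq_zero]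
    refine hbox.mvfderiv_eq_zero hpO (hh.smooth _) (fun r hr => hh.isQuotient.eq_section hbox hr) ?_
    ext i
    rw [← mvfderiv_euclidean_apply (hbox.smooth p hpO)]
    exact hH.mvfderiv_invariant_eq_zero (ξ.2.and hξ) (hbox.mem_family i)
  -- The minus sign in `germComponents` makes this a morphism of Lie algebras: the bracket of
  -- symmetries has minus the components of the frame bracket.
  let Ψ : L →ₗ⁅ℝ⁆ A.Isotropy (h p) :=
    { toLinearMap := ((germComponents H p).comp L.toSubmodule.subtype).codRestrict
        (LinearMap.ker (A.anchor (h p)).toLinearMap) hker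
      map_lie' := by
        rintro ⟨_, ξ, rfl, hξ⟩ ⟨_, η, rfl, hη⟩
        refine Subtype.ext ?_
        rw [TrivialLieAlgebroid.Isotropy.coe_lie, hA.bracket_const]
        change -H p (mlieBracket 𝓘(ℝ, E) ξ.1 η.1 p) =
          frameBracket H p (-H p (ξ.1 p)) (-H p (η.1 p))
        rw [hH.frameBracket_neg_neg, hH.apply_mlieBracket_of_preserves ξ.2 η.2 hξ.self_of_nhds
          hη.self_of_nhds, neg_neg] }
  refine ⟨LieEquiv.ofBijective Ψ ⟨?_, ?_⟩⟩
  · refine (injective_iff_map_eq_zero Ψ).2 ?_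
    rintro ⟨_, ξ, rfl, hξ⟩ h0
    have h1 : -H p (ξ.1 p) = 0 := congrArg Subtype.val h0
    have h2 : ξ.1 p = 0 := (hH.bijective p).1 ((neg_eq_zero.1 h1).trans (map_zero _).symm)
    refine Subtype.ext ?_
    change Submodule.Quotient.mk ξ = 0
    rw [← Submodule.Quotient.mk_zero]
    exact VFGerm.mk_eq_iff.2 (hH.eventually_eq_zero_of_preserves (ξ.2.and hξ) h2)
  · rintro ⟨a, ha⟩
    -- An isotropy element comes from a vector `v` in the kernel of `dh`. As `J` descends to the
    -- quotient, `v` is also in the kernel of `dJ`, so it extends to a symmetry.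
    obtain ⟨v, hv⟩ := (hH.bijective p).2 (-a)
    have hdv : mfderiv 𝓘(ℝ, E) 𝓘(ℝ, F) h p v = 0 := by
      rw [← hA.anchor_coframe, hv, map_neg, neg_eq_zero]
      exact ha
    have hJv : (mvfderiv 𝓘(ℝ, E) J p v : EuclideanSpace ℝ (Fin d)) = 0 := by
      have e := funext (hh.isQuotient.descend_apply hbox.apply_equiv)
      have hs : ContMDiffAt 𝓘(ℝ, F) 𝓘(ℝ, EuclideanSpace ℝ (Fin d)) ∞
          (hh.isQuotient.descend J) (h p) := by
        refine hh.contMDiffAt_of_comp ?_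
        rw [e]
        exact hbox.contMDiff p
      have h1 := hh.mvfderiv_comp hs v
      rw [e, hdv, map_zero] at h1
      exact h1
    obtain ⟨ξ, hξ1, hξ2⟩ := hbox.exists_symmetry p hpO v hJv
    refine ⟨⟨Submodule.Quotient.mk ⟨ξ, hξ2.mono fun _ h => h.1⟩, _, rfl, hξ2.mono fun _ h => h.2⟩,
      Subtype.ext ?_⟩
    change -H p (ξ p) = a
    rw [hξ1, hv, neg_neg]

end
end IsotropyAlgebra

/-! ### From structures with connection to coframes -/

section GStructureCoframes

variable {n : ℕ} {𝔤 : Type*} [NormedAddCommGroup 𝔤] [NormedSpace ℝ 𝔤] [FiniteDimensional ℝ 𝔤]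
  {E : Type*} [NormedAddCommGroup E] [NormedSpace ℝ E] [FiniteDimensional ℝ E]
  {G : Subgroup (Matrix.GeneralLinearGroup (Fin n) ℝ)} [ChartedSpace 𝔤 G]
  {P : Type*} [TopologicalSpace P] [ChartedSpace E P] [IsManifold 𝓘(ℝ, E) ∞ P]

namespace GStructureWithConnection

variable (S : GStructureWithConnection 𝔤 E G P)

theorem isCoframe : IsCoframe S.coframe where
  smooth := ContMDiff.prodMk_space S.tautForm_smooth S.connForm_smooth
  bijective := S.coframe_bijective

theorem isCoframeEquiv_iff {Φ : OpenPartialHomeomorph P P} :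
    IsCoframeEquiv S.coframe Φ ↔ S.IsLocalEquiv Φ :=
  ⟨fun h => ⟨h.smooth, h.smooth_symm, fun q hq v => congrArg Prod.fst (h.pullback q hq v),
    fun q hq v => congrArg Prod.snd (h.pullback q hq v)⟩,
  fun h => ⟨h.smooth, h.smooth_symm, fun q hq v =>
    Prod.ext (h.pullback_taut q hq v) (h.pullback_conn q hq v)⟩⟩

theorem isCoframeQuotientMap : IsCoframeQuotientMap S.coframe S.classifyingMap where
  isQuotientMap := isQuotientMap_quot_mk
  eq_iff p q := by
    simp only [isCoframeEquiv_iff]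
    exact Quotient.eq

theorem mem_coframeInvariants {f : P → ℝ} : f ∈ coframeInvariants S.coframe ↔ S.IsInvariant f := by
  simp only [coframeInvariants, isCoframeEquiv_iff]
  rfl

/-- The differentials of invariants already form a subspace, so taking the span adds nothing. -/
theorem differentials_coframeInvariants (p : P) :
    differentials E (coframeInvariants S.coframe) p = S.invariantCodifferentials p := by
  rw [differentials, ← Submodule.span_eq (S.invariantCodifferentials p)]
  congr 1
  ext φ
  constructor
  · rintro ⟨f, hf, rfl⟩
    exact ⟨f, S.mem_coframeInvariants.1 hf, rfl⟩
  · rintro ⟨f, hf, rfl⟩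
    exact ⟨f, S.mem_coframeInvariants.2 hf, rfl⟩

theorem preservesFormAt_coframe_iff {ξ : Π q : P, TangentSpace 𝓘(ℝ, E) q} {p : P} :
    PreservesFormAt S.coframe ξ p ↔
      PreservesFormAt S.tautForm ξ p ∧ PreservesFormAt S.connForm ξ p := by
  have key : ∀ Y : Π q : P, TangentSpace 𝓘(ℝ, E) q, (∀ᶠ r in 𝓝 p, SmoothVFAt Y r) →
      lieDerivForm S.coframe ξ Y p = (lieDerivForm S.tautForm ξ Y p, lieDerivForm S.connForm ξ Y p) := by
    intro Y hY
    have hd := mdifferentiableAt_of_contMDiffAt_infty (S.isCoframe.smooth.apply hY.self_of_nhds)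
    have h1 := mvfderiv_clm_comp (ContinuousLinearMap.fst ℝ (Fin n → ℝ) 𝔤) hd (ξ p)
    have h2 := mvfderiv_clm_comp (ContinuousLinearMap.snd ℝ (Fin n → ℝ) 𝔤) hd (ξ p)
    exact Prod.ext (congrArg (· - S.tautForm p (mlieBracket 𝓘(ℝ, E) ξ Y p)) h1.symm)
      (congrArg (· - S.connForm p (mlieBracket 𝓘(ℝ, E) ξ Y p)) h2.symm)
  constructor
  · intro h
    refine ⟨fun Y hY => ?_, fun Y hY => ?_⟩
    · exact congrArg Prod.fst ((key Y hY).symm.trans (h Y hY))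
    · exact congrArg Prod.snd ((key Y hY).symm.trans (h Y hY))
  · intro h Y hY
    rw [key Y hY, h.1 Y hY, h.2 Y hY]
    rfl

/-- A germ in the intersection has one representative for each form; they agree near `p`, so a
single one preserves both forms. -/
theorem symmetryGerms_eq (p : P) :
    S.symmetryGerms p = germsPreserving S.coframe S.isCoframe.smooth p := by
  ext x
  constructor
  · rintro ⟨⟨ξ, rfl, h1⟩, η, hη, h2⟩
    refine ⟨ξ, rfl, ?_⟩
    filter_upwards [h1, h2, (VFGerm.mk_eq_iff.1 hη).eventuallyEq_nhds] with q h3 h4 h5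
    exact S.preservesFormAt_coframe_iff.2 ⟨h3, h4.congr h5⟩
  · rintro ⟨ξ, rfl, h⟩
    exact ⟨⟨ξ, rfl, h.mono fun q hq => (S.preservesFormAt_coframe_iff.1 hq).1⟩,
      ⟨ξ, rfl, h.mono fun q hq => (S.preservesFormAt_coframe_iff.1 hq).2⟩⟩

end GStructureWithConnection
end GStructureCoframes

theorem mainTheorem6 {n : ℕ}
    {𝔤 : Type*} [NormedAddCommGroup 𝔤] [NormedSpace ℝ 𝔤] [FiniteDimensional ℝ 𝔤]
    (G : Subgroup (Matrix.GeneralLinearGroup (Fin n) ℝ))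
    (hG_closed : IsClosed (G : Set (Matrix.GeneralLinearGroup (Fin n) ℝ)))
    [ChartedSpace 𝔤 G] [LieGroup 𝓘(ℝ, 𝔤) ∞ G]
    (hG_smooth : ∀ i j, ContMDiff 𝓘(ℝ, 𝔤) 𝓘(ℝ, ℝ) ∞ (fun g : G => g.1.1 i j))
    {E : Type*} [NormedAddCommGroup E] [NormedSpace ℝ E] [FiniteDimensional ℝ E]
    {P : Type*} [TopologicalSpace P] [T2Space P] [SecondCountableTopology P]
    [ChartedSpace E P] [IsManifold 𝓘(ℝ, E) ∞ P]
    (S : GStructureWithConnection 𝔤 E G P) (hS : S.IsFullyRegular) :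
    (∃ (m : ℕ) (_ : ChartedSpace (EuclideanSpace ℝ (Fin m)) S.ClassifyingSpace)
      (_ : IsManifold (𝓡 m) ∞ S.ClassifyingSpace), S.IsClassifyingManifold m) ∧
    ∀ (m : ℕ) [ChartedSpace (EuclideanSpace ℝ (Fin m)) S.ClassifyingSpace]
      [IsManifold (𝓡 m) ∞ S.ClassifyingSpace], S.IsClassifyingManifold m →
      (∃ A : S.Algebroid m, S.IsClassifyingAlgebroid A) ∧
      ∀ A : S.Algebroid m, S.IsClassifyingAlgebroid A → ∀ p : P,
        Nonempty (S.symmetryGerms p ≃ₗ⁅ℝ⁆ A.Isotropy (S.classifyingMap p)) ∧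
        Module.Finite ℝ (S.symmetryGerms p) ∧
        (Module.finrank ℝ (S.symmetryGerms p) : ℤ) = Module.finrank ℝ E - m := by
  obtain ⟨d, hS⟩ := hS
  have hd : ∀ q, Module.finrank ℝ (differentials E (coframeInvariants S.coframe) q) = d := fun q => by
    rw [S.differentials_coframeInvariants]
    exact hS q
  refine ⟨?_, fun m _ _ hm => ?_⟩
  · obtain ⟨CS, hM, h1, h2⟩ := S.isCoframe.exists_isManifold_quotient S.isCoframeQuotientMap hd
    exact ⟨d, CS, hM, h1, h2⟩
  -- The smooth structure is now an arbitrary one for which `h` is a submersion; `d` enters only as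
  -- the rank of the invariants.
  · have hh : IsCoframeSubmersion (EuclideanSpace ℝ (Fin m)) S.coframe S.classifyingMap :=
      ⟨S.isCoframe, S.isCoframeQuotientMap, hm.smooth, hm.submersion⟩
    refine ⟨⟨hh.algebroid, fun f p v => ?_, fun η p ξ₁ ξ₂ h1 h2 => ?_⟩, fun A hA p => ?_⟩
    · rw [TrivialLieAlgebroid.dFunction, hh.isCoframeAlgebroid.anchor_coframe]
      exact hh.mvfderiv_comp f.contMDiff.contMDiffAt v
    · exact hh.isCoframeAlgebroid.extDerivForm_eq hh η h1 h2
    -- Functions and constant sections of the dual bundle already determine the anchor of `A` and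
    -- its brackets of constant sections.
    · have hA' : IsCoframeAlgebroid A S.coframe S.classifyingMap :=
        hh.isCoframeAlgebroid_of_pullback hd hA.pullback_d_function
          fun ℓ => hA.pullback_d_form (ContMDiffMap.const ℓ)
      rw [S.symmetryGerms_eq]
      obtain ⟨e⟩ := hA'.nonempty_lieEquiv hh hd p
      refine ⟨⟨e⟩, Module.Finite.equiv e.symm.toLinearEquiv, ?_⟩
      rw [e.toLinearEquiv.finrank_eq, hA'.finrank_isotropy hh, finrank_euclideanSpace_fin]
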